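/- Let $X$ be a complex Banach space, $1\le p<\infty$, let $(A,D(A))$ be the generator of a strongly continuous semigroup $(S(t))_{t\ge 0}$ on $X$ and let $\Phi:W^{1,p}([-1,0],X)\to X$ be a bounded linear operator. For $x\in X$, $f\in L^p([-1,0],X)$ and $s\ge 0$ define functions on $[-1,0]$ by $(S_sx)(\tau)=S(s+\tau)x$ if $-s<\tau\le 0$ and $(S_sx)(\tau)=0$ if $\tau\le -s$, and $(T_0(s)f)(\tau)=f(s+\tau)$ if $s+\tau\le 0$ and $(T_0(s)f)(\tau)=0$ otherwise. Assume that at least one of the following two conditions holds. (a) There is a function $q:(0,\infty)\to[0,\infty)$ with $\lim_{t\downarrow 0}q(t)=0$ such that $$\int_0^t\|\Phi(S_sx+T_0(s)f)\|\,ds\le q(t)\,\|(x,f)\|_{X\times L^p([-1,0],X)}$$ for all $t>0$ and all $(x,f)\in D(A)\times W^{1,p}([-1,0],X)$ with $f(0)=x$. (b) $p>1$ and there is a function $\eta:[-1,0]\to\mathcal L(X)$ of bounded variation such that $\Phi f=\int_{-1}^0 d\eta\, f$ (Riemann–Stieltjes integral) for all $f\in W^{1,p}([-1,0],X)$. On $\mathcal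 E=X\times L^p([-1,0],X)$ consider the operator $$\mathcal A\begin{pmatrix}x\\ f\end{pmatrix}=\begin{pmatrix}Ax+\Phi f\\ f'\end{pmatrix},\qquad D(\mathcal A)=\{(x,f)\in D(A)\times W^{1,p}([-1,0],X): f(0)=x\}.$$ For the generator $G$ of a strongly continuous semigroup $(T(t))_{t\ge0}$ let $\omega_0(G)=\inf\{\omega\in\mathbb R:\exists M>0\ \forall t\ge 0\ \|T(t)\|\le Me^{\omega t}\}\in[-\infty,\infty)$. For $\lambda\in\mathbb C$ let $\epsilon_\lambda\otimes \mathrm{Id}:X\to W^{1,p}([-1,0],X)$ be the operator $((\epsilon_\lambda\otimes \mathrm{Id})x)(s)=e^{\lambda s}x$, and let $R(\lambda,A)=(\lambda-A)^{-1}$ for $\lambda$ in the resolvent set of $A$. Suppose that $t\mapsto S(t)$ is continuous from $(0,\infty)$ to $\mathcal L(X)$ in the operator norm, that $\omega_0(A)<0$ and that $\alpha\in(\omega_0(A),0]$. If $$\sup_{\omega\in\mathbb R}\|\Phi(\epsilon_{\alpha+i\omega}\otimes \mathrm{Id})\|<\frac{1}{\sup_{\omega\in\mathbb R}\|R(\alpha+i\omega,A)\|}$$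 (with $1/0=\infty$), then $\mathcal A$ generates a strongly continuous semigroup on $\mathcal E$ and $\omega_0(\mathcal A)<\alpha\le 0$. -/

import Mathlib

open MeasureTheory Set Filter Topology
open scoped NNReal ENNReal

set_option linter.unusedSectionVars false

noncomputable section

/-! ### Strongly continuous semigroups, generators, resolvents -/

/-- A strongly continuous semigroup (`C₀`-semigroup) of bounded operators on `Y`. -/
structure C0Semigroup (Y : Type*) [NormedAddCommGroup Y] [NormedSpace ℂ Y] where
  toFun : ℝ≥0 → (Y →L[ℂ] Y)
  map_zero : toFun 0 = ContinuousLinearMap.id ℂ Y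
  map_add : ∀ s t, toFun (s + t) = (toFun s).comp (toFun t)
  continuous_orbit : ∀ y, Continuous fun t => toFun t y

namespace C0Semigroup

variable {Y : Type*} [NormedAddCommGroup Y] [NormedSpace ℂ Y]

/-- The graph of the generator: the pairs `(y, z)` such that `(T(h) y - y) / h → z` as `h ↓ 0`. -/
def generatorGraph (T : C0Semigroup Y) : Submodule ℂ (Y × Y) where
  carrier := {u | Tendsto (fun h : ℝ≥0 => (h : ℂ)⁻¹ • (T.toFun h u.1 - u.1)) (𝓝[>] 0) (𝓝 u.2)}
  add_mem' {u v} hu hv := by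
    have := Tendsto.add (show Tendsto _ _ _ from hu) (show Tendsto _ _ _ from hv)
    refine this.congr fun h => ?_
    rw [← smul_add]; congr 1; simp; abel
  zero_mem' := by simp
  smul_mem' c u hu := by
    have := Tendsto.const_smul (show Tendsto _ _ _ from hu) c
    refine this.congr fun h => ?_
    rw [smul_comm, smul_sub]; simp

theorem generatorGraph_single (T : C0Semigroup Y) :
    ∀ u ∈ T.generatorGraph, u.1 = 0 → u.2 = 0 := by
  rintro ⟨y, z⟩ hu rfl
  have h1 : Tendsto (fun h : ℝ≥0 => (h : ℂ)⁻¹ • (T.toFun h (0 : Y) - 0)) (𝓝[>] 0) (𝓝 z) := hu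
  simp only [ContinuousLinearMap.map_zero, sub_zero, smul_zero] at h1
  exact (tendsto_nhds_unique h1 tendsto_const_nhds)

/-- The generator of a strongly continuous semigroup, as a (partially defined) operator. -/
def generator (T : C0Semigroup Y) : Y →ₗ.[ℂ] Y := T.generatorGraph.toLinearPMap

theorem generator_graph (T : C0Semigroup Y) : T.generator.graph = T.generatorGraph :=
  Submodule.toLinearPMap_graph_eq _ T.generatorGraph_single

/-- The uniform growth bound `ω₀ = inf {ω | ∃ M > 0, ∀ t ≥ 0, ‖T(t)‖ ≤ M e^{ωt}}`, with values in
`[-∞, ∞]` (it is `-∞` for nilpotent semigroups, for instance). -/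
def growthBound (T : C0Semigroup Y) : EReal :=
  sInf ((fun r : ℝ => (r : EReal)) ''
    {r : ℝ | ∃ M : ℝ, 0 < M ∧ ∀ t : ℝ≥0, ‖T.toFun t‖ ≤ M * Real.exp (r * t)})

/-- Norm continuity of `t ↦ T(t)` on `(0, ∞)`. -/
def ImmediatelyNormContinuous (T : C0Semigroup Y) : Prop :=
  ContinuousOn T.toFun (Ioi 0)

end C0Semigroup

/-- `R` is a (bounded, everywhere defined) two-sided inverse of `l - A`. -/
def IsResolventAt {X : Type*} [NormedAddCommGroup X] [NormedSpace ℂ X]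
    (A : X →ₗ.[ℂ] X) (l : ℂ) (R : X →L[ℂ] X) : Prop :=
  (∀ y : X, ∃ h : R y ∈ A.domain, l • R y - A ⟨R y, h⟩ = y) ∧
    ∀ x : A.domain, R (l • (x : X) - A x) = x

open Classical in
/-- The resolvent `R(l, A) = (l - A)⁻¹` for `l` in the resolvent set of `A`
(and `0`, by convention, for the other `l`). -/
def unboundedResolvent {X : Type*} [NormedAddCommGroup X] [NormedSpace ℂ X]
    (A : X →ₗ.[ℂ] X) (l : ℂ) : X →L[ℂ] X :=
  if h : ∃ R : X →L[ℂ] X, IsResolventAt A l R then h.choose else 0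

/-! ### The spaces `L^p([-1,0], X)` and `W^{1,p}([-1,0], X)` -/

/-- Lebesgue measure on `[-1, 0]`. -/
abbrev delayMeasure : Measure ℝ := volume.restrict (Icc (-1 : ℝ) 0)

/-- `L^p([-1,0], X)`. -/
abbrev LpHistory (X : Type*) [NormedAddCommGroup X] (p : ℝ≥0∞) : Type _ :=
  Lp X p delayMeasure

section Sobolev

variable (X : Type*) [NormedAddCommGroup X] [NormedSpace ℂ X]
  (p : ℝ≥0∞) [Fact (1 ≤ p)]

theorem integrable_history {X : Type*} [NormedAddCommGroup X] {p : ℝ≥0∞} [hp : Fact (1 ≤ p)]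
    (g : LpHistory X p) : IntegrableOn g (Icc (-1 : ℝ) 0) volume :=
  (Lp.memLp g).integrable hp.out

theorem intervalIntegrable_history {X : Type*} [NormedAddCommGroup X] {p : ℝ≥0∞}
    [hp : Fact (1 ≤ p)] (g : LpHistory X p) {t : ℝ} (ht : t ∈ Icc (-1 : ℝ) 0) :
    IntervalIntegrable g volume 0 t := by
  refine ((integrable_history g).mono_set ?_).intervalIntegrable
  rw [uIcc_of_ge ht.2]
  exact Icc_subset_Icc_left ht.1

/-- The Sobolev space `W^{1,p}([-1,0], X)`: the pairs `(f, f')` of elements of `L^p([-1,0], X)`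
such that `f` is (a.e. equal to) a primitive of `f'`.  The norm is the maximum of `‖f‖_p` and
`‖f'‖_p`, which is equivalent to the usual one. -/
def W1p : Submodule ℂ (LpHistory X p × LpHistory X p) where
  carrier := {w | ∃ c : X, ∀ᵐ t ∂delayMeasure, w.1 t = c + ∫ r in (0 : ℝ)..t, w.2 r}
  zero_mem' := by
    refine ⟨0, ?_⟩
    filter_upwards [Lp.coeFn_zero X p delayMeasure,
      ae_restrict_mem (μ := volume) measurableSet_Icc] with t h ht
    have h2 : ∫ r in (0 : ℝ)..t, (0 : LpHistory X p) r = 0 := by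
      rw [intervalIntegral.integral_symm, intervalIntegral.integral_of_le ht.2, neg_eq_zero]
      refine integral_eq_zero_of_ae ?_
      have : (Ioc t 0 : Set ℝ) ⊆ Icc (-1) 0 := fun r hr => ⟨ht.1.trans hr.1.le, hr.2⟩
      exact ae_restrict_of_ae_restrict_of_subset this (Lp.coeFn_zero X p delayMeasure)
    change (0 : LpHistory X p) t = 0 + ∫ r in (0 : ℝ)..t, (0 : LpHistory X p) r
    rw [h2, h, Pi.zero_apply, add_zero]
  add_mem' := by
    rintro ⟨f, f'⟩ ⟨g, g'⟩ ⟨c, hc⟩ ⟨d, hd⟩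
    refine ⟨c + d, ?_⟩
    filter_upwards [hc, hd, Lp.coeFn_add f g,
      ae_restrict_mem (μ := volume) measurableSet_Icc] with t h1 h2 h3 ht
    have h4 : ∫ r in (0 : ℝ)..t, (f' + g') r
        = (∫ r in (0 : ℝ)..t, f' r) + ∫ r in (0 : ℝ)..t, g' r := by
      rw [← intervalIntegral.integral_add (intervalIntegrable_history f' ht)
        (intervalIntegrable_history g' ht), intervalIntegral.integral_symm,
        intervalIntegral.integral_symm t 0, intervalIntegral.integral_of_le ht.2,
        intervalIntegral.integral_of_le ht.2]
      congr 1
      refine integral_congr_ae ?_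
      have : (Ioc t 0 : Set ℝ) ⊆ Icc (-1) 0 := fun r hr => ⟨ht.1.trans hr.1.le, hr.2⟩
      exact ae_restrict_of_ae_restrict_of_subset this (Lp.coeFn_add f' g')
    change (f + g) t = c + d + ∫ r in (0 : ℝ)..t, (f' + g') r
    rw [h3, h4, Pi.add_apply, h1, h2]
    abel
  smul_mem' := by
    rintro a ⟨f, f'⟩ ⟨c, hc⟩
    refine ⟨a • c, ?_⟩
    filter_upwards [hc, Lp.coeFn_smul a f,
      ae_restrict_mem (μ := volume) measurableSet_Icc] with t h1 h3 ht
    have h4 : ∫ r in (0 : ℝ)..t, (a • f') r = a • ∫ r in (0 : ℝ)..t, f' r := by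
      rw [← intervalIntegral.integral_smul, intervalIntegral.integral_symm,
        intervalIntegral.integral_symm t 0, intervalIntegral.integral_of_le ht.2,
        intervalIntegral.integral_of_le ht.2]
      congr 1
      refine integral_congr_ae ?_
      have : (Ioc t 0 : Set ℝ) ⊆ Icc (-1) 0 := fun r hr => ⟨ht.1.trans hr.1.le, hr.2⟩
      exact ae_restrict_of_ae_restrict_of_subset this (Lp.coeFn_smul a f')
    change (a • f) t = a • c + ∫ r in (0 : ℝ)..t, (a • f') r
    rw [h3, h4, Pi.smul_apply, h1, smul_add]

variable {X p}

/-- The class in `L^p` of an element of `W^{1,p}`. -/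
def W1p.fn (w : W1p X p) : LpHistory X p := w.1.1

/-- The (weak) derivative of an element of `W^{1,p}`. -/
def W1p.deriv (w : W1p X p) : LpHistory X p := w.1.2


/-- `F` is the continuous representative on `[-1,0]` of the class `f`. -/
def IsContRep (f : LpHistory X p) (F : ℝ → X) : Prop :=
  ContinuousOn F (Icc (-1 : ℝ) 0) ∧ ∀ᵐ t ∂delayMeasure, f t = F t

/-- `f(0) = x`, where `f(0)` is the value at `0` of the continuous representative of `f`. -/
def HasValueAtZero (f : LpHistory X p) (x : X) : Prop :=
  ∃ F : ℝ → X, IsContRep f F ∧ F 0 = x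

theorem W1p.deriv_eq_zero [CompleteSpace X] (w : W1p X p) (h : (W1p.fn w) = 0) : (W1p.deriv w) = 0 := by
  obtain ⟨c, hc⟩ := w.2
  change ∀ᵐ t ∂delayMeasure, (W1p.fn w) t = c + ∫ r in (0 : ℝ)..t, (W1p.deriv w) r at hc
  have hint : IntervalIntegrable (W1p.deriv w) volume (-1) 0 :=
    (intervalIntegrable_history (W1p.deriv w) (by norm_num : (-1 : ℝ) ∈ Icc (-1 : ℝ) 0)).symm
  have hcont : ContinuousOn (fun t => c + ∫ r in (0 : ℝ)..t, (W1p.deriv w) r) (Icc (-1 : ℝ) 0) := by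
    have := intervalIntegral.continuousOn_primitive_interval'
      (μ := volume) (b₁ := -1) (b₂ := 0) (a := 0) hint (by simp)
    rw [uIcc_of_le (by norm_num)] at this
    exact continuousOn_const.add this
  have hae : (fun t => c + ∫ r in (0 : ℝ)..t, (W1p.deriv w) r) =ᵐ[delayMeasure] fun _ => 0 := by
    have h0 := Lp.coeFn_zero X p delayMeasure
    rw [← h] at h0
    filter_upwards [hc, h0] with t h1 h2
    rw [← h1, h2, Pi.zero_apply]
  have heq : EqOn (fun t => c + ∫ r in (0 : ℝ)..t, (W1p.deriv w) r) (fun _ => 0) (Icc (-1 : ℝ) 0) :=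
    Measure.eqOn_Icc_of_ae_eq volume (by norm_num) hae hcont continuousOn_const
  have hne : ∀ᵐ t ∂delayMeasure, t ∈ Ioo (-1 : ℝ) 0 := by
    change ∀ᵐ t ∂(volume.restrict (Icc (-1 : ℝ) 0)), t ∈ Ioo (-1 : ℝ) 0
    rw [← restrict_Ioo_eq_restrict_Icc]
    exact ae_restrict_mem measurableSet_Ioo
  rw [Lp.eq_zero_iff_ae_eq_zero]
  filter_upwards [ae_restrict_of_ae hint.ae_hasDerivAt_integral, hne] with t h1 h2
  have h3 : HasDerivAt (fun x => ∫ r in (0 : ℝ)..x, (W1p.deriv w) r) ((W1p.deriv w) t) t :=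
    h1 (by rw [uIcc_of_le (by norm_num)]; exact Ioo_subset_Icc_self h2) 0 (by simp)
  have h4 : HasDerivAt (fun x => c + ∫ r in (0 : ℝ)..x, (W1p.deriv w) r) ((W1p.deriv w) t) t :=
    h3.const_add c
  have h5 : (fun x => c + ∫ r in (0 : ℝ)..x, (W1p.deriv w) r) =ᶠ[𝓝 t] fun _ => (0 : X) := by
    filter_upwards [Icc_mem_nhds h2.1 h2.2] with x hx using heq hx
  exact h4.unique ((hasDerivAt_const t (0 : X)).congr_of_eventuallyEq h5)

/-- Elements of `W^{1,p}` are determined by their class in `L^p`. -/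
theorem W1p.ext_fn [CompleteSpace X] {v w : W1p X p} (h : (W1p.fn v) = (W1p.fn w)) : v = w := by
  have h1 : W1p.deriv (v - w) = 0 := W1p.deriv_eq_zero _ (by
    change (W1p.fn v) - (W1p.fn w) = 0
    rw [h, sub_self])
  have h2 : (W1p.deriv v) - (W1p.deriv w) = 0 := h1
  exact Subtype.ext (Prod.ext h (sub_eq_zero.1 h2))

theorem HasValueAtZero.zero : HasValueAtZero (0 : LpHistory X p) 0 :=
  ⟨fun _ => 0, ⟨continuousOn_const, Lp.coeFn_zero X p delayMeasure⟩, rfl⟩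

theorem HasValueAtZero.add {f g : LpHistory X p} {x y : X} (hf : HasValueAtZero f x)
    (hg : HasValueAtZero g y) : HasValueAtZero (f + g) (x + y) := by
  obtain ⟨F, ⟨hF, hF'⟩, rfl⟩ := hf
  obtain ⟨G, ⟨hG, hG'⟩, rfl⟩ := hg
  refine ⟨F + G, ⟨hF.add hG, ?_⟩, rfl⟩
  filter_upwards [hF', hG', Lp.coeFn_add f g] with t h1 h2 h3
  rw [h3, Pi.add_apply, Pi.add_apply, h1, h2]

theorem HasValueAtZero.smul {f : LpHistory X p} {x : X} (a : ℂ) (hf : HasValueAtZero f x) :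
    HasValueAtZero (a • f) (a • x) := by
  obtain ⟨F, ⟨hF, hF'⟩, rfl⟩ := hf
  refine ⟨a • F, ⟨hF.const_smul a, ?_⟩, rfl⟩
  filter_upwards [hF', Lp.coeFn_smul a f] with t h1 h3
  rw [h3, Pi.smul_apply, Pi.smul_apply, h1]

end Sobolev

/-! ### The delay operator -/

section Delay

variable {X : Type*} [NormedAddCommGroup X] [NormedSpace ℂ X]
  {p : ℝ≥0∞} [Fact (1 ≤ p)]

variable (X p) in
/-- The state space `X × L^p([-1,0], X)` (with the maximum norm, which is equivalent to the other
usual norms on the product). -/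
abbrev DelaySpace : Type _ := X × LpHistory X p

/-- The graph of the operator matrix `(A, Φ; 0, d/dσ)` with domain
`{(x, f) ∈ D(A) × W^{1,p}([-1,0], X) | f(0) = x}`. -/
def delayGraph (A : X →ₗ.[ℂ] X) (Φ : W1p X p →L[ℂ] X) :
    Submodule ℂ (DelaySpace X p × DelaySpace X p) where
  carrier := {u | ∃ (x : A.domain) (w : W1p X p), HasValueAtZero (W1p.fn w) (x : X) ∧
    u = (((x : X), (W1p.fn w)), (A x + Φ w, (W1p.deriv w)))}
  zero_mem' := ⟨0, 0, HasValueAtZero.zero, by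
    rw [LinearPMap.map_zero, ContinuousLinearMap.map_zero, add_zero]; rfl⟩
  add_mem' := by
    rintro _ _ ⟨x, v, hv, rfl⟩ ⟨y, w, hw, rfl⟩
    refine ⟨x + y, v + w, hv.add hw, ?_⟩
    rw [LinearPMap.map_add, ContinuousLinearMap.map_add, add_add_add_comm]
    rfl
  smul_mem' := by
    rintro a _ ⟨x, v, hv, rfl⟩
    refine ⟨a • x, a • v, hv.smul a, ?_⟩
    rw [LinearPMap.map_smul, ContinuousLinearMap.map_smul, ← smul_add]
    rfl

theorem delayGraph_single [CompleteSpace X] (A : X →ₗ.[ℂ] X) (Φ : W1p X p →L[ℂ] X) :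
    ∀ u ∈ delayGraph A Φ, u.1 = 0 → u.2 = 0 := by
  rintro u hu h
  obtain ⟨x, w, -, rfl⟩ := show ∃ (x : A.domain) (w : W1p X p), HasValueAtZero (W1p.fn w) (x : X) ∧
    u = (((x : X), W1p.fn w), (A x + Φ w, W1p.deriv w)) from hu
  have hx : (x : X) = 0 := congrArg Prod.fst h
  have hx' : x = 0 := Subtype.ext hx
  have hw : (W1p.fn w) = 0 := congrArg Prod.snd h
  have hw' : w = 0 := W1p.ext_fn (hw.trans rfl)
  subst hx' hw'
  change (A 0 + Φ 0, W1p.deriv (0 : W1p X p)) = 0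
  rw [LinearPMap.map_zero, ContinuousLinearMap.map_zero, add_zero]
  rfl

/-- The operator matrix `(A, Φ; 0, d/dσ)` associated with the delay equation
`u'(t) = A u(t) + Φ u_t`. -/
def delayOperator (A : X →ₗ.[ℂ] X) (Φ : W1p X p →L[ℂ] X) :
    DelaySpace X p →ₗ.[ℂ] DelaySpace X p :=
  (delayGraph A Φ).toLinearPMap

theorem delayOperator_graph [CompleteSpace X] (A : X →ₗ.[ℂ] X) (Φ : W1p X p →L[ℂ] X) :
    (delayOperator A Φ).graph = delayGraph A Φ :=
  Submodule.toLinearPMap_graph_eq _ (delayGraph_single A Φ)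

/-! ### The functions `ε_λ ⊗ x` -/

theorem memLp_smul_const {h : ℝ → ℂ} (hh : Continuous h) (x : X) :
    MemLp (fun t => h t • x) p delayMeasure := by
  obtain ⟨C, hC⟩ := (isCompact_Icc (a := (-1 : ℝ)) (b := 0)).exists_bound_of_continuousOn
    (hh.smul (continuous_const (y := x))).continuousOn
  refine MemLp.of_bound (hh.smul continuous_const).aestronglyMeasurable C ?_
  filter_upwards [ae_restrict_mem (μ := volume) measurableSet_Icc] with t ht using hC t ht

/-- The bounded operator `x ↦ h ⊗ x`, where `(h ⊗ x)(s) = h(s) x`, for continuous scalar `h`. -/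
def tensorLp {h : ℝ → ℂ} (hh : Continuous h) : X →L[ℂ] LpHistory X p :=
  LinearMap.mkContinuousOfExistsBound
    { toFun := fun x => (memLp_smul_const hh x).toLp (fun t => h t • x)
      map_add' := fun x y => by
        rw [← MemLp.toLp_add]
        refine MemLp.toLp_congr _ _ (Eventually.of_forall fun t => ?_)
        simp
      map_smul' := fun a x => by
        rw [RingHom.id_apply, ← MemLp.toLp_const_smul]
        refine MemLp.toLp_congr _ _ (Eventually.of_forall fun t => ?_)
        exact smul_comm _ _ _ } (by
    obtain ⟨C, hC⟩ := (isCompact_Icc (a := (-1 : ℝ)) (b := 0)).exists_bound_of_continuousOn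
      hh.continuousOn
    refine ⟨(delayMeasure univ).toReal ^ p.toReal⁻¹ * C, fun x => ?_⟩
    refine (Lp.norm_le_of_ae_bound (C := C * ‖x‖)
      (mul_nonneg ((norm_nonneg _).trans (hC 0 (by simp))) (norm_nonneg x)) ?_).trans ?_
    · filter_upwards [(memLp_smul_const (p := p) hh x).coeFn_toLp,
        ae_restrict_mem (μ := volume) measurableSet_Icc] with t h1 ht
      change ‖((memLp_smul_const hh x).toLp (fun t => h t • x)) t‖ ≤ _
      rw [h1, norm_smul]
      exact mul_le_mul_of_nonneg_right (hC t ht) (norm_nonneg x)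
    · rw [mul_assoc]
      exact le_of_eq rfl)

/-- The bounded operator `ε_l ⊗ Id : X → W^{1,p}([-1,0], X)`, `(ε_l ⊗ x)(s) = e^{l s} x`. -/
def expTensor (X : Type*) [NormedAddCommGroup X] [NormedSpace ℂ X] [CompleteSpace X]
    (p : ℝ≥0∞) [Fact (1 ≤ p)] (l : ℂ) : X →L[ℂ] W1p X p :=
  ((tensorLp (p := p) (X := X) (h := fun s => Complex.exp (l * s)) (by fun_prop)).prod
    (tensorLp (h := fun s => l * Complex.exp (l * s)) (by fun_prop))).codRestrict (W1p X p) (by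
      intro x
      refine ⟨x, ?_⟩
      have hd := (memLp_smul_const (p := p)
        (show Continuous fun s : ℝ => l * Complex.exp (l * s) by fun_prop) x).coeFn_toLp
      filter_upwards [(memLp_smul_const (p := p)
          (show Continuous fun s : ℝ => Complex.exp (l * s) by fun_prop) x).coeFn_toLp,
        ae_restrict_mem (μ := volume) measurableSet_Icc] with t h1 ht
      refine h1.trans ?_
      have h2 : ∫ r in (0 : ℝ)..t, ((memLp_smul_const (p := p)
            (show Continuous fun s : ℝ => l * Complex.exp (l * s) by fun_prop) x).toLp _) r
          = ∫ r in (0 : ℝ)..t, (l * Complex.exp (l * r)) • x := by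
        rw [intervalIntegral.integral_symm, intervalIntegral.integral_symm t 0,
          intervalIntegral.integral_of_le ht.2, intervalIntegral.integral_of_le ht.2]
        congr 1
        refine integral_congr_ae ?_
        have : (Ioc t 0 : Set ℝ) ⊆ Icc (-1) 0 := fun r hr => ⟨ht.1.trans hr.1.le, hr.2⟩
        exact ae_restrict_of_ae_restrict_of_subset this hd
      have h3 : ∀ r : ℝ, HasDerivAt (fun s : ℝ => Complex.exp (l * s) • x)
          ((l * Complex.exp (l * r)) • x) r := fun r => by
        have h4 : HasDerivAt (fun s : ℝ => Complex.exp (l * s)) (l * Complex.exp (l * r)) r := by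
          have h5 : HasDerivAt (fun s : ℝ => l * (s : ℂ)) l r := by
            simpa using (Complex.ofRealCLM.hasDerivAt (x := r)).const_mul l
          simpa [mul_comm] using h5.cexp
        exact h4.smul_const x
      have h6 : ∫ r in (0 : ℝ)..t, (l * Complex.exp (l * r)) • x
          = Complex.exp (l * t) • x - Complex.exp (l * (0 : ℝ)) • x :=
        intervalIntegral.integral_eq_sub_of_hasDerivAt (fun r _ => h3 r)
          (Continuous.intervalIntegrable (by fun_prop) _ _)
      refine Eq.trans ?_ (congrArg (x + ·) (h2.trans h6).symm)
      simp)

theorem expTensor_fn [CompleteSpace X] (l : ℂ) (x : X) :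
    ∀ᵐ t : ℝ ∂delayMeasure, W1p.fn (expTensor X p l x) t = Complex.exp (l * t) • x :=
  (memLp_smul_const (p := p)
    (show Continuous fun s : ℝ => Complex.exp (l * s) by fun_prop) x).coeFn_toLp

/-! ### History segments of the undelayed equation and the condition on `Φ` -/

/-- A primitive of a function in `L^p`, as an element of `W^{1,p}`. -/
theorem W1p.exists_primitive [CompleteSpace X] (c : X) (g : LpHistory X p) :
    ∃ w : W1p X p, ∀ᵐ t ∂delayMeasure, W1p.fn w t = c + ∫ r in (0 : ℝ)..t, g r := by
  have hint : IntervalIntegrable g volume (-1) 0 :=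
    (intervalIntegrable_history g (by norm_num : (-1 : ℝ) ∈ Icc (-1 : ℝ) 0)).symm
  have hcont : ContinuousOn (fun t => c + ∫ r in (0 : ℝ)..t, g r) (Icc (-1 : ℝ) 0) := by
    have := intervalIntegral.continuousOn_primitive_interval'
      (μ := volume) (b₁ := -1) (b₂ := 0) (a := 0) hint (by simp)
    rw [uIcc_of_le (by norm_num)] at this
    exact continuousOn_const.add this
  obtain ⟨C, hC⟩ := isCompact_Icc.exists_bound_of_continuousOn hcont
  have hmem : MemLp (fun t => c + ∫ r in (0 : ℝ)..t, g r) p delayMeasure := by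
    refine MemLp.of_bound (hcont.aestronglyMeasurable measurableSet_Icc) C ?_
    filter_upwards [ae_restrict_mem (μ := volume) measurableSet_Icc] with t ht using hC t ht
  exact ⟨⟨(hmem.toLp _, g), c, hmem.coeFn_toLp⟩, hmem.coeFn_toLp⟩

theorem C0Semigroup.continuous_real (S : C0Semigroup X) (x : X) :
    Continuous fun r : ℝ => S.toFun r.toNNReal x :=
  (S.continuous_orbit x).comp continuous_real_toNNReal

theorem C0Semigroup.integral_orbit [CompleteSpace X] (S : C0Semigroup X)
    (x : S.generator.domain) {r : ℝ} (hr : 0 ≤ r) :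
    S.toFun r.toNNReal (x : X) = x + ∫ q in (0 : ℝ)..r, S.toFun q.toNNReal (S.generator x) := by
  have hx : Tendsto (fun h : ℝ≥0 => (h : ℂ)⁻¹ • (S.toFun h (x : X) - x)) (𝓝[>] 0)
      (𝓝 (S.generator x)) := by
    have : ((x : X), S.generator x) ∈ S.generatorGraph := by
      rw [← S.generator_graph]; exact S.generator.mem_graph x
    exact this
  have hx' : Tendsto (fun h : ℝ => h⁻¹ • (S.toFun h.toNNReal (x : X) - x)) (𝓝[>] 0)
      (𝓝 (S.generator x)) := by
    have ht : Tendsto Real.toNNReal (𝓝[>] 0) (𝓝[>] 0) := by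
      refine tendsto_nhdsWithin_iff.2 ⟨?_, ?_⟩
      · have := (continuous_real_toNNReal.tendsto 0).mono_left
          (nhdsWithin_le_nhds (s := Ioi (0 : ℝ)))
        simpa using this
      · filter_upwards [self_mem_nhdsWithin] with a ha using Real.toNNReal_pos.2 ha
    refine (hx.comp ht).congr' ?_
    filter_upwards [self_mem_nhdsWithin] with h hh
    have hh' : (0 : ℝ) < h := hh
    change ((h.toNNReal : ℝ) : ℂ)⁻¹ • _ = _
    rw [Real.coe_toNNReal h hh'.le, ← Complex.ofReal_inv, Complex.coe_smul]
  have hder : ∀ q ∈ Ico (0 : ℝ) r, HasDerivWithinAt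
      (fun q : ℝ => S.toFun q.toNNReal (x : X)) (S.toFun q.toNNReal (S.generator x)) (Ici q) q := by
    intro q hq
    rw [← hasDerivWithinAt_Ioi_iff_Ici, hasDerivWithinAt_iff_tendsto_slope' (by simp)]
    have h1 : Tendsto (fun z : ℝ => z - q) (𝓝[>] q) (𝓝[>] 0) := by
      refine tendsto_nhdsWithin_iff.2 ⟨?_, ?_⟩
      · have : Tendsto (fun z : ℝ => z - q) (𝓝 q) (𝓝 (q - q)) := by
          exact (continuous_id.sub continuous_const).tendsto q
        rw [sub_self] at this
        exact this.mono_left nhdsWithin_le_nhds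
      · filter_upwards [self_mem_nhdsWithin] with a ha using sub_pos.2 (show q < a from ha)
    have h2 := ((S.toFun q.toNNReal).continuous.tendsto _).comp (hx'.comp h1)
    refine h2.congr' ?_
    filter_upwards [self_mem_nhdsWithin] with z hz
    have hz' : q < z := hz
    have h3 : z.toNNReal = q.toNNReal + (z - q).toNNReal := by
      rw [← Real.toNNReal_add hq.1 (sub_pos.2 hz').le]; congr 1; ring
    simp only [Function.comp, slope_def_module]
    rw [h3, S.map_add, ContinuousLinearMap.comp_apply, ← map_sub]
    exact (S.toFun q.toNNReal).map_smul_of_tower _ _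
  have hc := S.continuous_real (S.generator x)
  have key := constant_of_has_deriv_right_zero (a := 0) (b := r)
    (f := fun q : ℝ => S.toFun q.toNNReal (x : X) -
      ∫ z in (0 : ℝ)..q, S.toFun z.toNNReal (S.generator x))
    ((S.continuous_real x).sub
      (intervalIntegral.continuous_primitive (fun a b => hc.intervalIntegrable a b) 0)).continuousOn
    (fun q hq => by
      have := (hder q hq).sub (hc.integral_hasStrictDerivAt 0 q).hasDerivAt.hasDerivWithinAt
      rwa [sub_self] at this) r ⟨hr, le_rfl⟩
  simp only [Real.toNNReal_zero, S.map_zero, intervalIntegral.integral_same, sub_zero,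
    ContinuousLinearMap.id_apply] at key
  exact sub_eq_iff_eq_add.1 key

/-- `w ∈ W^{1,p}([-1,0], X)` is the function equal to `S(s+τ)x` for `-s < τ ≤ 0` and to `f(s+τ)`
for `-1 ≤ τ ≤ -s`. -/
def IsSegment (S : C0Semigroup X) (x : X) (f : LpHistory X p) (s : ℝ≥0) (w : W1p X p) : Prop :=
  ∀ᵐ τ : ℝ ∂delayMeasure,
    W1p.fn w τ = if -(s : ℝ) < τ then S.toFun (s + τ).toNNReal x else f (s + τ)

theorem exists_isSegment [CompleteSpace X] (S : C0Semigroup X) (x : S.generator.domain)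
    (v : W1p X p) (hv : HasValueAtZero (W1p.fn v) (x : X)) (s : ℝ≥0) :
    ∃ w : W1p X p, IsSegment S (x : X) (W1p.fn v) s w := by
  set y := S.generator x with hy
  obtain ⟨c, hc⟩ := v.2
  change ∀ᵐ t ∂delayMeasure, W1p.fn v t = c + ∫ r in (0 : ℝ)..t, W1p.deriv v r at hc
  set g := W1p.deriv v with hg
  have hcx : c = x := by
    obtain ⟨F, ⟨hF, hF'⟩, h0⟩ := hv
    have hint : IntervalIntegrable g volume (-1) 0 :=
      (intervalIntegrable_history g (by norm_num : (-1 : ℝ) ∈ Icc (-1 : ℝ) 0)).symm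
    have hcont : ContinuousOn (fun t => c + ∫ r in (0 : ℝ)..t, g r) (Icc (-1 : ℝ) 0) := by
      have := intervalIntegral.continuousOn_primitive_interval'
        (μ := volume) (b₁ := -1) (b₂ := 0) (a := 0) hint (by simp)
      rw [uIcc_of_le (by norm_num)] at this
      exact continuousOn_const.add this
    have hae : (fun t => c + ∫ r in (0 : ℝ)..t, g r) =ᵐ[delayMeasure] F := by
      filter_upwards [hc, hF'] with t h1 h2
      rw [← h1, h2]
    have := Measure.eqOn_Icc_of_ae_eq volume (by norm_num) hae hcont hF
      (show (0 : ℝ) ∈ Icc (-1 : ℝ) 0 by simp)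
    simpa [h0] using this
  subst hcx
  set G1 : ℝ → X := (Icc (-1 : ℝ) 0).indicator g with hG1
  set G2 : ℝ → X := (Ioi (0 : ℝ)).indicator (fun r => S.toFun r.toNNReal y) with hG2
  have hm1 : MemLp G1 p volume :=
    (memLp_indicator_iff_restrict measurableSet_Icc).2 (Lp.memLp g)
  have hi1 : Integrable G1 volume :=
    (integrable_indicator_iff measurableSet_Icc).2 (integrable_history g)
  have hcy := S.continuous_real y
  have hi2 : ∀ a b, IntervalIntegrable G2 volume a b := fun a b =>
    ⟨(hcy.intervalIntegrable a b).1.indicator measurableSet_Ioi,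
      (hcy.intervalIntegrable a b).2.indicator measurableSet_Ioi⟩
  have hmp := measurePreserving_add_left (volume : Measure ℝ) (s : ℝ)
  have hs1 : MemLp (fun τ : ℝ => G1 (s + τ)) p delayMeasure :=
    (hm1.comp_measurePreserving hmp).restrict _
  have hs2 : MemLp (fun τ : ℝ => G2 (s + τ)) p delayMeasure := by
    obtain ⟨C, hC⟩ := (isCompact_Icc (a := (-1 : ℝ)) (b := 0)).exists_bound_of_continuousOn
      (f := fun τ : ℝ => S.toFun (s + τ).toNNReal y)
      (hcy.comp (continuous_const.add continuous_id)).continuousOn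
    refine MemLp.of_bound ?_ C ?_
    · exact ((hcy.stronglyMeasurable.indicator measurableSet_Ioi).comp_measurable
        (measurable_const_add (s : ℝ))).aestronglyMeasurable
    · filter_upwards [ae_restrict_mem (μ := volume) measurableSet_Icc] with t ht
      exact (norm_indicator_le_norm_self _ _).trans (hC t ht)
  have hs := hs1.add hs2
  obtain ⟨w, hw⟩ := W1p.exists_primitive (S.toFun s (x : X)) (hs.toLp _)
  have hshift : ∀ᵐ τ : ℝ ∂volume, (s : ℝ) + τ ∈ Icc (-1 : ℝ) 0 →
      W1p.fn v (s + τ) = x + ∫ r in (0 : ℝ)..(s + τ), g r :=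
    hmp.quasiMeasurePreserving.ae ((ae_restrict_iff' measurableSet_Icc).1 hc)
  refine ⟨w, ?_⟩
  have hSs : S.toFun s (x : X) = x + ∫ q in (0 : ℝ)..s, S.toFun q.toNNReal y := by
    simpa using S.integral_orbit x s.2
  filter_upwards [hw, ae_restrict_of_ae hshift,
    ae_restrict_mem (μ := volume) measurableSet_Icc] with τ h1 h2 ht
  have h3 : ∫ r in (0 : ℝ)..τ, (hs.toLp _) r = ∫ r in (0 : ℝ)..τ, (G1 (s + r) + G2 (s + r)) := by
    rw [intervalIntegral.integral_symm, intervalIntegral.integral_symm τ 0,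
      intervalIntegral.integral_of_le ht.2, intervalIntegral.integral_of_le ht.2]
    congr 1
    refine integral_congr_ae ?_
    have : (Ioc τ 0 : Set ℝ) ⊆ Icc (-1) 0 := fun r hr => ⟨ht.1.trans hr.1.le, hr.2⟩
    exact ae_restrict_of_ae_restrict_of_subset this hs.coeFn_toLp
  have h4 : ∫ r in (0 : ℝ)..τ, (G1 (s + r) + G2 (s + r)) = ∫ r in (s : ℝ)..(s + τ), (G1 r + G2 r) := by
    rw [intervalIntegral.integral_comp_add_left (fun r => G1 r + G2 r) (s : ℝ), add_zero]
  have hiG : ∀ a b, IntervalIntegrable (fun r => G1 r + G2 r) volume a b := fun a b =>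
    hi1.intervalIntegrable.add (hi2 a b)
  have hpos : ∀ z : ℝ, 0 ≤ z → ∫ r in (0 : ℝ)..z, (G1 r + G2 r)
      = ∫ r in (0 : ℝ)..z, S.toFun r.toNNReal y := by
    intro z hz
    refine intervalIntegral.integral_congr_ae (Eventually.of_forall fun r hr => ?_)
    rw [uIoc_of_le hz] at hr
    have e1 : G1 r = 0 := indicator_of_notMem (fun h => not_lt.2 h.2 hr.1) _
    have e2 : G2 r = S.toFun r.toNNReal y := indicator_of_mem hr.1 _
    rw [e1, e2, zero_add]
  have hneg : ∀ z ∈ Icc (-1 : ℝ) 0, ∫ r in (0 : ℝ)..z, (G1 r + G2 r)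
      = ∫ r in (0 : ℝ)..z, g r := by
    intro z hz
    refine intervalIntegral.integral_congr_ae (Eventually.of_forall fun r hr => ?_)
    rw [uIoc_of_ge hz.2] at hr
    have hr' : r ∈ Icc (-1 : ℝ) 0 := ⟨hz.1.trans hr.1.le, hr.2⟩
    have e1 : G1 r = g r := indicator_of_mem hr' _
    have e2 : G2 r = 0 := indicator_of_notMem (fun h => not_lt.2 hr.2 h) _
    rw [e1, e2, add_zero]
  have hsplit : ∫ r in (s : ℝ)..(s + τ), (G1 r + G2 r)
      = (∫ r in (0 : ℝ)..(s + τ), (G1 r + G2 r)) - ∫ r in (0 : ℝ)..s, (G1 r + G2 r) :=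
    (intervalIntegral.integral_interval_sub_left (hiG _ _) (hiG _ _)).symm
  rw [h1, h3, h4, hsplit, hpos s s.2, hSs]
  split_ifs with hτ
  · have h5 : 0 ≤ (s : ℝ) + τ := by linarith
    rw [hpos _ h5, S.integral_orbit x h5]
    abel
  · have h5 : (s : ℝ) + τ ∈ Icc (-1 : ℝ) 0 := ⟨by linarith [ht.1, s.2], by linarith⟩
    rw [hneg _ h5, h2 h5]
    abel

/-- The element `S_s x + T₀(s) f` of `W^{1,p}([-1,0], X)`, for `x` in the domain of the generator of
`S` and `f ∈ W^{1,p}([-1,0], X)` with `f(0) = x`, where `T₀` is the nilpotent left shift semigroup and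
`(S_s x)(τ) = S(s+τ)x` for `-s < τ ≤ 0`, `(S_s x)(τ) = 0` for `τ ≤ -s`
(it is unique, by `W1p.ext_fn`). -/
def historySegment [CompleteSpace X] (S : C0Semigroup X) (x : S.generator.domain)
    (f : W1p X p) (hf : HasValueAtZero (W1p.fn f) (x : X)) (s : ℝ≥0) : W1p X p :=
  (exists_isSegment S x f hf s).choose

theorem historySegment_spec [CompleteSpace X] (S : C0Semigroup X) (x : S.generator.domain)
    (f : W1p X p) (hf : HasValueAtZero (W1p.fn f) (x : X)) (s : ℝ≥0) :
    IsSegment S (x : X) (W1p.fn f) s (historySegment S x f hf s) :=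
  (exists_isSegment S x f hf s).choose_spec

/-- Condition (K): there is `q : (0, ∞) → [0, ∞)` with `q(t) → 0` as `t ↓ 0` and
`∫₀ᵗ ‖Φ(S_s x + T₀(s) f)‖ ds ≤ q(t) ‖(x, f)‖` for all `t > 0` and all
`(x, f) ∈ D(A) × W^{1,p}` with `f(0) = x`. -/
def ConditionK [CompleteSpace X] (S : C0Semigroup X) (Φ : W1p X p →L[ℂ] X) : Prop :=
  ∃ q : ℝ → ℝ≥0, Tendsto q (𝓝[>] 0) (𝓝 0) ∧
    ∀ (x : S.generator.domain) (f : W1p X p) (hf : HasValueAtZero (W1p.fn f) (x : X)) (t : ℝ),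
      0 < t → ∫⁻ s in Ioc (0 : ℝ) t, ‖Φ (historySegment S x f hf s.toNNReal)‖ₑ
        ≤ q t * ‖(((x : X), W1p.fn f) : DelaySpace X p)‖ₑ

/-- `y` is the Riemann-Stieltjes integral `∫_{-1}^0 dη F`: the limit of the sums
`∑ (η(t_{i+1}) - η(t_i)) F(ξ_i)` over tagged partitions of `[-1,0]`, as the mesh tends to `0`. -/
def IsRiemannStieltjes (η : ℝ → (X →L[ℂ] X)) (F : ℝ → X) (y : X) : Prop :=
  ∀ ε : ℝ, 0 < ε → ∃ δ : ℝ, 0 < δ ∧ ∀ (n : ℕ) (t ξ : ℕ → ℝ), t 0 = -1 → t n = 0 →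
    (∀ i < n, t i ≤ ξ i ∧ ξ i ≤ t (i + 1) ∧ t (i + 1) - t i < δ) →
    ‖(∑ i ∈ Finset.range n, (η (t (i + 1)) - η (t i)) (F (ξ i))) - y‖ < ε

/-- `Φ f = ∫_{-1}^0 dη f` for some `η : [-1,0] → 𝓛(X)` of bounded variation (with respect to the
operator norm), the integral being that of the continuous representative of `f`. -/
def IsStieltjesDelay (Φ : W1p X p →L[ℂ] X) : Prop :=
  ∃ η : ℝ → (X →L[ℂ] X), BoundedVariationOn η (Icc (-1 : ℝ) 0) ∧
    ∀ (f : W1p X p) (F : ℝ → X), IsContRep (W1p.fn f) F → IsRiemannStieltjes η F (Φ f)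

end Delay

end

/-!
# Stability of delay equations with immediately norm continuous undelayed part

*The undelayed problem.*  Without `Φ`, the state `(x, f)` evolves by
`T₀(t)(x, f) = (S(t) x, S_t x + T₀(t) f)`.  This semigroup (`undelayedSemigroup`) is obtained by
gluing `f` to the orbit `S(·) x` to a function on the line (`lineExtension`), translating in
`L^p(ℝ)` and restricting to `[-1,0]`, so its strong continuity is that of translations.  After
time `1` only the orbit is visible, hence `T₀` is norm continuous on `(1, ∞)`.

*Generation.*  By `ConditionK`, the delay term `s ↦ e^{-ωs} Φ(S_s x + T₀(s) f)` defines, for a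
large weight `ω`, an operator of norm at most `1/2` from a dense domain into `L¹(0, ∞)`.  The
variation of constants equation is then a contractive affine fixed point equation for an operator
from the state space to the bounded continuous functions on `[0, ∞)`.  Uniqueness of the fixed
point gives the semigroup law (`volterra_solution_add`), and norm continuity on `(1, ∞)` passes
from `T₀` to the fixed point (`continuousOn_perturbedSemigroup`).  The result is
`exists_delaySemigroup`: a semigroup that is norm continuous on `(1, ∞)` and whose generator
contains `𝒜`.  A Riemann–Stieltjes delay with `p > 1` satisfies `ConditionK` by Fatou's lemma and
Hölder's inequality (`IsStieltjesDelay.conditionK`).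

*The characteristic equation.*  The hypothesis bounds `R(l, A) Φ(ε_l ⊗ Id)` by a constant `c < 1`
on the line `Re l = α`.  As this function is analytic, of at most linear growth on the half plane
and bounded on the positive real axis, the Phragmén–Lindelöf principle gives the same bound for
all `Re l ≥ α` (`exists_norm_resolvent_comp_le`).  Hence `x = R(l, A) (Φ(ε_l ⊗ x) + y)` can be
solved, and `l - 𝒜` is bounded below and surjective (`delayGraph_lower_bound`,
`delayGraph_surjective`).  For one `l` with large real part this shows that `𝒜` is the whole
generator (`C0Semigroup.generator_eq_of_le`).

*From the generator to the growth bound.*  A point of maximal modulus of the spectrum of `T(2)` is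
an approximate eigenvalue.  Norm continuity on `(1, ∞)` makes the operators `T(2 + s)`,
`0 ≤ s ≤ 2`, integrable in operator norm, so that trigonometric polynomials peaking at `s = 1`
recover `T(3)`, up to a small error, from the Fourier coefficients of `s ↦ T(2 + s)`.  An
approximate eigenvalue of `T(2)` of modulus at least `e^{2α}` would therefore yield an approximate
eigenvalue of the generator in `Re l ≥ α`, which the lower bounds exclude
(`C0Semigroup.exists_norm_le_sub_apply_two`).  So the spectral radius of `T(2)` is below `e^{2α}`,
and the growth bound is below `α` (`C0Semigroup.growthBound_lt_of_lower_bound`).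
-/

noncomputable section

open scoped BoundedContinuousFunction

/-! ### Strongly continuous semigroups -/

namespace C0Semigroup

variable {Y : Type*} [NormedAddCommGroup Y] [NormedSpace ℂ Y]

/-- The generator as a right derivative of orbits at `0`, with time in `ℝ`. -/
theorem mem_generatorGraph_iff (T : C0Semigroup Y) (y z : Y) :
    (y, z) ∈ T.generatorGraph ↔
      HasDerivWithinAt (fun r : ℝ => T.toFun r.toNNReal y) z (Ici 0) 0 := by
  rw [← hasDerivWithinAt_Ioi_iff_Ici, hasDerivWithinAt_iff_tendsto_slope' (by simp)]
  have e1 : (slope (fun r : ℝ => T.toFun r.toNNReal y) 0) =ᶠ[𝓝[>] (0 : ℝ)]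
      fun h : ℝ => h⁻¹ • (T.toFun h.toNNReal y - y) := by
    filter_upwards with h
    simp [slope_def_module, T.map_zero]
  rw [tendsto_congr' e1]
  constructor
  · intro hx
    have hx : Tendsto (fun h : ℝ≥0 => (h : ℂ)⁻¹ • (T.toFun h y - y)) (𝓝[>] 0) (𝓝 z) := hx
    have ht : Tendsto Real.toNNReal (𝓝[>] 0) (𝓝[>] 0) := by
      refine tendsto_nhdsWithin_iff.2 ⟨?_, ?_⟩
      · have := (continuous_real_toNNReal.tendsto 0).mono_left
          (nhdsWithin_le_nhds (s := Ioi (0 : ℝ)))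
        simpa using this
      · filter_upwards [self_mem_nhdsWithin] with a ha using Real.toNNReal_pos.2 ha
    refine (hx.comp ht).congr' ?_
    filter_upwards [self_mem_nhdsWithin] with h hh
    have hh' : (0 : ℝ) < h := hh
    change ((h.toNNReal : ℝ) : ℂ)⁻¹ • _ = _
    rw [Real.coe_toNNReal h hh'.le, ← Complex.ofReal_inv, Complex.coe_smul]
  · intro hx
    have ht : Tendsto (fun h : ℝ≥0 => (h : ℝ)) (𝓝[>] 0) (𝓝[>] 0) := by
      refine tendsto_nhdsWithin_iff.2 ⟨?_, ?_⟩
      · have := (NNReal.continuous_coe.tendsto 0).mono_left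
          (nhdsWithin_le_nhds (s := Ioi (0 : ℝ≥0)))
        simpa using this
      · filter_upwards [self_mem_nhdsWithin] with a ha
        exact NNReal.coe_pos.2 ha
    refine (hx.comp ht).congr fun h => ?_
    change (h : ℝ)⁻¹ • (T.toFun (h : ℝ).toNNReal y - y) = ((h : ℝ) : ℂ)⁻¹ • _
    rw [Real.toNNReal_coe, ← Complex.ofReal_inv, Complex.coe_smul]

/-- The rescaled semigroup `e^{-lt} T(t)`. -/
def rescale (T : C0Semigroup Y) (l : ℂ) : C0Semigroup Y where
  toFun t := Complex.exp (-l * t) • T.toFun t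
  map_zero := by simp [T.map_zero]
  map_add s t := by
    rw [T.map_add]
    ext y
    simp only [NNReal.coe_add, Complex.ofReal_add, mul_add, Complex.exp_add,
      _root_.smul_apply, ContinuousLinearMap.comp_apply, map_smul, smul_smul]
    rw [mul_comm]
  continuous_orbit y := by
    have := T.continuous_orbit y
    simp only [_root_.smul_apply]
    fun_prop

theorem rescale_apply (T : C0Semigroup Y) (l : ℂ) (t : ℝ≥0) (y : Y) :
    (T.rescale l).toFun t y = Complex.exp (-l * t) • T.toFun t y := rfl

theorem rescale_real (T : C0Semigroup Y) (l : ℂ) {t : ℝ} (ht : 0 ≤ t) (y : Y) :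
    (T.rescale l).toFun t.toNNReal y = Complex.exp (-l * t) • T.toFun t.toNNReal y := by
  rw [rescale_apply, Real.coe_toNNReal t ht]

theorem map_add_real (T : C0Semigroup Y) {s t : ℝ} (hs : 0 ≤ s) (ht : 0 ≤ t) :
    T.toFun (s + t).toNNReal = (T.toFun s.toNNReal).comp (T.toFun t.toNNReal) := by
  rw [Real.toNNReal_add hs ht, T.map_add]

theorem hasDerivAt_cexp (l : ℂ) (r : ℝ) :
    HasDerivAt (fun s : ℝ => Complex.exp (l * s)) (l * Complex.exp (l * r)) r := by
  have h5 : HasDerivAt (fun s : ℝ => l * (s : ℂ)) l r := by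
    simpa using (Complex.ofRealCLM.hasDerivAt (x := r)).const_mul l
  simpa [mul_comm] using h5.cexp

theorem mem_rescale_generatorGraph (T : C0Semigroup Y) (l : ℂ) {y z : Y}
    (h : (y, z) ∈ T.generatorGraph) : (y, z - l • y) ∈ (T.rescale l).generatorGraph := by
  rw [mem_generatorGraph_iff] at h ⊢
  have h1 := ((hasDerivAt_cexp (-l) 0).hasDerivWithinAt (s := Ici 0)).smul h
  simp only [Complex.ofReal_zero, mul_zero, Complex.exp_zero, one_smul, Real.toNNReal_zero,
    T.map_zero, ContinuousLinearMap.id_apply, mul_one, neg_smul, ← sub_eq_add_neg] at h1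
  refine h1.congr_of_mem (fun r hr => ?_) (by simp)
  exact T.rescale_real l hr y

theorem rescale_rescale (T : C0Semigroup Y) (l : ℂ) (t : ℝ≥0) :
    ((T.rescale l).rescale (-l)).toFun t = T.toFun t := by
  ext y
  rw [rescale_apply, rescale_apply, smul_smul, ← Complex.exp_add]
  simp

theorem mem_generatorGraph_of_rescale (T : C0Semigroup Y) (l : ℂ) {y z : Y}
    (h : (y, z) ∈ (T.rescale l).generatorGraph) : (y, z + l • y) ∈ T.generatorGraph := by
  have h1 := mem_rescale_generatorGraph _ (-l) h
  rw [mem_generatorGraph_iff] at h1 ⊢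
  rw [neg_smul, sub_neg_eq_add] at h1
  simpa only [rescale_rescale] using h1

theorem continuous_toNNReal (T : C0Semigroup Y) (y : Y) :
    Continuous fun r : ℝ => T.toFun r.toNNReal y :=
  (T.continuous_orbit y).comp continuous_real_toNNReal

variable [CompleteSpace Y]

theorem integral_mem_generatorGraph (T : C0Semigroup Y) (y : Y) {t : ℝ} (ht : 0 ≤ t) :
    (∫ s in (0 : ℝ)..t, T.toFun s.toNNReal y, T.toFun t.toNNReal y - y) ∈ T.generatorGraph := by
  rw [mem_generatorGraph_iff]
  have hc := T.continuous_toNNReal y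
  have hi : ∀ a b, IntervalIntegrable (fun s : ℝ => T.toFun s.toNNReal y) volume a b :=
    fun a b => hc.intervalIntegrable a b
  have h1 : HasDerivAt (fun r : ℝ => (∫ s in (0 : ℝ)..(t + r), T.toFun s.toNNReal y)
      - ∫ s in (0 : ℝ)..r, T.toFun s.toNNReal y) (T.toFun t.toNNReal y - y) 0 := by
    have h2 := (hc.integral_hasStrictDerivAt 0 (t + 0)).hasDerivAt
    have h3 : HasDerivAt (fun r : ℝ => t + r) 1 0 := (hasDerivAt_id _).const_add t
    have h4 := h2.scomp (0 : ℝ) h3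
    have h5 := h4.sub (hc.integral_hasStrictDerivAt 0 0).hasDerivAt
    simp only [one_smul, add_zero, Real.toNNReal_zero, T.map_zero, ContinuousLinearMap.id_apply]
      at h5
    exact h5
  refine h1.hasDerivWithinAt.congr_of_mem (fun r hr => ?_) (by simp)
  rw [← ContinuousLinearMap.intervalIntegral_comp_comm _ (hi _ _),
    intervalIntegral.integral_interval_sub_left (hi _ _) (hi _ _)]
  have h6 : ∫ s in (0 : ℝ)..t, T.toFun r.toNNReal (T.toFun s.toNNReal y)
      = ∫ s in (0 : ℝ)..t, T.toFun (s + r).toNNReal y := by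
    refine intervalIntegral.integral_congr fun s hs => ?_
    rw [uIcc_of_le ht] at hs
    rw [add_comm, map_add_real _ hr hs.1]; rfl
  rw [h6, intervalIntegral.integral_comp_add_right (fun s => T.toFun s.toNNReal y), zero_add]

/-- `∫₀ᵗ e^{-ls} T(s) y ds` lies in the domain of the generator. -/
theorem integral_exp_mem_generatorGraph (T : C0Semigroup Y) (l : ℂ) (y : Y) {t : ℝ}
    (ht : 0 ≤ t) :
    (∫ s in (0 : ℝ)..t, Complex.exp (-l * s) • T.toFun s.toNNReal y,
      Complex.exp (-l * t) • T.toFun t.toNNReal y - y +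
        l • ∫ s in (0 : ℝ)..t, Complex.exp (-l * s) • T.toFun s.toNNReal y)
      ∈ T.generatorGraph := by
  have h1 := (T.rescale l).integral_mem_generatorGraph y ht
  have h2 : ∫ s in (0 : ℝ)..t, (T.rescale l).toFun s.toNNReal y
      = ∫ s in (0 : ℝ)..t, Complex.exp (-l * s) • T.toFun s.toNNReal y := by
    refine intervalIntegral.integral_congr fun s hs => ?_
    rw [uIcc_of_le ht] at hs
    exact T.rescale_real l hs.1 y
  rw [h2, rescale_real _ _ ht] at h1
  exact T.mem_generatorGraph_of_rescale l h1

theorem orbit_eq (T : C0Semigroup Y) {y z : Y} (h : (y, z) ∈ T.generatorGraph) {t : ℝ}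
    (ht : 0 ≤ t) : T.toFun t.toNNReal y = y + ∫ s in (0 : ℝ)..t, T.toFun s.toNNReal z := by
  rw [← T.generator_graph, LinearPMap.mem_graph_iff] at h
  obtain ⟨x, rfl, rfl⟩ := h
  exact T.integral_orbit x ht

theorem rescale_norm_le (T : C0Semigroup Y) (l : ℂ) {M r : ℝ}
    (hM : ∀ t : ℝ≥0, ‖T.toFun t‖ ≤ M * Real.exp (r * t)) (t : ℝ≥0) :
    ‖(T.rescale l).toFun t‖ ≤ M * Real.exp ((r - l.re) * t) := by
  change ‖Complex.exp (-l * t) • T.toFun t‖ ≤ _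
  have h0 : ‖Complex.exp (-l * t)‖ = Real.exp (-l.re * t) := by
    rw [Complex.norm_exp]; simp
  rw [norm_smul, h0]
  calc _ ≤ Real.exp (-l.re * t) * (M * Real.exp (r * t)) := by
        gcongr; exact hM t
    _ = _ := by
        rw [mul_left_comm, ← Real.exp_add]; ring_nf

/-- The generator has no eigenvalue to the right of an exponential growth rate. -/
theorem eq_zero_of_mem_generatorGraph (T : C0Semigroup Y) {M r : ℝ}
    (hM : ∀ t : ℝ≥0, ‖T.toFun t‖ ≤ M * Real.exp (r * t)) {l : ℂ} (hl : r < l.re) {y : Y}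
    (h : (y, l • y) ∈ T.generatorGraph) : y = 0 := by
  have h1 := mem_rescale_generatorGraph T l h
  rw [sub_self] at h1
  have h2 : ∀ t : ℝ, 0 ≤ t → ‖y‖ ≤ M * Real.exp ((r - l.re) * t) * ‖y‖ := fun t ht => by
    have h3 := (T.rescale l).orbit_eq h1 ht
    simp only [ContinuousLinearMap.map_zero, intervalIntegral.integral_zero, add_zero] at h3
    calc ‖y‖ = ‖(T.rescale l).toFun t.toNNReal y‖ := by rw [h3]
      _ ≤ _ := ((T.rescale l).toFun t.toNNReal).le_of_opNorm_le
          (by simpa [Real.coe_toNNReal t ht] using T.rescale_norm_le l hM t.toNNReal) y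
  have h4 : Tendsto (fun t : ℝ => M * Real.exp ((r - l.re) * t) * ‖y‖) atTop (𝓝 (M * 0 * ‖y‖)) := by
    refine ((Real.tendsto_exp_atBot.comp ?_).const_mul M).mul_const _
    exact tendsto_id.const_mul_atTop_of_neg (by linarith)
  have h5 := ge_of_tendsto h4 (by filter_upwards [eventually_ge_atTop 0] with t ht using h2 t ht)
  simpa using h5

/-- The Laplace transform of an orbit solves the resolvent equation. -/
theorem laplace_mem_generatorGraph (T : C0Semigroup Y) {M r : ℝ}
    (hM : ∀ t : ℝ≥0, ‖T.toFun t‖ ≤ M * Real.exp (r * t)) {l : ℂ} (hl : r < l.re) (y : Y) :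
    (∫ s in Ioi (0 : ℝ), Complex.exp (-l * s) • T.toFun s.toNNReal y,
      l • (∫ s in Ioi (0 : ℝ), Complex.exp (-l * s) • T.toFun s.toNNReal y) - y)
      ∈ T.generatorGraph := by
  set U := T.rescale l with hU
  have hc := U.continuous_toNNReal y
  have hint : IntegrableOn (fun s : ℝ => U.toFun s.toNNReal y) (Ioi 0) := by
    refine Integrable.mono' (g := fun s : ℝ => (M * ‖y‖) * Real.exp ((r - l.re) * s)) ?_
      hc.aestronglyMeasurable ?_
    · exact (integrableOn_exp_mul_Ioi (by linarith) 0).const_mul _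
    · filter_upwards [ae_restrict_mem measurableSet_Ioi] with s hs
      have hs' : 0 ≤ s := le_of_lt hs
      refine ((U.toFun s.toNNReal).le_of_opNorm_le (T.rescale_norm_le l hM s.toNNReal) y).trans ?_
      rw [Real.coe_toNNReal s hs']; apply le_of_eq; ring
  have heq : ∫ s in Ioi (0 : ℝ), Complex.exp (-l * s) • T.toFun s.toNNReal y
      = ∫ s in Ioi (0 : ℝ), U.toFun s.toNNReal y :=
    setIntegral_congr_fun measurableSet_Ioi fun s hs => (T.rescale_real l (le_of_lt hs) y).symm
  rw [heq, sub_eq_neg_add]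
  refine T.mem_generatorGraph_of_rescale l ?_
  rw [mem_generatorGraph_iff]
  have h1 : HasDerivAt (fun r : ℝ => (∫ s in Ioi (0 : ℝ), U.toFun s.toNNReal y)
      - ∫ s in (0 : ℝ)..r, U.toFun s.toNNReal y) (-y) 0 := by
    have h5 := (hc.integral_hasStrictDerivAt 0 0).hasDerivAt.const_sub
      (∫ s in Ioi (0 : ℝ), U.toFun s.toNNReal y)
    simpa [U.map_zero] using h5
  refine h1.hasDerivWithinAt.congr_of_mem (fun r hr => ?_) (by simp)
  have hr' : (0 : ℝ) ≤ r := hr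
  rw [← ContinuousLinearMap.integral_comp_comm _ hint]
  have h6 : ∫ s in Ioi (0 : ℝ), U.toFun r.toNNReal (U.toFun s.toNNReal y)
      = ∫ s in Ioi (0 : ℝ), U.toFun (s + r).toNNReal y := by
    refine setIntegral_congr_fun measurableSet_Ioi fun s hs => ?_
    rw [add_comm, map_add_real _ hr (le_of_lt hs)]; rfl
  have h7 : ∫ s in Ioi (0 : ℝ), U.toFun (s + r).toNNReal y
      = ∫ s in Ioi r, U.toFun s.toNNReal y := by
    have := (measurePreserving_add_right volume r).setIntegral_preimage_emb
      (measurableEmbedding_addRight r) (fun s : ℝ => U.toFun s.toNNReal y) (Ioi r)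
    simpa using this
  rw [h6, h7, eq_sub_iff_add_eq,
    intervalIntegral.integral_of_le hr', add_comm,
    ← setIntegral_union Ioc_disjoint_Ioi_same measurableSet_Ioi
      (hint.mono_set Ioc_subset_Ioi_self) (hint.mono_set (Ioi_subset_Ioi hr')),
    Ioc_union_Ioi_eq_Ioi hr']

/-- A semigroup is bounded on bounded time intervals. -/
theorem exists_bound (T : C0Semigroup Y) (a : ℝ≥0) :
    ∃ M : ℝ, 0 < M ∧ ∀ t ≤ a, ‖T.toFun t‖ ≤ M := by
  obtain ⟨C, hC⟩ := banach_steinhaus (g := fun t : Icc (0 : ℝ≥0) a => T.toFun t) (by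
    intro y
    obtain ⟨C, hC⟩ := (isCompact_Icc (a := (0 : ℝ≥0)) (b := a)).exists_bound_of_continuousOn
      (T.continuous_orbit y).continuousOn
    exact ⟨C, fun t => hC t t.2⟩)
  exact ⟨max C 1, by positivity, fun t ht => (hC ⟨t, zero_le, ht⟩).trans (le_max_left _ _)⟩

theorem exists_growth_of_growthBound_lt (T : C0Semigroup Y) {a : ℝ}
    (h : T.growthBound < (a : EReal)) :
    ∃ r < a, ∃ M : ℝ, 0 < M ∧ ∀ t : ℝ≥0, ‖T.toFun t‖ ≤ M * Real.exp (r * t) := by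
  obtain ⟨_, ⟨r, hr, rfl⟩, hlt⟩ := sInf_lt_iff.1 h
  exact ⟨r, EReal.coe_lt_coe_iff.1 hlt, hr⟩

theorem map_nsmul (T : C0Semigroup Y) (t : ℝ≥0) (n : ℕ) :
    T.toFun (n * t) = (T.toFun t) ^ n := by
  induction n with
  | zero => simp [T.map_zero]; rfl
  | succ n ih =>
    rw [Nat.cast_succ, add_mul, one_mul, T.map_add, ih, pow_succ]; rfl

/-- If `‖T(t₁)‖ ≤ e^{b t₁}` for a single `t₁ > 0`, the growth bound is at most `b`. -/
theorem growthBound_le_of_norm_le (T : C0Semigroup Y) {b : ℝ} {t₁ : ℝ≥0} (h0 : 0 < t₁)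
    (h : ‖T.toFun t₁‖ ≤ Real.exp (b * t₁)) : T.growthBound ≤ (b : EReal) := by
  obtain ⟨M, hM0, hM⟩ := T.exists_bound t₁
  refine sInf_le ⟨b, ⟨M * Real.exp (|b| * t₁), by positivity, fun t => ?_⟩, rfl⟩
  set n := ⌊t / t₁⌋₊ with hn
  have hn1 : (n : ℝ≥0) * t₁ ≤ t := by
    rw [← le_div_iff₀ h0]; exact Nat.floor_le (zero_le)
  have hn2 : t - n * t₁ ≤ t₁ := by
    have : t < (n + 1) * t₁ := by
      rw [← div_lt_iff₀ h0]; exact Nat.lt_floor_add_one _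
    rw [tsub_le_iff_right]
    refine this.le.trans (le_of_eq ?_); ring
  have h3 : T.toFun t = (T.toFun (t - n * t₁)).comp (T.toFun t₁ ^ n) := by
    rw [← map_nsmul, ← T.map_add, tsub_add_cancel_of_le hn1]
  have h4 : ((t - n * t₁ : ℝ≥0) : ℝ) = t - n * t₁ := by
    rw [NNReal.coe_sub hn1]; simp
  have h6 : ‖T.toFun t₁ ^ n‖ ≤ Real.exp (b * t₁) ^ n := by
    rcases Nat.eq_zero_or_pos n with h | h'
    · rw [h, pow_zero, pow_zero]; exact ContinuousLinearMap.norm_id_le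
    · exact (norm_pow_le' _ h').trans (pow_le_pow_left₀ (norm_nonneg _) h n)
  calc ‖T.toFun t‖ ≤ ‖T.toFun (t - n * t₁)‖ * ‖T.toFun t₁ ^ n‖ := by
        rw [h3]; exact ContinuousLinearMap.opNorm_comp_le _ _
    _ ≤ M * Real.exp (b * t₁) ^ n := by
        gcongr; exact hM _ hn2
    _ ≤ M * (Real.exp (|b| * t₁) * Real.exp (b * t)) := by
        gcongr
        rw [← Real.exp_nat_mul, ← Real.exp_add, Real.exp_le_exp]
        have h5 : (0:ℝ) ≤ t - n * t₁ ∧ (t - n * t₁ : ℝ) ≤ t₁ := by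
          rw [← h4]; exact ⟨NNReal.coe_nonneg _, by exact_mod_cast hn2⟩
        have h7 : -(b * (t - n * t₁)) ≤ |b| * (t - n * t₁) := by
          rw [← neg_mul]; exact mul_le_mul_of_nonneg_right (neg_le_abs b) h5.1
        have h8 : |b| * (t - n * t₁) ≤ |b| * t₁ := mul_le_mul_of_nonneg_left h5.2 (abs_nonneg b)
        linarith
    _ = _ := by ring

end C0Semigroup

/-! ### Growth bound of eventually norm continuous semigroups -/

section Spectrum

variable {Y : Type*} [NormedAddCommGroup Y] [NormedSpace ℂ Y] [CompleteSpace Y]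

/-- A point of maximal modulus of the spectrum of a bounded operator is an approximate eigenvalue;
hence the spectral radius is smaller than `ρ` if there is no approximate eigenvalue of modulus at
least `ρ`. -/
theorem spectralRadius_lt_of_lower_bound [Nontrivial Y] (B : Y →L[ℂ] Y) {ρ : ℝ≥0} (hρ : 0 < ρ)
    (h : ∀ μ : ℂ, ρ ≤ ‖μ‖₊ → ∃ c : ℝ, 0 < c ∧ ∀ y, c * ‖y‖ ≤ ‖μ • y - B y‖) :
    spectralRadius ℂ B < ρ := by
  -- `μ` is a spectral value of maximal modulus
  obtain ⟨μ, hμ, hμr⟩ := spectrum.exists_nnnorm_eq_spectralRadius B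
  rw [← hμr, ENNReal.coe_lt_coe]
  by_contra! hle
  obtain ⟨c, hc, hlow⟩ := h μ hle
  have hμ0 : 0 < ‖μ‖ := by
    have : 0 < ‖μ‖₊ := hρ.trans_le hle
    exact this
  -- `ν = (1 + δ) μ` is in the resolvent set and so close to `μ` that the lower bound survives; it
  -- bounds the inverse at `ν` by `2 / c`, so the Neumann series at `ν` reaches `μ`
  set δ : ℝ := c / (4 * ‖μ‖) with hδ
  have hδ0 : 0 < δ := by positivity
  set ν : ℂ := (1 + δ : ℝ) • μ with hν
  have hνμ : ‖ν - μ‖ = c / 4 := by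
    have : ν - μ = (δ : ℝ) • μ := by rw [hν, add_smul, one_smul]; abel
    rw [this, norm_smul, Real.norm_eq_abs, abs_of_pos hδ0, hδ]
    field_simp
  have hνres : ν ∈ resolventSet ℂ B := by
    refine spectrum.mem_resolventSet_of_spectralRadius_lt ?_
    rw [← hμr, ENNReal.coe_lt_coe, ← NNReal.coe_lt_coe, coe_nnnorm, coe_nnnorm, hν, norm_smul,
      Real.norm_eq_abs, abs_of_pos (by positivity)]
    nlinarith
  have hunit : IsUnit (algebraMap ℂ (Y →L[ℂ] Y) ν - B) := spectrum.mem_resolventSet_iff.1 hνres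
  obtain ⟨u, hu⟩ := hunit
  have huv : ∀ y, (u : Y →L[ℂ] Y) y = ν • y - B y := fun y => by rw [hu]; rfl
  have hlow' : ∀ y, c / 2 * ‖y‖ ≤ ‖(u : Y →L[ℂ] Y) y‖ := fun y => by
    have h1 : ‖μ • y - B y‖ ≤ ‖ν • y - B y‖ + ‖(ν - μ) • y‖ := by
      have : μ • y - B y = (ν • y - B y) - (ν - μ) • y := by rw [sub_smul]; abel
      rw [this]; exact norm_sub_le _ _
    rw [norm_smul, hνμ] at h1
    rw [huv]
    nlinarith [hlow y, norm_nonneg y]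
  have hinv : ‖(↑u⁻¹ : Y →L[ℂ] Y)‖ ≤ 2 / c := by
    refine ContinuousLinearMap.opNorm_le_bound _ (by positivity) fun y => ?_
    have h1 := hlow' ((↑u⁻¹ : Y →L[ℂ] Y) y)
    have h2 : (u : Y →L[ℂ] Y) ((↑u⁻¹ : Y →L[ℂ] Y) y) = y := by
      change ((u : Y →L[ℂ] Y) * (↑u⁻¹ : Y →L[ℂ] Y)) y = y
      rw [u.mul_inv]; rfl
    rw [h2] at h1
    rw [div_mul_eq_mul_div, le_div_iff₀ hc]
    nlinarith
  refine hμ (spectrum.mem_resolventSet_iff.2 ?_)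
  have hlt : ‖algebraMap ℂ (Y →L[ℂ] Y) (μ - ν)‖ < ‖(↑u⁻¹ : Y →L[ℂ] Y)‖⁻¹ := by
    rw [norm_algebraMap', norm_sub_rev, hνμ]
    have hpos : 0 < ‖(↑u⁻¹ : Y →L[ℂ] Y)‖ := Units.norm_pos u⁻¹
    rw [lt_inv_comm₀ (by positivity) hpos, inv_div]
    refine hinv.trans_lt ?_
    gcongr; norm_num
  refine ⟨u.add _ hlt, ?_⟩
  rw [Units.val_add, hu, map_sub]
  abel

end Spectrum

namespace C0Semigroup

variable {Y : Type*} [NormedAddCommGroup Y] [NormedSpace ℂ Y] [CompleteSpace Y]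

theorem continuousOn_rescale (T : C0Semigroup Y) (l : ℂ) {s : Set ℝ≥0}
    (hc : ContinuousOn T.toFun s) : ContinuousOn (T.rescale l).toFun s := by
  have h : Continuous fun t : ℝ≥0 => Complex.exp (-l * t) := by fun_prop
  exact h.continuousOn.smul hc

/-- If the orbits are norm continuous on `(1, ∞)` and all `πik` satisfy a lower bound with respect
to the generator, then so does `1` with respect to `T(2)`.  The Fourier coefficients of
`s ↦ T(2 + s) y` on `[0, 2]` are controlled by `y - T(2) y`, and a trigonometric polynomial which
peaks at `s = 1` recovers `T(3) y` from them in operator norm. -/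
theorem exists_norm_le_sub_apply_two (T : C0Semigroup Y) (hc : ContinuousOn T.toFun (Ioi 1))
    (hlow : ∀ k : ℤ, ∃ C : ℝ, ∀ u ∈ T.generatorGraph,
      ‖u.1‖ ≤ C * ‖((Real.pi : ℂ) * Complex.I * k) • u.1 - u.2‖) :
    ∃ C : ℝ, ∀ y, ‖y‖ ≤ C * ‖y - T.toFun 2 y‖ := by
  set W : ℝ → (Y →L[ℂ] Y) := fun s => T.toFun (2 + s).toNNReal with hW
  have hWc : ContinuousOn W (Icc 0 2) := by
    refine hc.comp (continuous_real_toNNReal.comp (continuous_const.add continuous_id)).continuousOn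
      fun s hs => ?_
    change 1 < (2 + s).toNNReal
    rw [Real.lt_toNNReal_iff_coe_lt]
    have := hs.1
    push_cast; linarith
  -- a continuous weight is controlled if the weighted mean of the orbit is
  let Ctrl : (ℝ → ℂ) → Prop := fun f =>
    ∃ C : ℝ, ∀ y, ‖∫ s in (0 : ℝ)..2, f s • W s y‖ ≤ C * ‖y - T.toFun 2 y‖
  -- the Fourier modes on `[0, 2]`: means of orbits weighted by them lie in the generator domain
  let e : ℤ → ℝ → ℂ := fun k s => Complex.exp (-(Real.pi * Complex.I * k) * s)
  have hec : ∀ k, Continuous (e k) := fun k => by fun_prop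
  have hWy : ∀ y, Continuous fun s : ℝ => W s y := fun y =>
    (T.continuous_toNNReal y).comp (continuous_const.add continuous_id)
  have hctrl_e : ∀ k, Ctrl (e k) := fun k => by
    obtain ⟨C, hC⟩ := hlow k
    have hC0 : ∀ u ∈ T.generatorGraph,
      ‖u.1‖ ≤ |C| * ‖((Real.pi : ℂ) * Complex.I * k) • u.1 - u.2‖ := fun u hu =>
        (hC u hu).trans (by gcongr; exact le_abs_self C)
    refine ⟨|C| * ‖T.toFun 2‖, fun y => ?_⟩
    have h1 := T.integral_exp_mem_generatorGraph (Real.pi * Complex.I * k) (T.toFun 2 y)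
      (t := 2) (by norm_num)
    have h2 : ∫ s in (0 : ℝ)..2, Complex.exp (-(Real.pi * Complex.I * k) * s) •
        T.toFun s.toNNReal (T.toFun 2 y) = ∫ s in (0 : ℝ)..2, e k s • W s y := by
      refine intervalIntegral.integral_congr fun s hs => ?_
      rw [uIcc_of_le (by norm_num)] at hs
      change Complex.exp (-(Real.pi * Complex.I * k) * s) • _
        = Complex.exp (-(Real.pi * Complex.I * k) * s) • T.toFun (2 + s).toNNReal y
      rw [add_comm, T.map_add_real hs.1 (by norm_num)]
      simp
    have h3 : Complex.exp (-(Real.pi * Complex.I * k) * (2 : ℝ)) = 1 := by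
      rw [Complex.exp_eq_one_iff]
      exact ⟨-k, by push_cast; ring⟩
    rw [h2, h3] at h1
    have h4 := hC0 _ h1
    refine h4.trans ?_
    have h5 : (Real.toNNReal 2) = 2 := by simp
    rw [one_smul, sub_add_cancel_right, norm_neg, h5, ← map_sub, mul_assoc, ← norm_neg (y - _),
      neg_sub]
    gcongr
    exact ContinuousLinearMap.le_opNorm _ _
  have hctrl_add : ∀ f g, Continuous f → Continuous g → Ctrl f → Ctrl g → Ctrl (f + g) := by
    rintro f g hf hg ⟨C, hC⟩ ⟨D, hD⟩
    refine ⟨C + D, fun y => ?_⟩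
    have : ∫ s in (0 : ℝ)..2, (f + g) s • W s y
        = (∫ s in (0 : ℝ)..2, f s • W s y) + ∫ s in (0 : ℝ)..2, g s • W s y := by
      simp only [Pi.add_apply, add_smul]
      exact intervalIntegral.integral_add ((hf.smul (hWy y)).intervalIntegrable _ _)
        ((hg.smul (hWy y)).intervalIntegrable _ _)
    rw [this, add_mul]
    exact (norm_add_le _ _).trans (add_le_add (hC y) (hD y))
  have hctrl_smul : ∀ (a : ℂ) f, Ctrl f → Ctrl (a • f) := by
    rintro a f ⟨C, hC⟩
    refine ⟨‖a‖ * C, fun y => ?_⟩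
    simp only [Pi.smul_apply, smul_assoc, intervalIntegral.integral_smul]
    rw [norm_smul, mul_assoc]
    gcongr
    exact hC y
  -- a trigonometric polynomial with values in `[0, 1]` and unique maximum on `[0, 2]` at `s = 1`
  let q : ℝ → ℝ := fun s => (1 - Real.cos (Real.pi * s)) / 2
  have hqc : Continuous q := by fun_prop
  have hqe : ∀ s, (q s : ℂ) = 1 / 2 + (-1 / 4) * e 1 s + (-1 / 4) * e (-1) s := fun s => by
    simp only [q, e]
    push_cast
    rw [Complex.cos]
    ring_nf
  have hee : ∀ k m s, e k s * e m s = e (k + m) s := fun k m s => by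
    simp only [e]; rw [← Complex.exp_add]; congr 1; push_cast; ring
  have hctrl_q : ∀ (N : ℕ) (k : ℤ), Ctrl (fun s => e k s * (q s : ℂ) ^ N) := by
    intro N
    induction N with
    | zero => intro k; simpa using hctrl_e k
    | succ N ih =>
      intro k
      have hcont : ∀ k, Continuous fun s => e k s * (q s : ℂ) ^ N := fun k =>
        (hec k).mul ((Complex.continuous_ofReal.comp hqc).pow N)
      have h1 : (fun s => e k s * (q s : ℂ) ^ (N + 1))
          = ((1 / 2 : ℂ) • fun s => e k s * (q s : ℂ) ^ N)
            + (((-1 / 4 : ℂ) • fun s => e (k + 1) s * (q s : ℂ) ^ N)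
            + ((-1 / 4 : ℂ) • fun s => e (k + -1) s * (q s : ℂ) ^ N)) := by
        funext s
        simp only [Pi.add_apply, Pi.smul_apply, smul_eq_mul]
        rw [pow_succ, ← hee k 1, ← hee k (-1)]
        nth_rewrite 2 [hqe]
        ring
      rw [h1]
      refine hctrl_add _ _ ((hcont _).const_smul _)
        (((hcont _).const_smul _).add ((hcont _).const_smul _))
        (hctrl_smul _ _ (ih _)) (hctrl_add _ _ ((hcont _).const_smul _)
        ((hcont _).const_smul _) (hctrl_smul _ _ (ih _)) (hctrl_smul _ _ (ih _)))
  have hpeak : Tendsto (fun n : ℕ => (∫ x in Icc (0 : ℝ) 2, q x ^ n)⁻¹ •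
      ∫ x in Icc (0 : ℝ) 2, q x ^ n • W x) atTop (𝓝 (W 1)) := by
    refine tendsto_setIntegral_pow_smul_of_unique_maximum_of_isCompact_of_continuousOn isCompact_Icc
      hqc.continuousOn ?_ ?_ ?_ ?_ hWc
    · intro y hy hy1
      have h1 : q 1 = 1 := by simp [q]
      rw [h1]
      have h2 : Real.cos (Real.pi * y) ≠ -1 := by
        intro h
        obtain ⟨k, hk⟩ := Real.cos_eq_neg_one_iff.1 h
        have h3 : 1 + 2 * (k : ℝ) = y := by
          have : Real.pi * (1 + 2 * k) = Real.pi * y := by rw [← hk]; ring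
          exact mul_left_cancel₀ Real.pi_ne_zero this
        have h4 : k = 0 := by
          have h5 : (-1 : ℝ) < k := by linarith [hy.1]
          have h6 : (k : ℝ) < 1 := by linarith [hy.2]
          have h7 : -1 < k := by exact_mod_cast h5
          have h8 : k < 1 := by exact_mod_cast h6
          omega
        rw [h4] at h3
        exact hy1 (by simpa using h3.symm)
      have h3 : -1 < Real.cos (Real.pi * y) := lt_of_le_of_ne (Real.neg_one_le_cos _) h2.symm
      change (1 - Real.cos (Real.pi * y)) / 2 < 1
      linarith
    · intro x _
      have := Real.cos_le_one (Real.pi * x)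
      change 0 ≤ (1 - Real.cos (Real.pi * x)) / 2
      linarith
    · simp [q]
    · rw [interior_Icc, closure_Ioo (by norm_num)]; norm_num
  -- small enough to absorb `T(4) y = T(1) T(3) y` below
  set ε : ℝ := 1 / (2 * (‖T.toFun 1‖ + 1)) with hε
  have hε0 : 0 < ε := by positivity
  obtain ⟨N, hN⟩ := (hpeak.eventually (Metric.closedBall_mem_nhds _ hε0)).exists
  obtain ⟨C, hC⟩ := hctrl_q N 0
  set κ := (∫ x in Icc (0 : ℝ) 2, q x ^ N)⁻¹ with hκ
  set I := ∫ x in Icc (0 : ℝ) 2, q x ^ N • W x with hI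
  have hIy : ∀ y, ‖I y‖ ≤ C * ‖y - T.toFun 2 y‖ := fun y => by
    refine le_trans (le_of_eq ?_) (hC y)
    have hint : IntegrableOn (fun x => q x ^ N • W x) (Icc (0 : ℝ) 2) :=
      ((hqc.pow N).continuousOn.smul hWc).integrableOn_compact isCompact_Icc
    rw [hI, ContinuousLinearMap.integral_apply hint, intervalIntegral.integral_of_le (by norm_num),
      integral_Icc_eq_integral_Ioc]
    congr 1
    refine integral_congr_ae (Eventually.of_forall fun s => ?_)
    simp [e, ← Complex.ofReal_pow, Complex.coe_smul]
  have hW1 : W 1 = T.toFun 3 := by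
    change T.toFun (2 + 1 : ℝ).toNNReal = _
    congr 1
    rw [show (2 + 1 : ℝ) = ((3 : ℝ≥0) : ℝ) by norm_num, Real.toNNReal_coe]
  have h3 : ∀ y, ‖T.toFun 3 y‖ ≤ ε * ‖y‖ + |κ| * (C * ‖y - T.toFun 2 y‖) := fun y => by
    have h4 : ‖(κ • I - W 1) y‖ ≤ ε * ‖y‖ :=
      ContinuousLinearMap.le_of_opNorm_le _ (by simpa [dist_eq_norm] using hN) y
    have h5 : T.toFun 3 y = κ • I y - (κ • I - W 1) y := by
      rw [hW1]; simp
    rw [h5]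
    refine (norm_sub_le _ _).trans ?_
    rw [norm_smul, Real.norm_eq_abs, add_comm]
    gcongr
    exact hIy y
  refine ⟨2 * (‖T.toFun 1‖ * (|κ| * C) + 1 + ‖T.toFun 2‖), fun y => ?_⟩
  set d := ‖y - T.toFun 2 y‖ with hd
  have h4 : ‖T.toFun 4 y‖ ≤ ‖T.toFun 1‖ * (ε * ‖y‖ + |κ| * (C * d)) := by
    have : T.toFun 4 y = T.toFun 1 (T.toFun 3 y) := by
      rw [← ContinuousLinearMap.comp_apply, ← T.map_add]; norm_num
    rw [this]
    exact (ContinuousLinearMap.le_opNorm _ _).trans (by gcongr; exact h3 y)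
  have h5 : ‖y‖ ≤ d + ‖T.toFun 2‖ * d + ‖T.toFun 4 y‖ := by
    have h6 : T.toFun 4 y = T.toFun 2 (T.toFun 2 y) := by
      rw [← ContinuousLinearMap.comp_apply, ← T.map_add]; norm_num
    have h7 : y = (y - T.toFun 2 y) + T.toFun 2 (y - T.toFun 2 y) + T.toFun 4 y := by
      rw [h6, map_sub]; abel
    calc ‖y‖ = ‖(y - T.toFun 2 y) + T.toFun 2 (y - T.toFun 2 y) + T.toFun 4 y‖ := by rw [← h7]
      _ ≤ _ := (norm_add₃_le).trans (by gcongr; exact ContinuousLinearMap.le_opNorm _ _)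
  have h6 : ‖T.toFun 1‖ * ε ≤ 1 / 2 := by
    rw [hε, mul_one_div, div_le_div_iff₀ (by positivity) (by norm_num)]
    linarith
  nlinarith [norm_nonneg y, mul_le_mul_of_nonneg_right h6 (norm_nonneg y)]

/-- For a semigroup which is norm continuous on `(1, ∞)`, lower bounds for `l - G` on the closed
half plane `Re l ≥ a` force the growth bound to be smaller than `a`. -/
theorem growthBound_lt_of_lower_bound (T : C0Semigroup Y) (hc : ContinuousOn T.toFun (Ioi 1))
    {a : ℝ} (hlow : ∀ l : ℂ, a ≤ l.re → ∃ C : ℝ, ∀ u ∈ T.generatorGraph,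
      ‖u.1‖ ≤ C * ‖l • u.1 - u.2‖) : T.growthBound < (a : EReal) := by
  rcases subsingleton_or_nontrivial Y with hY | hY
  · refine (T.growthBound_le_of_norm_le (b := a - 1) one_pos ?_).trans_lt
      (EReal.coe_lt_coe_iff.2 (by linarith))
    rw [Subsingleton.elim (T.toFun 1) 0, norm_zero]
    positivity
  have hrad : spectralRadius ℂ (T.toFun 2) < (Real.exp (a * 2)).toNNReal := by
    refine spectralRadius_lt_of_lower_bound _ (Real.toNNReal_pos.2 (Real.exp_pos _)) fun μ hμ => ?_
    have hμ' : Real.exp (a * 2) ≤ ‖μ‖ := by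
      have := Real.toNNReal_le_iff_le_coe.1 hμ
      simpa using this
    have hμ0 : μ ≠ 0 := norm_pos_iff.1 ((Real.exp_pos _).trans_le hμ')
    -- `e^{2 l₀} = μ`: after rescaling by `l₀`, the point `μ` of the spectrum of `T(2)` becomes `1`
    set l₀ : ℂ := Complex.log μ / 2 with hl₀
    have hexp : Complex.exp (l₀ * 2) = μ := by
      rw [hl₀, div_mul_cancel₀ _ two_ne_zero, Complex.exp_log hμ0]
    have hre : a ≤ l₀.re := by
      have h1 : Real.exp (l₀.re * 2) = ‖μ‖ := by
        rw [← hexp, Complex.norm_exp]; simp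
      rw [← h1, Real.exp_le_exp] at hμ'
      linarith
    obtain ⟨C, hC⟩ := (T.rescale l₀).exists_norm_le_sub_apply_two (T.continuousOn_rescale l₀ hc) (by
      intro k
      obtain ⟨C, hC⟩ := hlow (l₀ + Real.pi * Complex.I * k) (by simpa using hre)
      refine ⟨C, fun u hu => ?_⟩
      have := hC _ (T.mem_generatorGraph_of_rescale l₀ (y := u.1) (z := u.2) hu)
      refine this.trans (le_of_eq ?_)
      congr 2
      change (l₀ + Real.pi * Complex.I * k) • u.1 - (u.2 + l₀ • u.1) = _
      rw [add_smul]; abel)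
    have hC' : ∀ y, ‖y‖ ≤ (|C| + 1) * ‖y - (T.rescale l₀).toFun 2 y‖ := fun y =>
      (hC y).trans (by gcongr; linarith [le_abs_self C])
    refine ⟨‖μ‖ / (|C| + 1), by positivity, fun y => ?_⟩
    have h1 : μ • y - T.toFun 2 y = μ • (y - (T.rescale l₀).toFun 2 y) := by
      rw [rescale_apply, smul_sub, smul_smul]
      have : μ * Complex.exp (-l₀ * (2 : ℝ≥0)) = 1 := by
        rw [← hexp, ← Complex.exp_add]; simp
      rw [this, one_smul]
    rw [h1, norm_smul, div_mul_eq_mul_div, div_le_iff₀ (by positivity), mul_assoc]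
    gcongr
    rw [mul_comm]
    exact hC' y
  obtain ⟨r, hr1, hr2⟩ := ENNReal.lt_iff_exists_nnreal_btwn.1 hrad
  have hr2' : (r : ℝ) < Real.exp (a * 2) := by
    have := ENNReal.coe_lt_coe.1 hr2
    rwa [Real.lt_toNNReal_iff_coe_lt] at this
  have hr0 : 0 < r := by
    have : (0 : ℝ≥0∞) < r := (zero_le).trans_lt hr1
    exact_mod_cast this
  -- Gelfand's formula provides a power of `T(2)` whose norm is at most `r ^ n`
  have hev := (spectrum.pow_nnnorm_pow_one_div_tendsto_nhds_spectralRadius (T.toFun 2)).eventually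
    (Iio_mem_nhds hr1)
  obtain ⟨n, hn, hn1⟩ := (hev.and (eventually_ge_atTop 1)).exists
  have hn0 : (0 : ℝ) < n := by exact_mod_cast hn1
  set b : ℝ := Real.log r / 2 with hb
  have hba : b < a := by
    have : Real.log r < a * 2 := by
      rw [← Real.log_exp (a * 2)]
      exact Real.log_lt_log (by exact_mod_cast hr0) hr2'
    rw [hb]; linarith
  have hnorm : ‖T.toFun 2 ^ n‖ ≤ (r : ℝ) ^ n := by
    have h1 : ((‖T.toFun 2 ^ n‖₊ : ℝ≥0∞) ^ (1 / n : ℝ)) ^ (n : ℝ) ≤ (r : ℝ≥0∞) ^ (n : ℝ) :=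
      ENNReal.rpow_le_rpow (le_of_lt hn) hn0.le
    rw [← ENNReal.rpow_mul, one_div, inv_mul_cancel₀ hn0.ne', ENNReal.rpow_one,
      ENNReal.rpow_natCast] at h1
    exact_mod_cast h1
  refine (T.growthBound_le_of_norm_le (t₁ := n * 2) (b := b) ?_ ?_).trans_lt
    (EReal.coe_lt_coe_iff.2 hba)
  · have : (0 : ℝ≥0) < n := by exact_mod_cast hn1
    positivity
  · rw [T.map_nsmul]
    refine hnorm.trans (le_of_eq ?_)
    have h1 : b * ((n * 2 : ℝ≥0) : ℝ) = n * Real.log r := by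
      rw [hb]; push_cast; ring
    rw [h1, Real.exp_nat_mul, Real.exp_log (by exact_mod_cast hr0)]

end C0Semigroup

/-! ### Calculus in `W^{1,p}([-1,0], X)` -/

section SobolevCalculus

variable {X : Type*} [NormedAddCommGroup X] [NormedSpace ℂ X]
  {p : ℝ≥0∞} [Fact (1 ≤ p)]

instance : IsProbabilityMeasure delayMeasure := ⟨by simp [delayMeasure]⟩

theorem integral_norm_history_le (g : LpHistory X p) :
    ∫ r in Icc (-1 : ℝ) 0, ‖g r‖ ≤ ‖g‖ := by
  rw [integral_norm_eq_lintegral_enorm (Lp.aestronglyMeasurable g), Lp.norm_def]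
  refine ENNReal.toReal_mono (Lp.eLpNorm_ne_top g) ?_
  rw [← eLpNorm_one_eq_lintegral_enorm]
  exact eLpNorm_le_eLpNorm_of_exponent_le Fact.out (Lp.aestronglyMeasurable g)

theorem norm_intervalIntegral_history_le {g : ℝ → X} (hg : IntegrableOn g (Icc (-1 : ℝ) 0))
    {t : ℝ} (ht : t ∈ Icc (-1 : ℝ) 0) :
    ‖∫ r in (0 : ℝ)..t, g r‖ ≤ ∫ r in Icc (-1 : ℝ) 0, ‖g r‖ := by
  rw [intervalIntegral.integral_symm, norm_neg, intervalIntegral.integral_of_le ht.2]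
  refine (norm_integral_le_integral_norm _).trans ?_
  refine setIntegral_mono_set hg.norm (Eventually.of_forall fun _ => norm_nonneg _) ?_
  exact (show Ioc t 0 ⊆ Icc (-1 : ℝ) 0 from fun r hr => ⟨ht.1.trans hr.1.le, hr.2⟩).eventuallyLE

theorem norm_history_le_of_ae_bound {g : LpHistory X p} {C : ℝ} (hC : 0 ≤ C)
    (h : ∀ᵐ t ∂delayMeasure, ‖g t‖ ≤ C) : ‖g‖ ≤ C := by
  have h1 : measureUnivNNReal delayMeasure = 1 := by
    simp [measureUnivNNReal]
  simpa [h1] using Lp.norm_le_of_ae_bound hC h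

theorem continuousOn_primitive_history {g : ℝ → X} (hg : IntegrableOn g (Icc (-1 : ℝ) 0))
    (c : X) : ContinuousOn (fun t => c + ∫ r in (0 : ℝ)..t, g r) (Icc (-1 : ℝ) 0) := by
  have hi : IntervalIntegrable g volume (-1) 0 :=
    (intervalIntegrable_iff_integrableOn_Icc_of_le (by norm_num)).2 hg
  have := intervalIntegral.continuousOn_primitive_interval'
    (μ := volume) (b₁ := -1) (b₂ := 0) (a := 0) hi (by simp)
  rw [uIcc_of_le (by norm_num)] at this
  exact continuousOn_const.add this

theorem intervalIntegral_congr_history {f g : ℝ → X} (h : ∀ᵐ r ∂delayMeasure, f r = g r) {t : ℝ}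
    (ht : t ∈ Icc (-1 : ℝ) 0) : ∫ r in (0 : ℝ)..t, f r = ∫ r in (0 : ℝ)..t, g r := by
  rw [intervalIntegral.integral_symm, intervalIntegral.integral_symm t 0,
    intervalIntegral.integral_of_le ht.2, intervalIntegral.integral_of_le ht.2]
  congr 1
  refine integral_congr_ae ?_
  have : (Ioc t 0 : Set ℝ) ⊆ Icc (-1) 0 := fun r hr => ⟨ht.1.trans hr.1.le, hr.2⟩
  exact ae_restrict_of_ae_restrict_of_subset this h

theorem eq_of_isContRep {f : LpHistory X p} {F G : ℝ → X} (hF : IsContRep f F)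
    (hG : IsContRep f G) : EqOn F G (Icc (-1 : ℝ) 0) := by
  refine Measure.eqOn_Icc_of_ae_eq volume (by norm_num) ?_ hF.1 hG.1
  filter_upwards [hF.2, hG.2] with t h1 h2
  rw [← h1, h2]

/-- `f(0) = x` means that the integration constant of `f` is `x`. -/
theorem W1p.hasValueAtZero_iff (w : W1p X p) (x : X) : HasValueAtZero (W1p.fn w) x ↔
    ∀ᵐ t ∂delayMeasure, W1p.fn w t = x + ∫ r in (0 : ℝ)..t, W1p.deriv w r := by
  constructor
  · rintro ⟨F, hF, rfl⟩
    obtain ⟨c, hc⟩ := w.2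
    have h := eq_of_isContRep hF
      ⟨continuousOn_primitive_history (integrable_history (W1p.deriv w)) c, hc⟩
      (show (0 : ℝ) ∈ Icc (-1 : ℝ) 0 by simp)
    simp only [intervalIntegral.integral_same, add_zero] at h
    rw [h]
    exact hc
  · intro h
    exact ⟨_, ⟨continuousOn_primitive_history (integrable_history (W1p.deriv w)) x, h⟩, by simp⟩

/-- A primitive of an integrable function is absolutely continuous. -/
theorem absolutelyContinuousOnInterval_primitive {q : ℝ → X} {a b : ℝ}
    (hq : IntervalIntegrable q volume a b) {c : ℝ} (hc : c ∈ uIcc a b) :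
    AbsolutelyContinuousOnInterval (fun t => ∫ r in c..t, q r) a b := by
  have h := hq.norm.absolutelyContinuousOnInterval_intervalIntegral hc
  rw [absolutelyContinuousOnInterval_iff] at h ⊢
  intro ε hε
  obtain ⟨δ, hδ, H⟩ := h ε hε
  refine ⟨δ, hδ, fun E hE hlt => lt_of_le_of_lt (Finset.sum_le_sum fun i hi => ?_) (H E hE hlt)⟩
  have hmem := hE.1 i (Finset.mem_range.1 hi |> Finset.mem_range.2)
  have hs : ∀ t ∈ uIcc a b, IntervalIntegrable q volume c t := fun t ht =>
    hq.mono_set (uIcc_subset_uIcc hc ht)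
  have hsn : ∀ t ∈ uIcc a b, IntervalIntegrable (fun r => ‖q r‖) volume c t := fun t ht =>
    hq.norm.mono_set (uIcc_subset_uIcc hc ht)
  rw [dist_eq_norm, dist_eq_norm,
    intervalIntegral.integral_interval_sub_left (hs _ hmem.1) (hs _ hmem.2),
    intervalIntegral.integral_interval_sub_left (hsn _ hmem.1) (hsn _ hmem.2)]
  exact intervalIntegral.norm_integral_le_abs_integral_norm

/-- The product rule for `e^{lt}` times a primitive. -/
theorem exp_smul_primitive [CompleteSpace X] (l : ℂ) {q : ℝ → X}
    (hq : IntegrableOn q (Icc (-1 : ℝ) 0)) {t : ℝ} (ht : t ∈ Icc (-1 : ℝ) 0) :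
    Complex.exp (l * t) • ∫ r in (0 : ℝ)..t, q r =
      ∫ s in (0 : ℝ)..t, (l • Complex.exp (l * s) • (∫ r in (0 : ℝ)..s, q r)
        + Complex.exp (l * s) • q s) := by
  have hi : IntervalIntegrable q volume (-1) 0 :=
    (intervalIntegrable_iff_integrableOn_Icc_of_le (by norm_num)).2 hq
  have h0 : (0 : ℝ) ∈ uIcc (-1 : ℝ) 0 := by simp
  set e : ℝ → ℂ := fun s => Complex.exp (l * s) with he
  have hec : Continuous e := by fun_prop
  set Q : ℝ → X := fun s => ∫ r in (0 : ℝ)..s, q r with hQ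
  have hQc : ContinuousOn Q (uIcc (-1 : ℝ) 0) := by
    rw [uIcc_of_le (by norm_num)]
    simpa using continuousOn_primitive_history hq 0
  set f : ℝ → X := fun s => l • e s • Q s + e s • q s with hf
  have hfi : IntervalIntegrable f volume (-1) 0 := by
    refine ((hec.continuousOn.smul hQc).const_smul l).intervalIntegrable.add ?_
    rw [intervalIntegrable_iff_integrableOn_Icc_of_le (by norm_num)]
    exact hq.continuousOn_smul hec.continuousOn isCompact_Icc
  have hACe : AbsolutelyContinuousOnInterval e (-1) 0 :=
    ContDiffOn.absolutelyContinuousOnInterval (ContDiff.contDiffOn (by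
      have h1 : ContDiff ℝ 1 fun s : ℝ => l * (s : ℂ) :=
        contDiff_const.mul Complex.ofRealCLM.contDiff
      exact h1.cexp))
  have hAC : AbsolutelyContinuousOnInterval (e • Q - fun s => ∫ r in (0 : ℝ)..s, f r) (-1) 0 :=
    (hACe.smul (absolutelyContinuousOnInterval_primitive hi h0)).sub
      (absolutelyContinuousOnInterval_primitive hfi h0)
  obtain ⟨C, hC⟩ := hAC.const_of_ae_hasDerivAt_zero (by
    filter_upwards [hi.ae_hasDerivAt_integral, hfi.ae_hasDerivAt_integral] with s h1 h2 hs
    have h3 := C0Semigroup.hasDerivAt_cexp l s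
    have h4 := (h3.smul (h1 hs 0 h0)).sub (h2 hs 0 h0)
    convert h4 using 1
    simp only [hf, he, hQ]
    rw [smul_smul]
    abel)
  have h1 := hC 0 h0
  have h2 := hC t (by rwa [uIcc_of_le (by norm_num)])
  simp only [Pi.sub_apply, Pi.smul_apply', hQ, intervalIntegral.integral_same, smul_zero,
    sub_zero] at h1 h2
  rw [← h1, sub_eq_zero] at h2
  exact h2

theorem norm_cexp_mul_le (l : ℂ) {t : ℝ} (ht : t ∈ Icc (-1 : ℝ) 0) :
    ‖Complex.exp (l * t)‖ ≤ Real.exp ‖l‖ := by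
  rw [Complex.norm_exp, Real.exp_le_exp]
  refine (Complex.re_le_norm _).trans ?_
  rw [norm_mul, Complex.norm_real]
  refine mul_le_of_le_one_right (norm_nonneg _) ?_
  rw [Real.norm_eq_abs, abs_le]
  exact ⟨ht.1, by linarith [ht.2]⟩

/-- A priori bound for the solutions of `l f - f' = g`, `f(0) = 0`. -/
theorem W1p.norm_fn_le [CompleteSpace X] (l : ℂ) (w : W1p X p) (h0 : HasValueAtZero (W1p.fn w) 0) :
    ‖W1p.fn w‖ ≤ Real.exp ‖l‖ * (Real.exp ‖l‖ * ‖l • W1p.fn w - W1p.deriv w‖) := by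
  set g := l • W1p.fn w - W1p.deriv w with hg
  have hw := (W1p.hasValueAtZero_iff w 0).1 h0
  simp only [zero_add] at hw
  refine norm_history_le_of_ae_bound (by positivity) ?_
  have hgae : ∀ᵐ r ∂delayMeasure, g r = l • (∫ s in (0 : ℝ)..r, W1p.deriv w s) - W1p.deriv w r := by
    filter_upwards [hw, Lp.coeFn_sub (l • W1p.fn w) (W1p.deriv w), Lp.coeFn_smul l (W1p.fn w)]
      with r h1 h2 h3
    rw [hg, h2, Pi.sub_apply, h3, Pi.smul_apply, h1]
  have hgi : IntegrableOn (fun r : ℝ => Complex.exp (-l * r) • g r) (Icc (-1 : ℝ) 0) :=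
    (integrable_history g).continuousOn_smul (by fun_prop) isCompact_Icc
  have hbd : ∫ r in Icc (-1 : ℝ) 0, ‖Complex.exp (-l * r) • g r‖ ≤ Real.exp ‖l‖ * ‖g‖ := by
    refine (setIntegral_mono_on hgi.norm ((integrable_history g).norm.const_mul (Real.exp ‖l‖))
      measurableSet_Icc fun r hr => ?_).trans ?_
    · rw [norm_smul]
      gcongr
      simpa using norm_cexp_mul_le (-l) hr
    · rw [integral_const_mul]
      gcongr
      exact integral_norm_history_le g
  filter_upwards [hw, ae_restrict_mem (μ := volume) measurableSet_Icc] with t h1 ht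
  have h2 := exp_smul_primitive (-l) (integrable_history (W1p.deriv w)) ht
  have h3 : ∫ s in (0 : ℝ)..t, (-l • Complex.exp (-l * s) • (∫ r in (0 : ℝ)..s, W1p.deriv w r)
        + Complex.exp (-l * s) • W1p.deriv w s)
      = ∫ s in (0 : ℝ)..t, -(Complex.exp (-l * s) • g s) := by
    refine intervalIntegral_congr_history ?_ ht
    filter_upwards [hgae] with s hs
    rw [hs, smul_sub, neg_smul, smul_comm l]
    abel
  have h4 : W1p.fn w t
      = Complex.exp (l * t) • ∫ s in (0 : ℝ)..t, -(Complex.exp (-l * s) • g s) := by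
    rw [← h3, ← h2, smul_smul, ← Complex.exp_add, h1]
    simp
  rw [h4, norm_smul]
  gcongr
  · exact norm_cexp_mul_le l ht
  · rw [intervalIntegral.integral_neg, norm_neg]
    exact (norm_intervalIntegral_history_le hgi ht).trans hbd

/-- Variation of constants: `l f - f' = g`, `f(0) = 0` has a solution. -/
theorem W1p.exists_solution [CompleteSpace X] (l : ℂ) (g : LpHistory X p) :
    ∃ w : W1p X p, HasValueAtZero (W1p.fn w) 0 ∧ l • W1p.fn w - W1p.deriv w = g := by
  have hgi : IntegrableOn (fun r : ℝ => Complex.exp (-l * r) • g r) (Icc (-1 : ℝ) 0) :=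
    (integrable_history g).continuousOn_smul (by fun_prop) isCompact_Icc
  set H : ℝ → X := fun t => -(Complex.exp (l * t) •
    (∫ r in (0 : ℝ)..t, Complex.exp (-l * r) • g r)) with hH
  have hHc : ContinuousOn H (Icc (-1 : ℝ) 0) := by
    have h1 : ContinuousOn (fun t => ∫ r in (0 : ℝ)..t, Complex.exp (-l * r) • g r)
        (Icc (-1 : ℝ) 0) := by
      simpa using continuousOn_primitive_history hgi 0
    exact (ContinuousOn.smul (by fun_prop) h1).neg
  obtain ⟨C, hC⟩ := isCompact_Icc.exists_bound_of_continuousOn hHc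
  have hmem : MemLp H p delayMeasure := by
    refine MemLp.of_bound (hHc.aestronglyMeasurable measurableSet_Icc) C ?_
    filter_upwards [ae_restrict_mem (μ := volume) measurableSet_Icc] with t ht using hC t ht
  have hae : ∀ᵐ t ∂delayMeasure, (hmem.toLp H) t
      = 0 + ∫ r in (0 : ℝ)..t, (l • hmem.toLp H - g) r := by
    filter_upwards [hmem.coeFn_toLp, ae_restrict_mem (μ := volume) measurableSet_Icc] with t h1 ht
    rw [h1, zero_add]
    change -(Complex.exp (l * t) • (∫ r in (0 : ℝ)..t, Complex.exp (-l * r) • g r)) = _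
    rw [exp_smul_primitive l hgi ht, ← intervalIntegral.integral_neg]
    refine intervalIntegral_congr_history ?_ ht
    filter_upwards [Lp.coeFn_sub (l • hmem.toLp H) g, Lp.coeFn_smul l (hmem.toLp H),
      hmem.coeFn_toLp] with s h2 h3 h4
    rw [h2, Pi.sub_apply, h3, Pi.smul_apply, h4]
    change _ = l • -(Complex.exp (l * s) • (∫ r in (0 : ℝ)..s, Complex.exp (-l * r) • g r)) - g s
    have h5 : Complex.exp (l * s) • Complex.exp (-l * s) • g s = g s := by
      rw [smul_smul, ← Complex.exp_add]; simp
    rw [h5, smul_neg]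
    abel
  refine ⟨⟨(hmem.toLp H, l • hmem.toLp H - g), 0, hae⟩, ?_, ?_⟩
  · exact (W1p.hasValueAtZero_iff _ 0).2 hae
  · change l • hmem.toLp H - (l • hmem.toLp H - g) = g
    abel

theorem W1p.norm_def (w : W1p X p) : ‖w‖ = max ‖W1p.fn w‖ ‖W1p.deriv w‖ := rfl

/-- `h ⊗ x` as an element of `W^{1,p}`, for a continuously differentiable scalar function `h`. -/
theorem tensor_mem_W1p [CompleteSpace X] {h h' : ℝ → ℂ} (hc : Continuous h) (hc' : Continuous h')
    (hd : ∀ r, HasDerivAt h (h' r) r) (x : X) :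
    ((tensorLp hc x, tensorLp hc' x) : LpHistory X p × LpHistory X p) ∈ W1p X p := by
  refine ⟨h 0 • x, ?_⟩
  filter_upwards [(memLp_smul_const (p := p) hc x).coeFn_toLp,
    ae_restrict_mem (μ := volume) measurableSet_Icc] with t h1 ht
  have h2 : ∫ r in (0 : ℝ)..t, (tensorLp (p := p) hc' x) r = ∫ r in (0 : ℝ)..t, h' r • x :=
    intervalIntegral_congr_history (memLp_smul_const (p := p) hc' x).coeFn_toLp ht
  change ((memLp_smul_const (p := p) hc x).toLp _) t = _ + ∫ r in (0 : ℝ)..t, (tensorLp hc' x) r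
  rw [h1, h2, intervalIntegral.integral_eq_sub_of_hasDerivAt (fun r _ => (hd r).smul_const x)
    ((hc'.smul continuous_const).intervalIntegrable _ _)]
  abel

theorem norm_tensorLp_le {h : ℝ → ℂ} (hc : Continuous h) {C : ℝ} (hC0 : 0 ≤ C)
    (hC : ∀ t ∈ Icc (-1 : ℝ) 0, ‖h t‖ ≤ C) (x : X) :
    ‖(tensorLp hc x : LpHistory X p)‖ ≤ C * ‖x‖ := by
  refine norm_history_le_of_ae_bound (by positivity) ?_
  filter_upwards [(memLp_smul_const (p := p) hc x).coeFn_toLp,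
    ae_restrict_mem (μ := volume) measurableSet_Icc] with t h1 ht
  change ‖((memLp_smul_const (p := p) hc x).toLp _) t‖ ≤ _
  rw [h1, norm_smul]
  gcongr
  exact hC t ht

end SobolevCalculus

/-! ### The operators `ε_l ⊗ Id` depend analytically on `l` -/

section ExpTensor

variable {X : Type*} [NormedAddCommGroup X] [NormedSpace ℂ X] [CompleteSpace X]
  {p : ℝ≥0∞} [Fact (1 ≤ p)]

theorem expTensor_deriv (l : ℂ) (x : X) :
    W1p.deriv (expTensor X p l x) = l • W1p.fn (expTensor X p l x) := by
  have hd := (memLp_smul_const (p := p)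
    (show Continuous fun s : ℝ => l * Complex.exp (l * s) by fun_prop) x).coeFn_toLp
  refine Lp.ext ?_
  filter_upwards [hd, expTensor_fn (p := p) l x, Lp.coeFn_smul l (W1p.fn (expTensor X p l x))]
    with t h1 h2 h3
  rw [h3, Pi.smul_apply, h2, smul_smul]
  exact h1

theorem expTensor_hasValueAtZero (l : ℂ) (x : X) :
    HasValueAtZero (W1p.fn (expTensor X p l x)) x :=
  ⟨fun t => Complex.exp (l * t) • x, ⟨by fun_prop, expTensor_fn l x⟩, by simp⟩

theorem norm_expTensor_le {a : ℝ} (ha : a ≤ 0) {l : ℂ} (hl : a ≤ l.re) :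
    ‖expTensor X p l‖ ≤ Real.exp (-a) * (1 + ‖l‖) := by
  refine ContinuousLinearMap.opNorm_le_bound _ (by positivity) fun x => ?_
  have h1 : ‖W1p.fn (expTensor X p l x)‖ ≤ Real.exp (-a) * ‖x‖ := by
    refine norm_tensorLp_le _ (by positivity) (fun t ht => ?_) x
    rw [Complex.norm_exp, Real.exp_le_exp]
    simp only [Complex.mul_re, Complex.ofReal_re, Complex.ofReal_im, mul_zero, sub_zero]
    nlinarith [ht.1, ht.2]
  have h0 : 0 ≤ Real.exp (-a) * ‖x‖ := by positivity
  rw [W1p.norm_def, expTensor_deriv, norm_smul]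
  refine max_le ?_ ?_
  · nlinarith [norm_nonneg l]
  · nlinarith [norm_nonneg l]

/-- `h ⊗ Id` as a bounded operator into `W^{1,p}`. -/
def tensorW1p {h h' : ℝ → ℂ} (hc : Continuous h) (hc' : Continuous h')
    (hd : ∀ r, HasDerivAt h (h' r) r) : X →L[ℂ] W1p X p :=
  ((tensorLp hc).prod (tensorLp hc')).codRestrict (W1p X p) (tensor_mem_W1p hc hc' hd)

theorem tensorLp_sub_apply {f g h : ℝ → ℂ} (hf : Continuous f) (hg : Continuous g)
    (hh : Continuous h) (c : ℂ) (k : ℝ → ℂ) (hk : Continuous k)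
    (e : ∀ t, k t = f t - g t - c * h t) (x : X) :
    (tensorLp hk x : LpHistory X p) = tensorLp hf x - tensorLp hg x - c • tensorLp hh x := by
  refine Lp.ext ?_
  filter_upwards [(memLp_smul_const (p := p) hf x).coeFn_toLp,
    (memLp_smul_const (p := p) hg x).coeFn_toLp, (memLp_smul_const (p := p) hh x).coeFn_toLp,
    (memLp_smul_const (p := p) hk x).coeFn_toLp,
    Lp.coeFn_sub (tensorLp hf x - tensorLp hg x : LpHistory X p) (c • tensorLp hh x),
    Lp.coeFn_sub (tensorLp hf x : LpHistory X p) (tensorLp hg x),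
    Lp.coeFn_smul c (tensorLp hh x : LpHistory X p)] with t h1 h2 h3 h4 h5 h6 h7
  rw [h5, Pi.sub_apply, h6, Pi.sub_apply, h7, Pi.smul_apply]
  change ((memLp_smul_const (p := p) hk x).toLp _) t
    = ((memLp_smul_const (p := p) hf x).toLp _) t - ((memLp_smul_const (p := p) hg x).toLp _) t
      - c • ((memLp_smul_const (p := p) hh x).toLp _) t
  rw [h1, h2, h3, h4, e, sub_smul, sub_smul, smul_smul]

theorem norm_cexp_remainder_le (m z : ℂ) (hz : ‖z‖ ≤ 1) {t : ℝ} (ht : t ∈ Icc (-1 : ℝ) 0) :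
    ‖Complex.exp ((m + z) * t) - Complex.exp (m * t) - z * (t * Complex.exp (m * t))‖
      ≤ Real.exp ‖m‖ * ‖z‖ ^ 2 := by
  have h1 : Complex.exp ((m + z) * t) - Complex.exp (m * t) - z * (t * Complex.exp (m * t))
      = Complex.exp (m * t) * (Complex.exp (z * t) - 1 - z * t) := by
    rw [add_mul, Complex.exp_add]; ring
  have h2 : ‖z * t‖ ≤ ‖z‖ := by
    rw [norm_mul, Complex.norm_real]
    refine mul_le_of_le_one_right (norm_nonneg _) ?_
    rw [Real.norm_eq_abs, abs_le]
    exact ⟨ht.1, by linarith [ht.2]⟩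
  rw [h1, norm_mul]
  gcongr
  · exact norm_cexp_mul_le m ht
  · exact (Complex.norm_exp_sub_one_sub_id_le (h2.trans hz)).trans (by gcongr)

theorem differentiable_comp_expTensor (Φ : W1p X p →L[ℂ] X) :
    Differentiable ℂ (fun l => Φ.comp (expTensor X p l)) := by
  intro m
  have hc0 : Continuous fun s : ℝ => (s : ℂ) * Complex.exp (m * s) := by fun_prop
  have hc1 : Continuous fun s : ℝ => (1 + m * s) * Complex.exp (m * s) := by fun_prop
  have hd : ∀ r : ℝ, HasDerivAt (fun s : ℝ => (s : ℂ) * Complex.exp (m * s))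
      ((1 + m * r) * Complex.exp (m * r)) r := fun r => by
    have := (Complex.ofRealCLM.hasDerivAt (x := r)).mul (C0Semigroup.hasDerivAt_cexp m r)
    refine this.congr_deriv ?_
    simp only [Complex.ofRealCLM_apply, Complex.ofReal_one]
    ring
  refine HasDerivAt.differentiableAt (f' := Φ.comp (tensorW1p hc0 hc1 hd)) ?_
  rw [hasDerivAt_iff_isLittleO_nhds_zero]
  -- the derivative is `Φ(s e^{ms} ⊗ Id)`; the remainder is quadratic in `z`
  have hO : (fun z => Φ.comp (expTensor X p (m + z)) - Φ.comp (expTensor X p m)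
      - z • Φ.comp (tensorW1p hc0 hc1 hd))
      =O[𝓝 0] fun z : ℂ => ‖z‖ ^ 2 := by
    refine Asymptotics.IsBigO.of_bound (‖Φ‖ * (3 * Real.exp ‖m‖ * (1 + ‖m‖))) ?_
    filter_upwards [Metric.closedBall_mem_nhds (0 : ℂ) one_pos] with z hz
    have hz : ‖z‖ ≤ 1 := by simpa using hz
    rw [norm_pow, norm_norm]
    have hm0 := norm_nonneg m
    have hz0 := norm_nonneg z
    refine ContinuousLinearMap.opNorm_le_bound _ (by positivity) fun x => ?_
    have e0 : ‖tensorLp (p := p) (h := fun s : ℝ => Complex.exp ((m + z) * s)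
        - Complex.exp (m * s) - z * (s * Complex.exp (m * s))) (by fun_prop) x‖
        ≤ 3 * Real.exp ‖m‖ * (1 + ‖m‖) * ‖z‖ ^ 2 * ‖x‖ := by
      refine norm_tensorLp_le _ (by positivity) (fun t ht => ?_) x
      refine (norm_cexp_remainder_le m z hz ht).trans ?_
      gcongr
      have := Real.exp_pos ‖m‖
      nlinarith
    have e1 : ‖tensorLp (p := p) (h := fun s : ℝ => (m + z) * Complex.exp ((m + z) * s)
        - m * Complex.exp (m * s) - z * ((1 + m * s) * Complex.exp (m * s))) (by fun_prop) x‖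
        ≤ 3 * Real.exp ‖m‖ * (1 + ‖m‖) * ‖z‖ ^ 2 * ‖x‖ := by
      refine norm_tensorLp_le _ (by positivity) (fun t ht => ?_) x
      set R := Complex.exp ((m + z) * t) - Complex.exp (m * t) - z * (t * Complex.exp (m * t))
        with hR
      have hRn : ‖R‖ ≤ Real.exp ‖m‖ * ‖z‖ ^ 2 := norm_cexp_remainder_le m z hz ht
      have h1 : (m + z) * Complex.exp ((m + z) * t) - m * Complex.exp (m * t)
          - z * ((1 + m * t) * Complex.exp (m * t))
          = (m + z) * R + z * (z * (t * Complex.exp (m * t))) := by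
        rw [hR]; ring
      have h2 : ‖(t : ℂ) * Complex.exp (m * t)‖ ≤ Real.exp ‖m‖ := by
        rw [norm_mul, Complex.norm_real]
        refine (mul_le_of_le_one_left (norm_nonneg _) ?_).trans (norm_cexp_mul_le m ht)
        rw [Real.norm_eq_abs, abs_le]
        exact ⟨ht.1, by linarith [ht.2]⟩
      rw [h1]
      calc _ ≤ (‖m‖ + 1) * (Real.exp ‖m‖ * ‖z‖ ^ 2) + ‖z‖ * (‖z‖ * Real.exp ‖m‖) := by
            refine (norm_add_le _ _).trans ?_
            rw [norm_mul, norm_mul z, norm_mul z]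
            gcongr
            exact (norm_add_le _ _).trans (by gcongr)
        _ ≤ _ := by
            have := Real.exp_pos ‖m‖
            have h3 : 0 ≤ Real.exp ‖m‖ * ‖z‖ ^ 2 := by positivity
            have h4 : 0 ≤ Real.exp ‖m‖ * ‖z‖ ^ 2 * ‖m‖ := by positivity
            nlinarith
    have f0 := tensorLp_sub_apply (p := p)
      (show Continuous fun s : ℝ => Complex.exp ((m + z) * s) by fun_prop)
      (show Continuous fun s : ℝ => Complex.exp (m * s) by fun_prop) hc0 z
      (fun s : ℝ => Complex.exp ((m + z) * s)
        - Complex.exp (m * s) - z * (s * Complex.exp (m * s))) (by fun_prop) (fun _ => rfl) x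
    have f1 := tensorLp_sub_apply (p := p)
      (show Continuous fun s : ℝ => (m + z) * Complex.exp ((m + z) * s) by fun_prop)
      (show Continuous fun s : ℝ => m * Complex.exp (m * s) by fun_prop) hc1 z
      (fun s : ℝ => (m + z) * Complex.exp ((m + z) * s)
        - m * Complex.exp (m * s) - z * ((1 + m * s) * Complex.exp (m * s))) (by fun_prop)
      (fun _ => rfl) x
    rw [f0] at e0
    rw [f1] at e1
    change ‖Φ (expTensor X p (m + z) x) - Φ (expTensor X p m x)
      - z • Φ (tensorW1p hc0 hc1 hd x)‖ ≤ _
    rw [← map_smul, ← map_sub, ← map_sub, mul_assoc, mul_assoc, ← mul_assoc _ (‖z‖ ^ 2)]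
    exact Φ.le_opNorm_of_le (max_le e0 e1)
  refine hO.trans_isLittleO ?_
  have := (Asymptotics.isLittleO_norm_pow_id (E' := ℂ) (n := 2) (by norm_num))
  simpa using this

end ExpTensor

/-! ### The resolvent of the generator -/

section Resolvent

variable {X : Type*} [NormedAddCommGroup X] [NormedSpace ℂ X]

theorem C0Semigroup.generator_mem (S : C0Semigroup X) (x : S.generator.domain) :
    ((x : X), S.generator x) ∈ S.generatorGraph := by
  rw [← S.generator_graph]; exact S.generator.mem_graph x

theorem C0Semigroup.exists_of_mem_generatorGraph (S : C0Semigroup X) {y z : X}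
    (h : (y, z) ∈ S.generatorGraph) : ∃ hy : y ∈ S.generator.domain, S.generator ⟨y, hy⟩ = z := by
  rw [← S.generator_graph, LinearPMap.mem_graph_iff] at h
  obtain ⟨x, rfl, rfl⟩ := h
  exact ⟨x.2, rfl⟩

variable [CompleteSpace X]

theorem IsResolventAt.unique {A : X →ₗ.[ℂ] X} {l : ℂ} {R R' : X →L[ℂ] X}
    (h : IsResolventAt A l R) (h' : IsResolventAt A l R') : R = R' := by
  ext y
  obtain ⟨hy, e⟩ := h.1 y
  have := h'.2 ⟨R y, hy⟩
  rw [e] at this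
  exact this.symm

theorem IsResolventAt.unboundedResolvent_eq {A : X →ₗ.[ℂ] X} {l : ℂ} {R : X →L[ℂ] X}
    (h : IsResolventAt A l R) : unboundedResolvent A l = R := by
  have hex : ∃ R : X →L[ℂ] X, IsResolventAt A l R := ⟨R, h⟩
  rw [unboundedResolvent, dif_pos hex]
  exact hex.choose_spec.unique h

/-- The resolvent identity. -/
theorem IsResolventAt.sub_eq {A : X →ₗ.[ℂ] X} {l m : ℂ} {R Q : X →L[ℂ] X}
    (h : IsResolventAt A l R) (h' : IsResolventAt A m Q) : R - Q = (m - l) • R.comp Q := by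
  ext y
  obtain ⟨hy, e⟩ := h'.1 y
  have h1 := h.2 ⟨Q y, hy⟩
  have h2 : l • Q y - A ⟨Q y, hy⟩ = y - (m - l) • Q y := by
    have h3 : l • Q y - A ⟨Q y, hy⟩ = (m • Q y - A ⟨Q y, hy⟩) - (m - l) • Q y := by
      rw [sub_smul]; abel
    rw [h3, e]
  change R (l • Q y - A ⟨Q y, hy⟩) = Q y at h1
  rw [h2, map_sub, map_smul] at h1
  change R y - Q y = (m - l) • R (Q y)
  rw [sub_eq_iff_eq_add] at h1 ⊢
  exact h1.trans (add_comm _ _)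

/-- To the right of an exponential growth rate of `S`, the resolvent of the generator exists and is
bounded by the Laplace transform of the growth estimate. -/
theorem C0Semigroup.exists_isResolventAt (S : C0Semigroup X) {M r : ℝ}
    (hM : ∀ t : ℝ≥0, ‖S.toFun t‖ ≤ M * Real.exp (r * t)) {l : ℂ} (hl : r < l.re) :
    ∃ R : X →L[ℂ] X, IsResolventAt S.generator l R ∧ ‖R‖ ≤ M / (l.re - r) := by
  have hd : 0 < l.re - r := by linarith
  have hM0 : 0 ≤ M := by
    have := (norm_nonneg _).trans (hM 0)
    simpa using this
  have hint : ∀ y, IntegrableOn (fun s : ℝ => Complex.exp (-l * s) • S.toFun s.toNNReal y)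
      (Ioi 0) ∧ ‖∫ s in Ioi (0 : ℝ), Complex.exp (-l * s) • S.toFun s.toNNReal y‖
        ≤ M / (l.re - r) * ‖y‖ := by
    intro y
    have hg : IntegrableOn (fun s : ℝ => (M * ‖y‖) * Real.exp ((r - l.re) * s)) (Ioi 0) :=
      (integrableOn_exp_mul_Ioi (by linarith) 0).const_mul _
    have hle : ∀ᵐ s : ℝ ∂volume.restrict (Ioi 0), ‖Complex.exp (-l * s) • S.toFun s.toNNReal y‖
        ≤ (M * ‖y‖) * Real.exp ((r - l.re) * s) := by
      filter_upwards [ae_restrict_mem measurableSet_Ioi] with s hs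
      have hs' : 0 ≤ s := le_of_lt hs
      rw [← S.rescale_real l hs']
      refine (((S.rescale l).toFun s.toNNReal).le_of_opNorm_le
        (S.rescale_norm_le l hM s.toNNReal) y).trans ?_
      rw [Real.coe_toNNReal s hs']; apply le_of_eq; ring
    refine ⟨hg.mono' ?_ hle, (norm_integral_le_of_norm_le hg hle).trans (le_of_eq ?_)⟩
    · have := S.continuous_toNNReal y
      exact Continuous.aestronglyMeasurable (by fun_prop)
    · rw [integral_const_mul, integral_exp_mul_Ioi (by linarith)]
      have : r - l.re ≠ 0 := by linarith
      have : l.re - r ≠ 0 := by linarith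
      rw [mul_zero, Real.exp_zero, ← neg_sub l.re r]
      field_simp
  let R : X →L[ℂ] X := LinearMap.mkContinuous
    { toFun := fun y => ∫ s in Ioi (0 : ℝ), Complex.exp (-l * s) • S.toFun s.toNNReal y
      map_add' := fun y z => by
        rw [← integral_add (hint y).1 (hint z).1]
        simp only [_root_.map_add, smul_add]
      map_smul' := fun c y => by
        rw [RingHom.id_apply, ← integral_smul]
        simp only [map_smul, smul_comm c] } (M / (l.re - r)) fun y => (hint y).2
  have hR : ∀ y, (R y, l • R y - y) ∈ S.generatorGraph := fun y =>
    S.laplace_mem_generatorGraph hM hl y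
  refine ⟨R, ⟨fun y => ?_, fun x => ?_⟩, LinearMap.mkContinuous_norm_le _ (by positivity) _⟩
  · obtain ⟨h, e⟩ := S.exists_of_mem_generatorGraph (hR y)
    exact ⟨h, by rw [e]; abel⟩
  · have h1 := S.generatorGraph.sub_mem (hR (l • (x : X) - S.generator x)) (S.generator_mem x)
    have h2 := S.eq_zero_of_mem_generatorGraph hM hl (y := R (l • (x : X) - S.generator x) - x) (by
      convert h1 using 1
      refine Prod.ext rfl ?_
      change l • (R (l • (x : X) - S.generator x) - x)
        = l • R (l • (x : X) - S.generator x) - (l • (x : X) - S.generator x) - S.generator x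
      rw [smul_sub]; abel)
    exact sub_eq_zero.1 h2

theorem C0Semigroup.isResolventAt (S : C0Semigroup X) {M r : ℝ}
    (hM : ∀ t : ℝ≥0, ‖S.toFun t‖ ≤ M * Real.exp (r * t)) {l : ℂ} (hl : r < l.re) :
    IsResolventAt S.generator l (unboundedResolvent S.generator l) := by
  obtain ⟨R, hR, -⟩ := S.exists_isResolventAt hM hl
  rwa [hR.unboundedResolvent_eq]

theorem C0Semigroup.norm_unboundedResolvent_le (S : C0Semigroup X) {M r : ℝ}
    (hM : ∀ t : ℝ≥0, ‖S.toFun t‖ ≤ M * Real.exp (r * t)) {l : ℂ} (hl : r < l.re) :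
    ‖unboundedResolvent S.generator l‖ ≤ M / (l.re - r) := by
  obtain ⟨R, hR, hn⟩ := S.exists_isResolventAt hM hl
  rwa [hR.unboundedResolvent_eq]

theorem C0Semigroup.differentiableAt_unboundedResolvent (S : C0Semigroup X) {M r : ℝ}
    (hM : ∀ t : ℝ≥0, ‖S.toFun t‖ ≤ M * Real.exp (r * t)) {m : ℂ} (hm : r < m.re) :
    DifferentiableAt ℂ (unboundedResolvent S.generator) m := by
  set R := unboundedResolvent S.generator with hR
  have hM0 : 0 ≤ M := by
    have := (norm_nonneg _).trans (hM 0)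
    simpa using this
  have hnhds : ∀ᶠ l in 𝓝 m, (m.re + r) / 2 < l.re :=
    Complex.continuous_re.continuousAt.eventually (lt_mem_nhds (by linarith))
  have hid : ∀ᶠ l in 𝓝 m, R l - R m = (m - l) • (R l).comp (R m) := by
    filter_upwards [hnhds] with l hl
    exact (S.isResolventAt hM (by linarith)).sub_eq (S.isResolventAt hM hm)
  have hbd : ∀ᶠ l in 𝓝 m, ‖R l‖ ≤ M / ((m.re - r) / 2) := by
    filter_upwards [hnhds] with l hl
    refine (S.norm_unboundedResolvent_le hM (by linarith)).trans ?_
    gcongr; linarith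
  have hcont : Tendsto R (𝓝 m) (𝓝 (R m)) := by
    rw [tendsto_iff_norm_sub_tendsto_zero]
    have h0 : Tendsto (fun l : ℂ => ‖m - l‖ * (M / ((m.re - r) / 2) * ‖R m‖)) (𝓝 m) (𝓝 0) := by
      have h1 : Continuous fun l : ℂ => ‖m - l‖ * (M / ((m.re - r) / 2) * ‖R m‖) := by fun_prop
      simpa using h1.tendsto m
    refine squeeze_zero' (Eventually.of_forall fun _ => norm_nonneg _) ?_ h0
    filter_upwards [hid, hbd] with l h1 h2
    rw [h1, norm_smul]
    gcongr
    exact (ContinuousLinearMap.opNorm_comp_le _ _).trans (by gcongr)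
  refine HasDerivAt.differentiableAt (f' := -(R m).comp (R m)) ?_
  rw [hasDerivAt_iff_tendsto_slope]
  have h1 : Tendsto (fun l => -(R l).comp (R m)) (𝓝[≠] m) (𝓝 (-(R m).comp (R m))) :=
    ((continuous_id.clm_comp continuous_const).neg.tendsto (R m)).comp
      (hcont.mono_left nhdsWithin_le_nhds)
  refine h1.congr' ?_
  filter_upwards [nhdsWithin_le_nhds hid, self_mem_nhdsWithin] with l h2 h3
  rw [slope_def_module, h2, smul_smul, ← neg_sub l m, mul_neg, inv_mul_cancel₀ (sub_ne_zero.2 h3),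
    neg_one_smul]

end Resolvent

/-! ### The characteristic operator `R(l, A) Φ(ε_l ⊗ Id)` on the half plane -/

section Characteristic

variable {X : Type*} [NormedAddCommGroup X] [NormedSpace ℂ X] [CompleteSpace X]
  {p : ℝ≥0∞} [Fact (1 ≤ p)]

/-- The bound on the line `Re l = a` extends to the half plane `Re l ≥ a`, by the
Phragmén–Lindelöf principle. -/
theorem exists_norm_resolvent_comp_le (S : C0Semigroup X) (Φ : W1p X p →L[ℂ] X)
    {M r a : ℝ} (hM : ∀ t : ℝ≥0, ‖S.toFun t‖ ≤ M * Real.exp (r * t)) (hr : r < a) (ha : a ≤ 0)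
    (h : (⨆ ω : ℝ, ‖Φ.comp (expTensor X p ((a : ℂ) + Complex.I * (ω : ℂ)))‖ₑ) <
      (⨆ ω : ℝ, ‖unboundedResolvent S.generator ((a : ℂ) + Complex.I * (ω : ℂ))‖ₑ)⁻¹) :
    ∃ c < (1 : ℝ), ∀ l : ℂ, a ≤ l.re →
      ‖(unboundedResolvent S.generator l).comp (Φ.comp (expTensor X p l))‖ ≤ c := by
  set R := unboundedResolvent S.generator with hR
  set P : ℂ → X →L[ℂ] X := fun l => Φ.comp (expTensor X p l) with hP
  have hM0 : 0 ≤ M := by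
    have := (norm_nonneg _).trans (hM 0)
    simpa using this
  set B := ⨆ ω : ℝ, ‖R ((a : ℂ) + Complex.I * (ω : ℂ))‖ₑ with hB
  set Q := ⨆ ω : ℝ, ‖P ((a : ℂ) + Complex.I * (ω : ℂ))‖ₑ with hQ
  have hBQ : B * Q < 1 := by
    rw [mul_comm]
    exact ENNReal.mul_lt_of_lt_div (by rwa [one_div])
  have hd : 0 < a - r := by linarith
  have hPn : ∀ l : ℂ, a ≤ l.re → ‖P l‖ ≤ ‖Φ‖ * (Real.exp (-a) * (1 + ‖l‖)) := fun l hl =>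
    (ContinuousLinearMap.opNorm_comp_le _ _).trans (by gcongr; exact norm_expTensor_le ha hl)
  set f : ℂ → X →L[ℂ] X := fun z => (R (a + z)).comp (P (a + z)) with hf
  refine ⟨(B * Q).toReal, ?_, fun l hl => ?_⟩
  · rw [← ENNReal.toReal_one]
    exact (ENNReal.toReal_lt_toReal (hBQ.trans ENNReal.one_lt_top).ne ENNReal.one_ne_top).2 hBQ
  have key : ‖f (l - a)‖ ≤ (B * Q).toReal := by
    refine PhragmenLindelof.right_half_plane_of_bounded_on_real ?_ ?_ ?_ ?_ (by simpa using hl)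
    -- analyticity
    · refine DifferentiableOn.diffContOnCl fun z hz => ?_
      have hz' : 0 ≤ z.re := by
        have hcl : IsClosed {z : ℂ | 0 ≤ z.re} := isClosed_le continuous_const Complex.continuous_re
        exact closure_minimal (s := {z : ℂ | 0 < z.re}) (t := {z : ℂ | 0 ≤ z.re})
          (fun w (hw : 0 < w.re) => hw.le) hcl hz
      have h1 : DifferentiableAt ℂ R ((a : ℂ) + z) :=
        S.differentiableAt_unboundedResolvent hM (by simp; linarith)
      have h2 : DifferentiableAt ℂ P ((a : ℂ) + z) := differentiable_comp_expTensor Φ _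
      have h3 : DifferentiableAt ℂ (fun z : ℂ => (a : ℂ) + z) z := by fun_prop
      exact ((h1.comp z h3).clm_comp (h2.comp z h3)).differentiableWithinAt
    -- growth of order at most `1`, which is less than `2`
    · refine ⟨1, by norm_num, 1, ?_⟩
      refine Asymptotics.IsBigO.of_bound
        (M / (a - r) * (‖Φ‖ * (Real.exp (-a) * (1 + |a|)))) ?_
      filter_upwards [mem_inf_of_right (mem_principal_self _)] with z hz
      have hz' : 0 < z.re := hz
      have e1 : ‖R (a + z)‖ ≤ M / (a - r) := by
        refine (S.norm_unboundedResolvent_le hM (by simp; linarith)).trans ?_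
        gcongr
        simp; linarith
      have e2 := hPn (a + z) (by simp; linarith)
      have e3 : 1 + ‖(a : ℂ) + z‖ ≤ (1 + |a|) * Real.exp ‖z‖ := by
        have h1 : ‖(a : ℂ) + z‖ ≤ |a| + ‖z‖ := by
          refine (norm_add_le _ _).trans ?_
          rw [Complex.norm_real, Real.norm_eq_abs]
        have h2 : 1 + ‖z‖ ≤ Real.exp ‖z‖ := by linarith [Real.add_one_le_exp ‖z‖]
        have h3 : (1 + |a|) * (1 + ‖z‖) ≤ (1 + |a|) * Real.exp ‖z‖ := by gcongr
        nlinarith [mul_nonneg (abs_nonneg a) (norm_nonneg z)]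
      calc ‖f z‖ ≤ ‖R (a + z)‖ * ‖P (a + z)‖ := ContinuousLinearMap.opNorm_comp_le _ _
        _ ≤ M / (a - r) * (‖Φ‖ * (Real.exp (-a) * ((1 + |a|) * Real.exp ‖z‖))) := by
            gcongr
            exact e2.trans (by gcongr)
        _ = _ := by
            rw [Real.rpow_one, one_mul, Real.norm_eq_abs, abs_of_pos (Real.exp_pos _)]
            ring
    -- boundedness on the positive real axis: `Φ(ε_l ⊗ Id)` grows linearly, and the resolvent decays
    -- like `1 / l`
    · refine ⟨M * (‖Φ‖ * (Real.exp (-a) * (1 + (1 + |a|) / (a - r)))), ?_⟩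
      rw [eventually_map]
      filter_upwards [eventually_ge_atTop 0] with x hx
      have e1 : ‖R (a + (x : ℂ))‖ ≤ M / (x + (a - r)) := by
        refine (S.norm_unboundedResolvent_le hM (by simp; linarith)).trans (le_of_eq ?_)
        congr 1; simp; ring
      have e2 := hPn (a + x) (by simpa using hx)
      have e3 : 1 + ‖(a : ℂ) + x‖ ≤ (1 + |a|) + x := by
        have h1 : ‖(a : ℂ) + x‖ ≤ |a| + x := by
          refine (norm_add_le _ _).trans ?_
          rw [Complex.norm_real, Real.norm_eq_abs, Complex.norm_real, Real.norm_eq_abs,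
            abs_of_nonneg hx]
        linarith
      have hxd : 0 < x + (a - r) := by linarith
      calc ‖f x‖ ≤ ‖R (a + x)‖ * ‖P (a + x)‖ := ContinuousLinearMap.opNorm_comp_le _ _
        _ ≤ M / (x + (a - r)) * (‖Φ‖ * (Real.exp (-a) * ((1 + |a|) + x))) := by
            gcongr
            exact e2.trans (by gcongr)
        _ = M * (‖Φ‖ * (Real.exp (-a) * (((1 + |a|) + x) / (x + (a - r))))) := by ring
        _ ≤ _ := by
            gcongr
            rw [add_div, add_comm]
            gcongr
            · rw [div_le_one hxd]; linarith
            · linarith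
    -- the bound on the imaginary axis
    · intro x
      have hx : (a : ℂ) + x * Complex.I = a + Complex.I * x := by ring
      have h1 : ‖f (x * Complex.I)‖ₑ ≤ B * Q := by
        simp only [hf, hx]
        refine le_trans ?_ (mul_le_mul' (le_iSup (fun ω : ℝ => ‖R ((a : ℂ) + Complex.I * ω)‖ₑ) x)
          (le_iSup (fun ω : ℝ => ‖P ((a : ℂ) + Complex.I * ω)‖ₑ) x))
        rw [← ofReal_norm, ← ofReal_norm, ← ofReal_norm, ← ENNReal.ofReal_mul (norm_nonneg _)]
        exact ENNReal.ofReal_le_ofReal (ContinuousLinearMap.opNorm_comp_le _ _)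
      rw [← toReal_enorm]
      exact ENNReal.toReal_mono (hBQ.trans ENNReal.one_lt_top).ne h1
  simpa [hf, hP] using key

/-! ### Solvability of `l u - 𝒜 u = v` -/

theorem norm_solution_le (l : ℂ) (w : W1p X p) (h0 : HasValueAtZero (W1p.fn w) 0) :
    ‖w‖ ≤ (1 + (1 + ‖l‖) * (Real.exp ‖l‖ * Real.exp ‖l‖)) * ‖l • W1p.fn w - W1p.deriv w‖ := by
  have h1 := W1p.norm_fn_le l w h0
  set g := l • W1p.fn w - W1p.deriv w with hg
  set e := Real.exp ‖l‖ with he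
  have he0 : 0 < e := Real.exp_pos _
  have hl0 := norm_nonneg l
  have hg0 := norm_nonneg g
  have h2 : ‖W1p.deriv w‖ ≤ ‖l‖ * (e * (e * ‖g‖)) + ‖g‖ := by
    have : W1p.deriv w = l • W1p.fn w - g := by rw [hg]; abel
    rw [this]
    refine (norm_sub_le _ _).trans ?_
    rw [norm_smul]
    gcongr
  rw [W1p.norm_def]
  have h3 : 0 ≤ e * e * ‖g‖ := by positivity
  have h4 : 0 ≤ ‖l‖ * (e * e * ‖g‖) := by positivity
  refine max_le (h1.trans ?_) (h2.trans ?_) <;> nlinarith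

/-- If `‖R(l, A) Φ(ε_l ⊗ Id)‖ < 1`, then `l - 𝒜` is bounded below: if `(y, g) = (l - 𝒜)(x, w)`, then
`w = ε_l ⊗ x + d`, where `d` is controlled by `g`, and `x = R(l, A) (Φ(ε_l ⊗ x) + y + Φ d)`. -/
theorem delayGraph_lower_bound {A : X →ₗ.[ℂ] X} (Φ : W1p X p →L[ℂ] X) {l : ℂ} {R : X →L[ℂ] X}
    (hR : IsResolventAt A l R) (hc : ‖R.comp (Φ.comp (expTensor X p l))‖ < 1) :
    ∃ C : ℝ, ∀ u ∈ delayGraph A Φ, ‖u.1‖ ≤ C * ‖l • u.1 - u.2‖ := by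
  set c := ‖R.comp (Φ.comp (expTensor X p l))‖ with hcdef
  set K := 1 + (1 + ‖l‖) * (Real.exp ‖l‖ * Real.exp ‖l‖) with hK
  have hK0 : 0 < K := by positivity
  set Cx := (1 - c)⁻¹ * (‖R‖ * (1 + ‖Φ‖ * K)) with hCx
  have hc1 : 0 < 1 - c := by linarith
  have hCx0 : 0 ≤ Cx := by positivity
  refine ⟨Cx + (K + ‖expTensor X p l‖ * Cx), ?_⟩
  rintro _ ⟨x, w, hw, rfl⟩
  set v : DelaySpace X p := l • ((x : X), W1p.fn w) - (A x + Φ w, W1p.deriv w) with hv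
  have hy : ‖l • (x : X) - (A x + Φ w)‖ ≤ ‖v‖ := le_max_left _ _
  have hg : ‖l • W1p.fn w - W1p.deriv w‖ ≤ ‖v‖ := le_max_right _ _
  set d : W1p X p := w - expTensor X p l x with hd
  have hd0 : HasValueAtZero (W1p.fn d) 0 := by
    have := hw.add ((expTensor_hasValueAtZero (p := p) l (x : X)).smul (-1))
    rw [neg_one_smul, neg_one_smul, ← sub_eq_add_neg, ← sub_eq_add_neg, sub_self] at this
    exact this
  have hdg : l • W1p.fn d - W1p.deriv d = l • W1p.fn w - W1p.deriv w := by
    change l • (W1p.fn w - W1p.fn (expTensor X p l x))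
      - (W1p.deriv w - W1p.deriv (expTensor X p l x)) = _
    rw [expTensor_deriv, smul_sub]; abel
  have hdn : ‖d‖ ≤ K * ‖v‖ := by
    refine (norm_solution_le l d hd0).trans ?_
    rw [hdg]
    gcongr
  have hwd : w = expTensor X p l x + d := by rw [hd]; abel
  have hx : (x : X) = R (Φ (expTensor X p l x)) + R ((l • (x : X) - (A x + Φ w)) + Φ d) := by
    have h1 := hR.2 x
    rw [← _root_.map_add]
    have h2 : Φ (expTensor X p l x) + ((l • (x : X) - (A x + Φ w)) + Φ d) = l • (x : X) - A x := by
      have : Φ w = Φ (expTensor X p l x) + Φ d := by rw [← _root_.map_add, ← hwd]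
      rw [this]; abel
    rw [h2, h1]
  have hxn : ‖(x : X)‖ ≤ Cx * ‖v‖ := by
    have h1 : ‖(x : X)‖ ≤ c * ‖(x : X)‖ + ‖R‖ * (‖v‖ + ‖Φ‖ * (K * ‖v‖)) := by
      calc ‖(x : X)‖ = ‖R (Φ (expTensor X p l x)) + R ((l • (x : X) - (A x + Φ w)) + Φ d)‖ := by
            rw [← hx]
        _ ≤ _ := by
            refine (norm_add_le _ _).trans (add_le_add ?_ ?_)
            · exact (R.comp (Φ.comp (expTensor X p l))).le_opNorm x
            · refine R.le_opNorm_of_le ((norm_add_le _ _).trans (add_le_add hy ?_))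
              exact Φ.le_opNorm_of_le hdn
    rw [hCx, mul_assoc, inv_mul_eq_div, le_div_iff₀ hc1]
    nlinarith
  have hwn : ‖W1p.fn w‖ ≤ (K + ‖expTensor X p l‖ * Cx) * ‖v‖ := by
    have h1 : ‖w‖ ≤ ‖expTensor X p l‖ * (Cx * ‖v‖) + K * ‖v‖ := by
      rw [hwd]
      exact (norm_add_le _ _).trans (add_le_add ((expTensor X p l).le_opNorm_of_le hxn) hdn)
    have h2 : ‖W1p.fn w‖ ≤ ‖w‖ := le_max_left _ _
    linarith
  have h0 : 0 ≤ K + ‖expTensor X p l‖ * Cx := by positivity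
  change max ‖(x : X)‖ ‖W1p.fn w‖ ≤ _
  refine max_le (hxn.trans ?_) (hwn.trans ?_)
  · exact mul_le_mul_of_nonneg_right (by linarith) (norm_nonneg _)
  · exact mul_le_mul_of_nonneg_right (by linarith) (norm_nonneg _)

/-- If `‖R(l, A) Φ(ε_l ⊗ Id)‖ < 1`, then `l - 𝒜` is surjective: the Neumann series solves
`x = R(l, A) (Φ(ε_l ⊗ x) + y + Φ d)`. -/
theorem delayGraph_surjective {A : X →ₗ.[ℂ] X} (Φ : W1p X p →L[ℂ] X) {l : ℂ} {R : X →L[ℂ] X}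
    (hR : IsResolventAt A l R) (hc : ‖R.comp (Φ.comp (expTensor X p l))‖ < 1)
    (v : DelaySpace X p) : ∃ u ∈ delayGraph A Φ, l • u.1 - u.2 = v := by
  obtain ⟨d, hd0, hdg⟩ := W1p.exists_solution (p := p) l v.2
  set P := R.comp (Φ.comp (expTensor X p l)) with hP
  obtain ⟨x, hx⟩ : ∃ x : X, x = R (Φ (expTensor X p l x) + (v.1 + Φ d)) := by
    obtain ⟨u, hu⟩ := isUnit_one_sub_of_norm_lt_one hc
    refine ⟨(↑u⁻¹ : X →L[ℂ] X) (R (v.1 + Φ d)), ?_⟩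
    set x := (↑u⁻¹ : X →L[ℂ] X) (R (v.1 + Φ d)) with hx
    have h1 : (u : X →L[ℂ] X) x = R (v.1 + Φ d) := by
      change ((u : X →L[ℂ] X) * (↑u⁻¹ : X →L[ℂ] X)) _ = _
      rw [u.mul_inv]; rfl
    rw [hu] at h1
    have h2 : x - R (Φ (expTensor X p l x)) = R (v.1 + Φ d) := h1
    rw [_root_.map_add, ← h2]
    abel
  obtain ⟨hdom, e⟩ := hR.1 (Φ (expTensor X p l x) + (v.1 + Φ d))
  set x' : A.domain := ⟨_, hdom⟩ with hx'
  have hxx : (x' : X) = x := hx.symm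
  refine ⟨(((x' : X), W1p.fn (expTensor X p l x + d)),
    (A x' + Φ (expTensor X p l x + d), W1p.deriv (expTensor X p l x + d))),
    ⟨x', expTensor X p l x + d, ?_, rfl⟩, ?_⟩
  · rw [hxx]
    have := (expTensor_hasValueAtZero (p := p) l x).add hd0
    rwa [add_zero] at this
  · refine Prod.ext ?_ ?_
    · change l • (x' : X) - (A x' + Φ (expTensor X p l x + d)) = v.1
      rw [_root_.map_add, ← sub_sub, e]
      abel
    · change l • (W1p.fn (expTensor X p l x) + W1p.fn d)
        - (W1p.deriv (expTensor X p l x) + W1p.deriv d) = v.2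
      rw [expTensor_deriv, ← hdg, smul_add]
      abel

end Characteristic

/-! ### The semigroup of the undelayed problem on `X × L^p([-1,0], X)` -/

section Undelayed

variable {X : Type*} [NormedAddCommGroup X] [NormedSpace ℂ X]
  {p : ℝ≥0∞} [Fact (1 ≤ p)]

/-- The operator valued function `r ↦ S(r)` for `r > 0`, extended by `0`. -/
def orbitKernel (S : C0Semigroup X) : ℝ → (X →L[ℂ] X) :=
  (Ioi (0 : ℝ)).indicator fun r => S.toFun r.toNNReal

theorem memLp_orbitKernel (S : C0Semigroup X) (hc : S.ImmediatelyNormContinuous) {M r : ℝ}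
    (hM : ∀ t : ℝ≥0, ‖S.toFun t‖ ≤ M * Real.exp (r * t)) (hr : r < 0) (hp : p ≠ ⊤) :
    MemLp (orbitKernel S) p volume := by
  have hp0 : p ≠ 0 := (one_pos.trans_le (Fact.out : 1 ≤ p)).ne'
  have hpr : 0 < p.toReal := ENNReal.toReal_pos hp0 hp
  have hmeas : AEStronglyMeasurable (orbitKernel S) volume := by
    refine (aestronglyMeasurable_indicator_iff measurableSet_Ioi).2 ?_
    refine ContinuousOn.aestronglyMeasurable ?_ measurableSet_Ioi
    exact hc.comp continuous_real_toNNReal.continuousOn fun s hs => Real.toNNReal_pos.2 hs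
  set g : ℝ → ℝ := (Ioi (0 : ℝ)).indicator fun s => M * Real.exp (r * s) with hg
  have hgm : MemLp g p volume := by
    have hgmeas : AEStronglyMeasurable g volume := by
      refine (aestronglyMeasurable_indicator_iff measurableSet_Ioi).2 ?_
      exact Continuous.aestronglyMeasurable (by fun_prop)
    rw [← integrable_norm_rpow_iff hgmeas hp0 hp]
    have e : (fun s => ‖g s‖ ^ p.toReal)
        = (Ioi (0 : ℝ)).indicator fun s => |M| ^ p.toReal * Real.exp ((r * p.toReal) * s) := by
      funext s
      by_cases hs : s ∈ Ioi (0 : ℝ)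
      · rw [hg, indicator_of_mem hs, indicator_of_mem hs, norm_mul, Real.norm_eq_abs,
          Real.norm_eq_abs, abs_of_pos (Real.exp_pos _),
          Real.mul_rpow (abs_nonneg _) (Real.exp_pos _).le, ← Real.exp_mul]
        ring_nf
      · rw [hg, indicator_of_notMem hs, indicator_of_notMem hs, norm_zero, Real.zero_rpow hpr.ne']
    rw [e, integrable_indicator_iff measurableSet_Ioi]
    exact (integrableOn_exp_mul_Ioi (mul_neg_of_neg_of_pos hr hpr) 0).const_mul _
  refine hgm.mono hmeas (Eventually.of_forall fun s => ?_)
  by_cases hs : s ∈ Ioi (0 : ℝ)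
  · rw [orbitKernel, hg, indicator_of_mem hs, indicator_of_mem hs]
    have := hM s.toNNReal
    rw [Real.coe_toNNReal s (le_of_lt hs)] at this
    exact this.trans (le_abs_self _)
  · rw [orbitKernel, hg, indicator_of_notMem hs, indicator_of_notMem hs, norm_zero, norm_zero]

/-- Pointwise evaluation of operator valued `L^p` functions, as an operator valued map. -/
def evalLp (μ : Measure ℝ) : Lp (X →L[ℂ] X) p μ →L[ℂ] X →L[ℂ] Lp X p μ :=
  LinearMap.mkContinuous₂
    (LinearMap.mk₂ ℂ (fun (g : Lp (X →L[ℂ] X) p μ) (x : X) =>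
        (ContinuousLinearMap.apply ℂ X x).compLp g)
      (fun g h x => by
        refine Lp.ext ?_
        filter_upwards [Lp.coeFn_add g h, ContinuousLinearMap.coeFn_compLp
          (ContinuousLinearMap.apply ℂ X x) (g + h), ContinuousLinearMap.coeFn_compLp
          (ContinuousLinearMap.apply ℂ X x) g, ContinuousLinearMap.coeFn_compLp
          (ContinuousLinearMap.apply ℂ X x) h, Lp.coeFn_add
            ((ContinuousLinearMap.apply ℂ X x).compLp g)
            ((ContinuousLinearMap.apply ℂ X x).compLp h)] with t h1 h2 h3 h4 h5
        rw [h2, h1, h5, Pi.add_apply, Pi.add_apply, h3, h4]; rfl)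
      (fun c g x => by
        refine Lp.ext ?_
        filter_upwards [Lp.coeFn_smul c g, ContinuousLinearMap.coeFn_compLp
          (ContinuousLinearMap.apply ℂ X x) (c • g), ContinuousLinearMap.coeFn_compLp
          (ContinuousLinearMap.apply ℂ X x) g, Lp.coeFn_smul c
            ((ContinuousLinearMap.apply ℂ X x).compLp g)] with t h1 h2 h3 h4
        rw [h2, h1, h4, Pi.smul_apply, Pi.smul_apply, h3]; rfl)
      (fun g x y => by
        refine Lp.ext ?_
        filter_upwards [ContinuousLinearMap.coeFn_compLp
          (ContinuousLinearMap.apply ℂ X (x + y)) g, ContinuousLinearMap.coeFn_compLp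
          (ContinuousLinearMap.apply ℂ X x) g, ContinuousLinearMap.coeFn_compLp
          (ContinuousLinearMap.apply ℂ X y) g, Lp.coeFn_add
            ((ContinuousLinearMap.apply ℂ X x).compLp g)
            ((ContinuousLinearMap.apply ℂ X y).compLp g)] with t h1 h2 h3 h4
        rw [h1, h4, Pi.add_apply, h2, h3]
        exact (g t).map_add x y)
      (fun c g x => by
        refine Lp.ext ?_
        filter_upwards [ContinuousLinearMap.coeFn_compLp
          (ContinuousLinearMap.apply ℂ X (c • x)) g, ContinuousLinearMap.coeFn_compLp
          (ContinuousLinearMap.apply ℂ X x) g, Lp.coeFn_smul c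
            ((ContinuousLinearMap.apply ℂ X x).compLp g)] with t h1 h2 h3
        rw [h1, h3, Pi.smul_apply, h2]
        exact (g t).map_smul c x)) 1 fun g x => by
    refine ((ContinuousLinearMap.apply ℂ X x).norm_compLp_le g).trans ?_
    rw [one_mul, mul_comm]
    gcongr
    refine ContinuousLinearMap.opNorm_le_bound _ (norm_nonneg _) fun T => ?_
    rw [mul_comm]
    exact T.le_opNorm x

theorem evalLp_ae {μ : Measure ℝ} (g : Lp (X →L[ℂ] X) p μ) (x : X) :
    ∀ᵐ t ∂μ, evalLp μ g x t = g t x :=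
  ContinuousLinearMap.coeFn_compLp (ContinuousLinearMap.apply ℂ X x) g

theorem memLp_indicator_history (f : LpHistory X p) :
    MemLp ((Icc (-1 : ℝ) 0).indicator (f : ℝ → X)) p volume :=
  (memLp_indicator_iff_restrict measurableSet_Icc).2 (Lp.memLp f)

/-- Extension of history functions by `0` to the real line. -/
def extendHistory : LpHistory X p →L[ℂ] Lp X p (volume : Measure ℝ) :=
  LinearMap.mkContinuous
    { toFun := fun f => (memLp_indicator_history f).toLp _
      map_add' := fun f g => by
        rw [← MemLp.toLp_add]
        refine MemLp.toLp_congr _ _ ?_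
        have h := (ae_restrict_iff' measurableSet_Icc).1 (Lp.coeFn_add f g)
        filter_upwards [h] with t ht
        by_cases hs : t ∈ Icc (-1 : ℝ) 0
        · simp only [Pi.add_apply, indicator_of_mem hs]; exact ht hs
        · simp only [Pi.add_apply, indicator_of_notMem hs, add_zero]
      map_smul' := fun c f => by
        rw [RingHom.id_apply, ← MemLp.toLp_const_smul]
        refine MemLp.toLp_congr _ _ ?_
        have h := (ae_restrict_iff' measurableSet_Icc).1 (Lp.coeFn_smul c f)
        filter_upwards [h] with t ht
        by_cases hs : t ∈ Icc (-1 : ℝ) 0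
        · simp only [Pi.smul_apply, indicator_of_mem hs]; exact ht hs
        · simp only [Pi.smul_apply, indicator_of_notMem hs, smul_zero] } 1 fun f => by
    change ‖(memLp_indicator_history f).toLp _‖ ≤ _
    rw [Lp.norm_toLp, eLpNorm_indicator_eq_eLpNorm_restrict measurableSet_Icc, one_mul, Lp.norm_def]

theorem extendHistory_ae (f : LpHistory X p) :
    ∀ᵐ t : ℝ, extendHistory f t = (Icc (-1 : ℝ) 0).indicator (f : ℝ → X) t := by
  have h : extendHistory f = (memLp_indicator_history f).toLp _ := rfl
  rw [h]
  exact (memLp_indicator_history f).coeFn_toLp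

/-- Translation `f ↦ f(t + ·)` on `L^p(ℝ)`. -/
def translateLp (F : Type*) [NormedAddCommGroup F] [NormedSpace ℂ F] (p : ℝ≥0∞) [Fact (1 ≤ p)]
    (t : ℝ) : Lp F p (volume : Measure ℝ) →L[ℂ] Lp F p (volume : Measure ℝ) :=
  (Lp.compMeasurePreservingₗᵢ ℂ (fun r => t + r)
    (measurePreserving_add_left volume t)).toContinuousLinearMap

theorem translateLp_ae {F : Type*} [NormedAddCommGroup F] [NormedSpace ℂ F] (t : ℝ)
    (f : Lp F p (volume : Measure ℝ)) : ∀ᵐ r : ℝ, translateLp F p t f r = f (t + r) :=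
  Lp.coeFn_compMeasurePreserving f (measurePreserving_add_left volume t)

theorem continuous_translateLp {F : Type*} [NormedAddCommGroup F] [NormedSpace ℂ F] (hp : p ≠ ⊤)
    (f : Lp F p (volume : Measure ℝ)) : Continuous fun t => translateLp F p t f := by
  have h : Continuous fun t : ℝ => (⟨fun r => t + r, by fun_prop⟩ : C(ℝ, ℝ)) :=
    ContinuousMap.continuous_of_continuous_uncurry _ (continuous_fst.add continuous_snd)
  exact (continuous_const (y := f)).compMeasurePreservingLp h
    (fun t => measurePreserving_add_left volume t) hp

theorem norm_translateLp_le {F : Type*} [NormedAddCommGroup F] [NormedSpace ℂ F] (t : ℝ)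
    (f : Lp F p (volume : Measure ℝ)) : ‖translateLp F p t f‖ ≤ ‖f‖ :=
  (Lp.norm_compMeasurePreserving f (measurePreserving_add_left volume t)).le

/-- Restriction of functions on the line to `[-1,0]`. -/
abbrev restrictHistory (F : Type*) [NormedAddCommGroup F] [NormedSpace ℂ F] (p : ℝ≥0∞)
    [Fact (1 ≤ p)] : Lp F p (volume : Measure ℝ) →L[ℂ] LpHistory F p :=
  LpToLpRestrictCLM ℝ F ℂ volume p (Icc (-1 : ℝ) 0)

variable {S : C0Semigroup X} (h : MemLp (orbitKernel S) p volume)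

/-- The function on the line given by an initial state `(x, f)`: `f` on `[-1,0]`, the orbit
`S(·)x` on `(0, ∞)` and `0` on `(-∞, -1)`. -/
def lineExtension : DelaySpace X p →L[ℂ] Lp X p (volume : Measure ℝ) :=
  (evalLp volume (h.toLp _)).comp (ContinuousLinearMap.fst ℂ X (LpHistory X p))
    + extendHistory.comp (ContinuousLinearMap.snd ℂ X (LpHistory X p))

theorem lineExtension_ae (u : DelaySpace X p) : ∀ᵐ r : ℝ, -1 ≤ r →
    lineExtension h u r = if 0 < r then S.toFun r.toNNReal u.1 else u.2 r := by
  filter_upwards [evalLp_ae (h.toLp _) u.1, extendHistory_ae u.2, h.coeFn_toLp,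
    Lp.coeFn_add (evalLp volume (h.toLp _) u.1) (extendHistory u.2)] with r h1 h2 h3 h4 hr
  change (evalLp volume (h.toLp _) u.1 + extendHistory u.2) r = _
  rw [h4, Pi.add_apply, h1, h2, h3]
  split_ifs with h0
  · rw [orbitKernel, indicator_of_mem (show r ∈ Ioi (0 : ℝ) from h0),
      indicator_of_notMem (fun h => not_lt.2 h.2 h0), add_zero]
  · rw [orbitKernel, indicator_of_notMem (show r ∉ Ioi (0 : ℝ) from h0),
      indicator_of_mem (show r ∈ Icc (-1 : ℝ) 0 from ⟨hr, not_lt.1 h0⟩)]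
    simp

/-- The history segment `S_t x + T₀(t) f` at time `t`. -/
def pastSegment (t : ℝ) : DelaySpace X p →L[ℂ] LpHistory X p :=
  (restrictHistory X p).comp ((translateLp X p t).comp (lineExtension h))

theorem pastSegment_ae' (t : ℝ) (u : DelaySpace X p) :
    ∀ᵐ τ : ℝ ∂delayMeasure, pastSegment h t u τ = lineExtension h u (t + τ) := by
  filter_upwards [LpToLpRestrictCLM_coeFn ℂ (Icc (-1 : ℝ) 0)
      (translateLp X p t (lineExtension h u)),
    ae_restrict_of_ae (translateLp_ae t (lineExtension h u))] with τ h1 h2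
  exact h1.trans h2

theorem ae_shift {P : ℝ → Prop} (hP : ∀ᵐ r : ℝ, P r) (t : ℝ) : ∀ᵐ τ : ℝ, P (t + τ) :=
  (measurePreserving_add_left volume t).quasiMeasurePreserving.ae hP

theorem pastSegment_ae {t : ℝ} (ht : 0 ≤ t) (u : DelaySpace X p) :
    ∀ᵐ τ : ℝ ∂delayMeasure, pastSegment h t u τ =
      if 0 < t + τ then S.toFun (t + τ).toNNReal u.1 else u.2 (t + τ) := by
  filter_upwards [pastSegment_ae' h t u, ae_restrict_of_ae (ae_shift (lineExtension_ae h u) t),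
    ae_restrict_mem (μ := volume) measurableSet_Icc] with τ h1 h2 hτ
  rw [h1, h2 (by linarith [hτ.1])]

theorem continuous_pastSegment (hp : p ≠ ⊤) (u : DelaySpace X p) :
    Continuous fun t => pastSegment h t u :=
  (restrictHistory X p).continuous.comp (continuous_translateLp hp (lineExtension h u))

theorem norm_pastSegment_le (t : ℝ) : ‖pastSegment h t‖ ≤ ‖lineExtension h‖ := by
  refine ContinuousLinearMap.opNorm_le_bound _ (norm_nonneg _) fun u => ?_
  calc ‖pastSegment h t u‖ ≤ ‖translateLp X p t (lineExtension h u)‖ :=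
        norm_Lp_toLp_restrict_le _ _
    _ ≤ ‖lineExtension h u‖ := norm_translateLp_le _ _
    _ ≤ _ := ContinuousLinearMap.le_opNorm _ _

theorem pastSegment_zero (u : DelaySpace X p) : pastSegment h 0 u = u.2 := by
  refine Lp.ext ?_
  filter_upwards [pastSegment_ae h le_rfl u, ae_restrict_mem (μ := volume) measurableSet_Icc]
    with τ h1 hτ
  rw [h1, zero_add, if_neg (not_lt.2 hτ.2)]

/-- The state at time `t` of the undelayed problem. -/
def undelayedState (t : ℝ≥0) : DelaySpace X p →L[ℂ] DelaySpace X p :=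
  ((S.toFun t).comp (ContinuousLinearMap.fst ℂ X (LpHistory X p))).prod (pastSegment h t)

theorem undelayedState_apply (t : ℝ≥0) (u : DelaySpace X p) :
    undelayedState h t u = (S.toFun t u.1, pastSegment h t u) := rfl

theorem pastSegment_undelayedState (t s : ℝ≥0) (u : DelaySpace X p) :
    pastSegment h t (undelayedState h s u) = pastSegment h (s + t) u := by
  refine Lp.ext ?_
  have h0 := (ae_restrict_iff' measurableSet_Icc).1 (pastSegment_ae h s.coe_nonneg u)
  have hst : (0 : ℝ) ≤ s + t := add_nonneg s.coe_nonneg t.coe_nonneg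
  filter_upwards [pastSegment_ae h t.coe_nonneg (undelayedState h s u), pastSegment_ae h hst u,
    ae_restrict_of_ae (ae_shift h0 t), ae_restrict_mem (μ := volume) measurableSet_Icc]
    with τ h1 h2 h3 hτ
  rw [h1, h2, add_assoc]
  by_cases hp0 : 0 < (t : ℝ) + τ
  · rw [if_pos hp0, if_pos (by linarith [s.coe_nonneg]), S.map_add_real s.coe_nonneg hp0.le,
      Real.toNNReal_coe]
    change (S.toFun _).comp (S.toFun s) u.1 = (S.toFun s).comp (S.toFun _) u.1
    rw [← S.map_add, ← S.map_add, add_comm]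
  · rw [if_neg hp0]
    exact h3 ⟨by linarith [hτ.1, t.coe_nonneg], not_lt.1 hp0⟩

/-- The semigroup `T₀(t)(x, f) = (S(t) x, S_t x + T₀(t) f)` of the undelayed problem. -/
def undelayedSemigroup (hp : p ≠ ⊤) : C0Semigroup (DelaySpace X p) where
  toFun := undelayedState h
  map_zero := by
    refine ContinuousLinearMap.ext fun u => ?_
    rw [undelayedState_apply, S.map_zero, NNReal.coe_zero, pastSegment_zero]
    rfl
  map_add s t := by
    refine ContinuousLinearMap.ext fun u => ?_
    rw [ContinuousLinearMap.comp_apply, undelayedState_apply, undelayedState_apply h s,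
      pastSegment_undelayedState, S.map_add, add_comm s t]
    push_cast
    rfl
  continuous_orbit u :=
    (S.continuous_orbit u.1).prodMk ((continuous_pastSegment h hp u).comp NNReal.continuous_coe)

end Undelayed

/-! ### Norm continuity of the undelayed semigroup -/

section NormContinuity

variable {X : Type*} [NormedAddCommGroup X] [NormedSpace ℂ X]
  {p : ℝ≥0∞} [Fact (1 ≤ p)] {S : C0Semigroup X} (h : MemLp (orbitKernel S) p volume)

/-- History segments of operator valued orbits. -/
def kernelSegment (t : ℝ) : LpHistory (X →L[ℂ] X) p :=
  restrictHistory (X →L[ℂ] X) p (translateLp (X →L[ℂ] X) p t (h.toLp _))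

theorem continuous_kernelSegment (hp : p ≠ ⊤) : Continuous (kernelSegment h) :=
  (restrictHistory (X →L[ℂ] X) p).continuous.comp (continuous_translateLp hp _)

theorem kernelSegment_ae (t : ℝ) :
    ∀ᵐ τ : ℝ ∂delayMeasure, kernelSegment h t τ = orbitKernel S (t + τ) := by
  filter_upwards [LpToLpRestrictCLM_coeFn ℂ (Icc (-1 : ℝ) 0)
      (translateLp (X →L[ℂ] X) p t (h.toLp _)),
    ae_restrict_of_ae (translateLp_ae t (h.toLp (orbitKernel S))),
    ae_restrict_of_ae (ae_shift h.coeFn_toLp t)] with τ h1 h2 h3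
  exact h1.trans (h2.trans h3)

theorem pastSegment_inl {t : ℝ} (ht : 0 ≤ t) (x : X) :
    pastSegment h t (x, 0) = evalLp _ (kernelSegment h t) x := by
  have h0 := (ae_restrict_iff' measurableSet_Icc).1 (Lp.coeFn_zero X p delayMeasure)
  refine Lp.ext ?_
  filter_upwards [pastSegment_ae h ht ((x, 0) : DelaySpace X p), kernelSegment_ae h t,
    evalLp_ae (kernelSegment h t) x, ae_restrict_of_ae (ae_shift h0 t),
    ae_restrict_mem (μ := volume) measurableSet_Icc] with τ h1 h2 h3 h4 hτ
  rw [h1, h3, h2, orbitKernel]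
  split_ifs with h5
  · rw [indicator_of_mem (show t + τ ∈ Ioi (0 : ℝ) from h5)]
  · rw [indicator_of_notMem (show t + τ ∉ Ioi (0 : ℝ) from h5)]
    exact h4 ⟨by linarith [hτ.1], not_lt.1 h5⟩

/-- On states with zero history, norm continuity sets in at once: the history segments of the
orbits are translates of `orbitKernel`, as operators from `X` to `L^p`. -/
theorem continuousOn_undelayedState_inl (hc : S.ImmediatelyNormContinuous) (hp : p ≠ ⊤) :
    ContinuousOn (fun t : ℝ≥0 =>
      (undelayedState h t).comp (ContinuousLinearMap.inl ℂ X (LpHistory X p))) (Ioi 0) := by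
  have e : ∀ t : ℝ≥0, (undelayedState h t).comp (ContinuousLinearMap.inl ℂ X (LpHistory X p))
      = (ContinuousLinearMap.inl ℂ X (LpHistory X p)).comp (S.toFun t)
        + (ContinuousLinearMap.inr ℂ X (LpHistory X p)).comp (evalLp _ (kernelSegment h t)) := by
    intro t
    ext1 x
    refine Prod.ext ?_ ?_
    · change S.toFun t x = S.toFun t x + 0
      rw [add_zero]
    · change pastSegment h t (x, 0) = 0 + evalLp _ (kernelSegment h t) x
      rw [zero_add, pastSegment_inl h t.coe_nonneg]
  simp only [e]
  have h2 : Continuous fun t : ℝ≥0 => evalLp (X := X) (p := p) _ (kernelSegment h t) :=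
    (evalLp _).continuous.comp ((continuous_kernelSegment h hp).comp NNReal.continuous_coe)
  exact (continuousOn_const.clm_comp hc).add
    (continuousOn_const.clm_comp h2.continuousOn)

theorem pastSegment_eq_inl {t : ℝ} (ht : 1 ≤ t) (u : DelaySpace X p) :
    pastSegment h t u = pastSegment h t (u.1, 0) := by
  have ht0 : 0 ≤ t := by linarith
  have hne : ∀ᵐ τ : ℝ ∂delayMeasure, τ ∈ Ioc (-1 : ℝ) 0 := by
    change ∀ᵐ t ∂(volume.restrict (Icc (-1 : ℝ) 0)), t ∈ Ioc (-1 : ℝ) 0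
    rw [← restrict_Ioc_eq_restrict_Icc]
    exact ae_restrict_mem measurableSet_Ioc
  refine Lp.ext ?_
  filter_upwards [pastSegment_ae h ht0 u, pastSegment_ae h ht0 ((u.1, 0) : DelaySpace X p), hne]
    with τ h1 h2 hτ
  have : 0 < t + τ := by linarith [hτ.1]
  rw [h1, h2, if_pos this, if_pos this]

/-- After time `1` the initial history is forgotten, and norm continuity is that of the orbits. -/
theorem continuousOn_undelayedState (hc : S.ImmediatelyNormContinuous) (hp : p ≠ ⊤) :
    ContinuousOn (undelayedState h) (Ioi 1) := by
  have h1 : ContinuousOn (fun t : ℝ≥0 =>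
      ((undelayedState h t).comp (ContinuousLinearMap.inl ℂ X (LpHistory X p))).comp
        (ContinuousLinearMap.fst ℂ X (LpHistory X p))) (Ioi 1) :=
    ((continuousOn_undelayedState_inl h hc hp).mono
      (Ioi_subset_Ioi zero_le_one)).clm_comp continuousOn_const
  refine h1.congr fun t ht => ContinuousLinearMap.ext fun u => ?_
  have ht' : (1 : ℝ) ≤ t := by exact_mod_cast (le_of_lt ht)
  change (S.toFun t u.1, pastSegment h t u) = (S.toFun t u.1, pastSegment h t (u.1, 0))
  rw [pastSegment_eq_inl h ht']

end NormContinuity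

/-! ### The domain of the delay operator and the undelayed semigroup -/

section Domain

variable {X : Type*} [NormedAddCommGroup X] [NormedSpace ℂ X] [CompleteSpace X]
  {p : ℝ≥0∞} [Fact (1 ≤ p)]

theorem C0Semigroup.map_mem_generatorGraph (S : C0Semigroup X) {x y : X}
    (h : (x, y) ∈ S.generatorGraph) (t : ℝ≥0) :
    (S.toFun t x, S.toFun t y) ∈ S.generatorGraph := by
  rw [C0Semigroup.mem_generatorGraph_iff] at h ⊢
  have h1 := (S.toFun t).restrictScalars ℝ |>.hasFDerivAt.comp_hasDerivWithinAt (0 : ℝ) h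
  refine h1.congr_of_mem (fun r hr => ?_) (by simp)
  change (S.toFun r.toNNReal).comp (S.toFun t) x = (S.toFun t).comp (S.toFun r.toNNReal) x
  rw [← S.map_add, ← S.map_add, add_comm]

variable (S : C0Semigroup X) (p) in
/-- The pairs `(x, f) ∈ D(A) × W^{1,p}` with `f(0) = x`. -/
def delayDomain : Submodule ℂ (S.generator.domain × W1p X p) where
  carrier := {q | HasValueAtZero (W1p.fn q.2) (q.1 : X)}
  add_mem' hq hr := HasValueAtZero.add hq hr
  zero_mem' := HasValueAtZero.zero
  smul_mem' c _ hq := HasValueAtZero.smul c hq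

variable {S : C0Semigroup X}

/-- An element of the domain as an element of the state space. -/
def delayDomain.state : delayDomain p S →ₗ[ℂ] DelaySpace X p where
  toFun q := ((q.1.1 : X), W1p.fn q.1.2)
  map_add' _ _ := rfl
  map_smul' _ _ := rfl

/-- The image `(A x, f')` of an element of the domain under the undelayed operator. -/
def delayDomain.stateDeriv : delayDomain p S →ₗ[ℂ] DelaySpace X p where
  toFun q := (S.generator q.1.1, W1p.deriv q.1.2)
  map_add' q r := Prod.ext (S.generator.map_add q.1.1 r.1.1) rfl
  map_smul' c q := Prod.ext (S.generator.map_smul c q.1.1) rfl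

open delayDomain

theorem eq_zero_of_forall_integral_eq_zero (g : LpHistory X p)
    (hg : ∀ a ∈ Icc (-1 : ℝ) 0, ∫ r in (0 : ℝ)..a, g r = 0) : g = 0 := by
  refine W1p.deriv_eq_zero ⟨(0, g), 0, ?_⟩ rfl
  filter_upwards [Lp.coeFn_zero X p delayMeasure,
    ae_restrict_mem (μ := volume) measurableSet_Icc] with t h1 ht
  rw [h1, hg t ht, add_zero]; rfl

/-- The functional `g ↦ ∫₀ᵃ g` on `L^p([-1,0], X)`, for `a ∈ [-1,0]`. -/
def integralHistory {a : ℝ} (ha : a ∈ Icc (-1 : ℝ) 0) : LpHistory X p →L[ℂ] X :=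
  LinearMap.mkContinuous
    { toFun := fun g => ∫ r in (0 : ℝ)..a, g r
      map_add' := fun f g => by
        rw [intervalIntegral_congr_history (Lp.coeFn_add f g) ha]
        exact intervalIntegral.integral_add (intervalIntegrable_history f ha)
          (intervalIntegrable_history g ha)
      map_smul' := fun c g => by
        rw [intervalIntegral_congr_history (Lp.coeFn_smul c g) ha, RingHom.id_apply]
        exact intervalIntegral.integral_smul c _ } 1 fun g => by
    rw [one_mul]
    exact (norm_intervalIntegral_history_le (integrable_history g) ha).trans
      (integral_norm_history_le g)

theorem integralHistory_apply {a : ℝ} (ha : a ∈ Icc (-1 : ℝ) 0) (g : LpHistory X p) :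
    integralHistory ha g = ∫ r in (0 : ℝ)..a, g r := rfl

variable (h : MemLp (orbitKernel S) p volume)

theorem intervalIntegrable_lineExtension (u : DelaySpace X p) (a b : ℝ) :
    IntervalIntegrable (lineExtension h u) volume a b :=
  (((Lp.memLp (lineExtension h u)).locallyIntegrable Fact.out).integrableOn_isCompact
    isCompact_uIcc).intervalIntegrable

/-- Time integrals of history segments, computed pointwise. -/
theorem integral_pastSegment_ae (hp : p ≠ ⊤) (u : DelaySpace X p) (t : ℝ) :
    ∀ᵐ τ : ℝ ∂delayMeasure, (∫ s in (0 : ℝ)..t, pastSegment h s u) τ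
      = ∫ r in τ..(t + τ), lineExtension h u r := by
  set E := lineExtension h u with hE
  have hi := intervalIntegrable_lineExtension h u
  set P : ℝ → X := fun r => ∫ s in (0 : ℝ)..r, E s with hP
  have hPc : Continuous P := intervalIntegral.continuous_primitive hi 0
  have hPi : ∀ a b, IntervalIntegrable P volume a b := fun a b => hPc.intervalIntegrable a b
  have hPsub : ∀ a b, ∫ r in a..b, E r = P b - P a := fun a b =>
    (intervalIntegral.integral_interval_sub_left (hi _ _) (hi _ _)).symm
  set G : ℝ → X := fun τ => P (t + τ) - P τ with hG
  have hGc : Continuous G := (hPc.comp (continuous_const.add continuous_id)).sub hPc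
  obtain ⟨C, hC⟩ := (isCompact_Icc (a := (-1 : ℝ)) (b := 0)).exists_bound_of_continuousOn
    hGc.continuousOn
  have hmem : MemLp G p delayMeasure := by
    refine MemLp.of_bound hGc.aestronglyMeasurable C ?_
    filter_upwards [ae_restrict_mem (μ := volume) measurableSet_Icc] with τ hτ using hC τ hτ
  have key : ∫ s in (0 : ℝ)..t, pastSegment h s u = hmem.toLp G := by
    rw [← sub_eq_zero]
    refine eq_zero_of_forall_integral_eq_zero _ fun a ha => ?_
    rw [← integralHistory_apply ha, map_sub, integralHistory_apply ha (hmem.toLp G),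
      intervalIntegral_congr_history hmem.coeFn_toLp ha,
      ← ContinuousLinearMap.intervalIntegral_comp_comm _
        ((continuous_pastSegment h hp u).intervalIntegrable _ _)]
    have h1 : ∀ s, integralHistory ha (pastSegment h s u) = P (s + a) - P s := fun s => by
      rw [integralHistory_apply, intervalIntegral_congr_history (pastSegment_ae' h s u) ha,
        intervalIntegral.integral_comp_add_left (fun r => E r), hPsub, add_zero]
    simp only [h1, hG]
    have i1 : Continuous fun s => P (s + a) := hPc.comp (continuous_id.add continuous_const)
    have i2 : Continuous fun r => P (t + r) := hPc.comp (continuous_const.add continuous_id)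
    rw [intervalIntegral.integral_sub (i1.intervalIntegrable _ _) (hPi _ _),
      intervalIntegral.integral_sub (i2.intervalIntegrable _ _) (hPi _ _),
      intervalIntegral.integral_comp_add_right P, intervalIntegral.integral_comp_add_left P,
      ← intervalIntegral.integral_interval_sub_left (hPi 0 _) (hPi 0 _),
      ← intervalIntegral.integral_interval_sub_left (hPi 0 (t + a)) (hPi 0 (t + 0))]
    simp only [add_zero, zero_add]
    abel
  rw [key]
  filter_upwards [hmem.coeFn_toLp] with τ h1
  rw [h1, hPsub]

/-- For an initial state in the domain, the extension to the line is a primitive of the extension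
of the derivative. -/
theorem lineExtension_state_ae (q : delayDomain p S) : ∀ᵐ r : ℝ, -1 ≤ r →
    lineExtension h (state q) r
      = (q.1.1 : X) + ∫ s in (0 : ℝ)..r, lineExtension h (stateDeriv q) s := by
  have hw := (ae_restrict_iff' measurableSet_Icc).1 ((W1p.hasValueAtZero_iff q.1.2 _).1 q.2)
  filter_upwards [lineExtension_ae h (state q), hw] with r h1 h2 hr
  rw [h1 hr]
  split_ifs with h0
  · change S.toFun r.toNNReal (q.1.1 : X) = _
    rw [S.integral_orbit q.1.1 h0.le]
    congr 1
    refine intervalIntegral.integral_congr_ae ?_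
    filter_upwards [lineExtension_ae h (stateDeriv q)] with s h3 hs
    rw [uIoc_of_le h0.le] at hs
    rw [h3 (by linarith [hs.1]), if_pos hs.1]
    rfl
  · have hr' : r ∈ Icc (-1 : ℝ) 0 := ⟨hr, not_lt.1 h0⟩
    change W1p.fn q.1.2 r = _
    rw [h2 hr']
    congr 1
    refine intervalIntegral_congr_history ?_ hr'
    filter_upwards [ae_restrict_of_ae (lineExtension_ae h (stateDeriv q)),
      ae_restrict_mem (μ := volume) measurableSet_Icc] with s h3 hs
    rw [h3 hs.1, if_neg (not_lt.2 hs.2)]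
    rfl

theorem orbit_eq_lineExtension (q : delayDomain p S) {t : ℝ} (ht : 0 ≤ t) :
    S.toFun t.toNNReal (q.1.1 : X)
      = (q.1.1 : X) + ∫ s in (0 : ℝ)..t, lineExtension h (stateDeriv q) s := by
  rw [S.integral_orbit q.1.1 ht]
  congr 1
  refine intervalIntegral.integral_congr_ae ?_
  filter_upwards [lineExtension_ae h (stateDeriv q)] with s h3 hs
  rw [uIoc_of_le ht] at hs
  rw [h3 (by linarith [hs.1]), if_pos hs.1]
  rfl

theorem pastSegment_state_ae (q : delayDomain p S) (t : ℝ≥0) :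
    ∀ᵐ τ : ℝ ∂delayMeasure, pastSegment h t (state q) τ
      = S.toFun t (q.1.1 : X) + ∫ r in (0 : ℝ)..τ, pastSegment h t (stateDeriv q) r := by
  have hi := intervalIntegrable_lineExtension h (stateDeriv q)
  filter_upwards [pastSegment_ae' h t (state q),
    ae_restrict_of_ae (ae_shift (lineExtension_state_ae h q) t),
    ae_restrict_mem (μ := volume) measurableSet_Icc] with τ h1 h2 hτ
  rw [h1, h2 (by linarith [hτ.1, t.coe_nonneg]),
    intervalIntegral_congr_history (pastSegment_ae' h t (stateDeriv q)) hτ,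
    intervalIntegral.integral_comp_add_left (fun r => lineExtension h (stateDeriv q) r), add_zero]
  have h3 := orbit_eq_lineExtension h q t.coe_nonneg
  rw [Real.toNNReal_coe] at h3
  rw [h3, add_assoc, intervalIntegral.integral_add_adjacent_intervals (hi _ _) (hi _ _)]

/-- The undelayed semigroup on the domain. -/
def shiftDomain (t : ℝ≥0) (q : delayDomain p S) : delayDomain p S :=
  ⟨(⟨S.toFun t q.1.1, (S.exists_of_mem_generatorGraph
      (S.map_mem_generatorGraph (S.generator_mem q.1.1) t)).1⟩,
    ⟨(pastSegment h t (state q), pastSegment h t (stateDeriv q)), _, pastSegment_state_ae h q t⟩),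
    (W1p.hasValueAtZero_iff _ _).2 (pastSegment_state_ae h q t)⟩

theorem state_shiftDomain (t : ℝ≥0) (q : delayDomain p S) :
    state (shiftDomain h t q) = undelayedState h t (state q) := rfl

/-- The history segment as a linear operator from the domain to `W^{1,p}`. -/
def segmentW1p (t : ℝ≥0) : delayDomain p S →ₗ[ℂ] W1p X p where
  toFun q := (shiftDomain h t q).1.2
  map_add' q r := Subtype.ext (Prod.ext (by
    change pastSegment h t (state (q + r)) = pastSegment h t (state q) + pastSegment h t (state r)
    rw [_root_.map_add, _root_.map_add]) (by
    change pastSegment h t (stateDeriv (q + r))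
      = pastSegment h t (stateDeriv q) + pastSegment h t (stateDeriv r)
    rw [_root_.map_add, _root_.map_add]))
  map_smul' c q := Subtype.ext (Prod.ext (by
    change pastSegment h t (state (c • q)) = c • pastSegment h t (state q)
    rw [map_smul, map_smul]) (by
    change pastSegment h t (stateDeriv (c • q)) = c • pastSegment h t (stateDeriv q)
    rw [map_smul, map_smul]))

theorem segmentW1p_eq_historySegment (t : ℝ≥0) (q : delayDomain p S) :
    segmentW1p h t q = historySegment S q.1.1 q.1.2 q.2 t := by
  refine W1p.ext_fn (Lp.ext ?_)
  filter_upwards [historySegment_spec S q.1.1 q.1.2 q.2 t, pastSegment_ae h t.coe_nonneg (state q)]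
    with τ h1 h2
  rw [h1]
  refine h2.trans ?_
  have : 0 < (t : ℝ) + τ ↔ -(t : ℝ) < τ := by constructor <;> intro <;> linarith
  simp only [this]
  rfl

theorem segmentW1p_shiftDomain (s t : ℝ≥0) (q : delayDomain p S) :
    segmentW1p h s (shiftDomain h t q) = segmentW1p h (t + s) q := by
  refine W1p.ext_fn ?_
  have := pastSegment_undelayedState h s t (state q)
  rw [← NNReal.coe_add] at this
  exact this

theorem continuous_segmentW1p (hp : p ≠ ⊤) (q : delayDomain p S) :
    Continuous fun t : ℝ≥0 => segmentW1p h t q :=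
  Continuous.subtype_mk (((continuous_pastSegment h hp _).comp NNReal.continuous_coe).prodMk
    ((continuous_pastSegment h hp _).comp NNReal.continuous_coe)) _

theorem segmentW1p_zero (q : delayDomain p S) : segmentW1p h 0 q = q.1.2 :=
  W1p.ext_fn (pastSegment_zero h (state q))

theorem fst_intervalIntegral {f : ℝ → DelaySpace X p} {a b : ℝ}
    (hf : IntervalIntegrable f volume a b) : (∫ s in a..b, f s).1 = ∫ s in a..b, (f s).1 :=
  ((ContinuousLinearMap.fst ℂ X (LpHistory X p)).intervalIntegral_comp_comm hf).symm

theorem snd_intervalIntegral {f : ℝ → DelaySpace X p} {a b : ℝ}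
    (hf : IntervalIntegrable f volume a b) : (∫ s in a..b, f s).2 = ∫ s in a..b, (f s).2 :=
  ((ContinuousLinearMap.snd ℂ X (LpHistory X p)).intervalIntegral_comp_comm hf).symm

/-- The undelayed operator is contained in the generator of the undelayed semigroup. -/
theorem state_mem_generatorGraph (hp : p ≠ ⊤) (q : delayDomain p S) :
    (state q, stateDeriv q) ∈ (undelayedSemigroup h hp).generatorGraph := by
  rw [C0Semigroup.mem_generatorGraph_iff]
  have hc := (undelayedSemigroup h hp).continuous_toNNReal (stateDeriv q)
  have h1 := ((hc.integral_hasStrictDerivAt 0 0).hasDerivAt.const_add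
    (state q)).hasDerivWithinAt (s := Ici 0)
  rw [Real.toNNReal_zero, (undelayedSemigroup h hp).map_zero, ContinuousLinearMap.id_apply] at h1
  refine h1.congr_of_mem (fun t ht => ?_) (by simp)
  have ht : (0 : ℝ) ≤ t := ht
  have hint := hc.intervalIntegrable (μ := volume) 0 t
  refine Prod.ext ?_ ?_
  · change S.toFun t.toNNReal (q.1.1 : X) = (q.1.1 : X) + Prod.fst (∫ s in (0 : ℝ)..t, _)
    rw [S.integral_orbit q.1.1 ht, fst_intervalIntegral hint]
    rfl
  · change pastSegment h t.toNNReal (state q) = W1p.fn q.1.2 + Prod.snd (∫ s in (0 : ℝ)..t, _)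
    rw [snd_intervalIntegral hint]
    have e : ∫ s in (0 : ℝ)..t,
        ((undelayedSemigroup h hp).toFun s.toNNReal (stateDeriv q)).2
        = ∫ s in (0 : ℝ)..t, pastSegment h s (stateDeriv q) := by
      refine intervalIntegral.integral_congr fun s hs => ?_
      rw [uIcc_of_le ht] at hs
      change pastSegment h s.toNNReal (stateDeriv q) = _
      rw [Real.coe_toNNReal s hs.1]
    rw [e, Real.coe_toNNReal t ht, ← sub_eq_iff_eq_add']
    have hi := intervalIntegrable_lineExtension h (stateDeriv q)
    refine Lp.ext ?_
    filter_upwards [integral_pastSegment_ae h hp (stateDeriv q) t,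
      Lp.coeFn_sub (pastSegment h t (state q)) (W1p.fn q.1.2), pastSegment_ae' h t (state q),
      ae_restrict_of_ae (ae_shift (lineExtension_state_ae h q) t),
      ae_restrict_of_ae (lineExtension_state_ae h q),
      ae_restrict_of_ae (lineExtension_ae h (state q)),
      ae_restrict_mem (μ := volume) measurableSet_Icc] with τ e1 e2 e3 e4 e5 e6 hτ
    have e7 : W1p.fn q.1.2 τ = lineExtension h (state q) τ := by
      rw [e6 hτ.1, if_neg (not_lt.2 hτ.2)]; rfl
    rw [e1, e2, Pi.sub_apply, e3, e7, e4 (by linarith [hτ.1]), e5 hτ.1, add_sub_add_left_eq_sub,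
      intervalIntegral.integral_interval_sub_left (hi _ _) (hi _ _)]

/-- Time integrals of undelayed orbits lie in the domain. -/
theorem integral_undelayed_mem_range (hp : p ≠ ⊤) (u : DelaySpace X p) {t : ℝ} (ht : 0 ≤ t) :
    ∫ s in (0 : ℝ)..t, (undelayedSemigroup h hp).toFun s.toNNReal u
      ∈ LinearMap.range (state (p := p) (S := S)) := by
  have hc := (undelayedSemigroup h hp).continuous_toNNReal u
  have hint := hc.intervalIntegrable (μ := volume) 0 t
  obtain ⟨hx, -⟩ := S.exists_of_mem_generatorGraph (S.integral_mem_generatorGraph u.1 ht)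
  have hi := intervalIntegrable_lineExtension h u
  have hP0 : ∫ s in (0 : ℝ)..t, S.toFun s.toNNReal u.1
      = ∫ s in (0 : ℝ)..t, lineExtension h u s := by
    refine intervalIntegral.integral_congr_ae ?_
    filter_upwards [lineExtension_ae h u] with s h3 hs
    rw [uIoc_of_le ht] at hs
    rw [h3 (by linarith [hs.1]), if_pos hs.1]
  have hae : ∀ᵐ τ : ℝ ∂delayMeasure, (∫ s in (0 : ℝ)..t, pastSegment h s u) τ
      = (∫ s in (0 : ℝ)..t, S.toFun s.toNNReal u.1)
        + ∫ r in (0 : ℝ)..τ, (pastSegment h t u - pastSegment h 0 u) r := by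
    filter_upwards [integral_pastSegment_ae h hp u t,
      ae_restrict_mem (μ := volume) measurableSet_Icc] with τ h1 hτ
    have h2 : ∫ r in (0 : ℝ)..τ, (pastSegment h t u - pastSegment h 0 u) r
        = ∫ r in (0 : ℝ)..τ, (lineExtension h u (t + r) - lineExtension h u (0 + r)) := by
      refine intervalIntegral_congr_history ?_ hτ
      filter_upwards [Lp.coeFn_sub (pastSegment h t u) (pastSegment h 0 u),
        pastSegment_ae' h t u, pastSegment_ae' h 0 u] with r e1 e2 e3
      rw [e1, Pi.sub_apply, e2, e3]
    rw [h1, h2, hP0, intervalIntegral.integral_sub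
      (by simpa using (hi (t + 0) (t + τ)).comp_add_left t) (by simpa using hi 0 τ),
      intervalIntegral.integral_comp_add_left (fun r => lineExtension h u r),
      intervalIntegral.integral_comp_add_left (fun r => lineExtension h u r), add_zero, zero_add,
      zero_add, ← intervalIntegral.integral_interval_sub_left (hi 0 _) (hi 0 _),
      ← intervalIntegral.integral_interval_sub_left (hi 0 (t + τ)) (hi 0 t)]
    abel
  refine ⟨⟨(⟨_, hx⟩, ⟨(∫ s in (0 : ℝ)..t, pastSegment h s u, pastSegment h t u - pastSegment h 0 u),
    _, hae⟩), (W1p.hasValueAtZero_iff _ _).2 hae⟩, ?_⟩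
  refine Prod.ext ?_ ?_
  · change ∫ s in (0 : ℝ)..t, S.toFun s.toNNReal u.1 = Prod.fst (∫ s in (0 : ℝ)..t, _)
    rw [fst_intervalIntegral hint]
    rfl
  · change ∫ s in (0 : ℝ)..t, pastSegment h s u = Prod.snd (∫ s in (0 : ℝ)..t, _)
    rw [snd_intervalIntegral hint]
    refine intervalIntegral.integral_congr fun s hs => ?_
    rw [uIcc_of_le ht] at hs
    change _ = pastSegment h s.toNNReal u
    rw [Real.coe_toNNReal s hs.1]

/-- Every state is the limit of the means of its undelayed orbit over `[0, t]` as `t ↓ 0`, and these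
lie in the domain. -/
theorem denseRange_state (h : MemLp (orbitKernel S) p volume) (hp : p ≠ ⊤) :
    DenseRange (state (p := p) (S := S)) := by
  intro u
  have hc := (undelayedSemigroup h hp).continuous_toNNReal u
  have h1 := (hc.integral_hasStrictDerivAt 0 0).hasDerivAt.hasDerivWithinAt (s := Ici 0)
  rw [← hasDerivWithinAt_Ioi_iff_Ici, hasDerivWithinAt_iff_tendsto_slope' (by simp),
    Real.toNNReal_zero, (undelayedSemigroup h hp).map_zero, ContinuousLinearMap.id_apply] at h1
  refine mem_closure_of_tendsto h1 ?_
  filter_upwards [self_mem_nhdsWithin] with t ht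
  obtain ⟨q, hq⟩ := integral_undelayed_mem_range h hp u (le_of_lt ht)
  refine ⟨((t⁻¹ : ℝ) : ℂ) • q, ?_⟩
  rw [map_smul, hq, slope_def_module, intervalIntegral.integral_same, sub_zero, sub_zero]
  exact Complex.coe_smul _ _

end Domain

/-! ### Volterra convolution operators -/

section Volterra

variable {X : Type*} [NormedAddCommGroup X] [NormedSpace ℂ X]
  {E : Type*} [NormedAddCommGroup E] [NormedSpace ℂ E]

/-- Lebesgue measure on `(0, ∞)`. -/
abbrev halfLine : Measure ℝ := volume.restrict (Ioi (0 : ℝ))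

/-- The value at `t` of the translate of `f` that starts at time `s` and vanishes before. -/
def startedAt (f : ℝ≥0 →ᵇ E) (t s : ℝ) : E := if s < t then f (t - s).toNNReal else 0

theorem norm_startedAt_le (f : ℝ≥0 →ᵇ E) (t s : ℝ) : ‖startedAt f t s‖ ≤ ‖f‖ := by
  unfold startedAt
  split_ifs
  · exact f.norm_coe_le_norm _
  · rw [norm_zero]; exact norm_nonneg f

theorem startedAt_add (f g : ℝ≥0 →ᵇ E) (t s : ℝ) :
    startedAt (f + g) t s = startedAt f t s + startedAt g t s := by
  unfold startedAt
  split_ifs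
  · rfl
  · rw [add_zero]

theorem startedAt_smul (c : ℂ) (f : ℝ≥0 →ᵇ E) (t s : ℝ) :
    startedAt (c • f) t s = c • startedAt f t s := by
  unfold startedAt
  split_ifs
  · rfl
  · rw [smul_zero]

theorem aestronglyMeasurable_startedAt {μ : Measure ℝ} {Y : ℝ → (ℝ≥0 →ᵇ E)}
    (hY : AEStronglyMeasurable Y μ) (t : ℝ) :
    AEStronglyMeasurable (fun s => startedAt (Y s) t s) μ := by
  have h1 : AEStronglyMeasurable (fun s : ℝ => Y s (t - s).toNNReal) μ := by
    have hc : Continuous fun s : ℝ => (t - s).toNNReal := by fun_prop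
    have he : Continuous fun z : (ℝ≥0 →ᵇ E) × ℝ≥0 => z.1 z.2 := by fun_prop
    exact he.comp_aestronglyMeasurable (hY.prodMk hc.aestronglyMeasurable)
  have h2 : (fun s => startedAt (Y s) t s)
      = (Iio t).indicator fun s : ℝ => Y s (t - s).toNNReal := by
    funext s
    by_cases hs : s < t
    · rw [indicator_of_mem (show s ∈ Iio t from hs), startedAt, if_pos hs]
    · rw [indicator_of_notMem (show s ∉ Iio t from hs), startedAt, if_neg hs]
  rw [h2]
  exact h1.indicator measurableSet_Iio

variable (G : X →L[ℂ] (ℝ≥0 →ᵇ E)) (g : Lp X 1 halfLine)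

theorem integrable_startedAt (t : ℝ) : Integrable (fun s => startedAt (G (g s)) t s) halfLine := by
  refine ((L1.integrable_coeFn g).norm.const_mul ‖G‖).mono' (aestronglyMeasurable_startedAt
    (G.continuous.comp_aestronglyMeasurable (Lp.aestronglyMeasurable g)) t)
    (Eventually.of_forall fun s => (norm_startedAt_le _ t s).trans (G.le_opNorm _))

theorem continuous_integral_startedAt :
    Continuous fun t : ℝ≥0 => ∫ s, startedAt (G (g s)) t s ∂halfLine := by
  refine continuous_iff_continuousAt.2 fun t₀ => ?_
  refine continuousAt_of_dominated (bound := fun s => ‖G‖ * ‖g s‖)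
    (Eventually.of_forall fun t => (integrable_startedAt G g t).aestronglyMeasurable)
    (Eventually.of_forall fun t => Eventually.of_forall fun s =>
      (norm_startedAt_le _ t s).trans (G.le_opNorm _))
    ((L1.integrable_coeFn g).norm.const_mul ‖G‖) ?_
  have hne : ∀ᵐ s : ℝ ∂halfLine, s ≠ t₀ := ae_restrict_of_ae (Measure.ae_ne volume (t₀ : ℝ))
  filter_upwards [hne] with s hs
  rcases lt_or_gt_of_ne hs with hlt | hgt
  · have h1 : ContinuousAt (fun t : ℝ≥0 => G (g s) ((t : ℝ) - s).toNNReal) t₀ :=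
      ((G (g s)).continuous.comp (continuous_real_toNNReal.comp
        (NNReal.continuous_coe.sub continuous_const))).continuousAt
    refine h1.congr ?_
    filter_upwards [NNReal.continuous_coe.continuousAt.eventually (lt_mem_nhds hlt)] with t ht
    rw [startedAt, if_pos ht]
  · refine (continuousAt_const (y := (0 : E))).congr ?_
    filter_upwards [NNReal.continuous_coe.continuousAt.eventually (gt_mem_nhds hgt)] with t ht
    rw [startedAt, if_neg (not_lt.2 (le_of_lt ht))]

theorem norm_integral_startedAt_le (t : ℝ) :
    ‖∫ s, startedAt (G (g s)) t s ∂halfLine‖ ≤ ‖G‖ * ‖g‖ := by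
  refine (norm_integral_le_of_norm_le ((L1.integrable_coeFn g).norm.const_mul ‖G‖)
    (Eventually.of_forall fun s => (norm_startedAt_le _ t s).trans (G.le_opNorm _))).trans ?_
  rw [integral_const_mul, L1.norm_eq_integral_norm]

/-- The convolution `t ↦ ∫₀ᵗ G(g(s))(t - s) ds`. -/
def volterraConv : ℝ≥0 →ᵇ E :=
  BoundedContinuousFunction.ofNormedAddCommGroup
    (fun t : ℝ≥0 => ∫ s, startedAt (G (g s)) t s ∂halfLine)
    (continuous_integral_startedAt G g) (‖G‖ * ‖g‖) fun t => norm_integral_startedAt_le G g t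

theorem volterraConv_apply (t : ℝ≥0) :
    volterraConv G g t = ∫ s, startedAt (G (g s)) t s ∂halfLine := rfl

variable (J : X →L[ℂ] E) (B : E →L[ℂ] Lp X 1 halfLine)

/-- The operator `u ↦ ∫₀ᵗ F(J (B u)(s))(t - s) ds` given by an operator valued kernel `F`. -/
def volterraMap (F : E →L[ℂ] (ℝ≥0 →ᵇ E)) : E →L[ℂ] (ℝ≥0 →ᵇ E) :=
  LinearMap.mkContinuous
    { toFun := fun u => volterraConv (F.comp J) (B u)
      map_add' := fun u v => by
        ext t
        rw [BoundedContinuousFunction.add_apply, volterraConv_apply, volterraConv_apply,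
          volterraConv_apply, ← integral_add (integrable_startedAt _ _ _)
            (integrable_startedAt _ _ _)]
        refine integral_congr_ae ?_
        filter_upwards [Lp.coeFn_add (B u) (B v)] with s hs
        rw [map_add, hs, Pi.add_apply, map_add, startedAt_add]
      map_smul' := fun c u => by
        ext t
        rw [RingHom.id_apply, BoundedContinuousFunction.smul_apply, volterraConv_apply,
          volterraConv_apply, ← integral_smul]
        refine integral_congr_ae ?_
        filter_upwards [Lp.coeFn_smul c (B u)] with s hs
        rw [map_smul, hs, Pi.smul_apply, map_smul, startedAt_smul] } (‖J‖ * ‖B‖ * ‖F‖)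
      fun u => by
        change ‖volterraConv (F.comp J) (B u)‖ ≤ _
        refine (BoundedContinuousFunction.norm_ofNormedAddCommGroup_le _ (by positivity)
          _).trans ?_
        calc ‖F.comp J‖ * ‖B u‖ ≤ (‖F‖ * ‖J‖) * (‖B‖ * ‖u‖) := by
              gcongr
              · exact F.opNorm_comp_le J
              · exact B.le_opNorm u
          _ = _ := by ring

theorem norm_volterraMap_le (F : E →L[ℂ] (ℝ≥0 →ᵇ E)) :
    ‖volterraMap J B F‖ ≤ ‖J‖ * ‖B‖ * ‖F‖ :=
  LinearMap.mkContinuous_norm_le _ (by positivity) _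

/-- The Volterra operator `F ↦ (u ↦ ∫₀ᵗ F(J (B u)(s))(t - s) ds)`. -/
def volterraOp : (E →L[ℂ] (ℝ≥0 →ᵇ E)) →L[ℂ] (E →L[ℂ] (ℝ≥0 →ᵇ E)) :=
  LinearMap.mkContinuous
    { toFun := volterraMap J B
      map_add' := fun F G => by
        refine ContinuousLinearMap.ext fun u => ?_
        ext t
        change volterraConv ((F + G).comp J) (B u) t
          = volterraConv (F.comp J) (B u) t + volterraConv (G.comp J) (B u) t
        rw [volterraConv_apply, volterraConv_apply,
          volterraConv_apply, ← integral_add (integrable_startedAt _ _ _)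
            (integrable_startedAt _ _ _)]
        refine integral_congr_ae (Eventually.of_forall fun s => ?_)
        exact startedAt_add _ _ _ _
      map_smul' := fun c F => by
        refine ContinuousLinearMap.ext fun u => ?_
        ext t
        change volterraConv ((c • F).comp J) (B u) t = c • volterraConv (F.comp J) (B u) t
        rw [volterraConv_apply, volterraConv_apply, ← integral_smul]
        refine integral_congr_ae (Eventually.of_forall fun s => ?_)
        exact startedAt_smul _ _ _ _ } (‖J‖ * ‖B‖) fun F => norm_volterraMap_le J B F

theorem norm_volterraOp_le : ‖volterraOp J B‖ ≤ ‖J‖ * ‖B‖ :=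
  LinearMap.mkContinuous_norm_le _ (by positivity) _

theorem volterraOp_apply (F : E →L[ℂ] (ℝ≥0 →ᵇ E)) (u : E) (t : ℝ≥0) :
    volterraOp J B F u t = ∫ s, startedAt (F (J (B u s))) t s ∂halfLine := rfl

/-- Composition with an operator commutes with the Volterra operator. -/
theorem volterraOp_comp [CompleteSpace E] (L : E →L[ℂ] E) (F : E →L[ℂ] (ℝ≥0 →ᵇ E)) :
    volterraOp J B ((L.compLeftContinuousBounded ℝ≥0).comp F)
      = (L.compLeftContinuousBounded ℝ≥0).comp (volterraOp J B F) := by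
  refine ContinuousLinearMap.ext fun u => ?_
  ext t
  change ∫ s, startedAt (L.compLeftContinuousBounded ℝ≥0 (F (J (B u s)))) t s ∂halfLine
    = L (∫ s, startedAt (F (J (B u s))) t s ∂halfLine)
  refine Eq.trans ?_ (L.integral_comp_comm (integrable_startedAt (F.comp J) (B u) t))
  refine integral_congr_ae (Eventually.of_forall fun s => ?_)
  simp only [startedAt]
  split_ifs
  · rfl
  · exact L.map_zero.symm

/-- Fixed points of affine Volterra equations exist and are unique for small kernels. -/
theorem exists_volterra_solution [CompleteSpace E] (hB : ‖J‖ * ‖B‖ < 1)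
    (F₀ : E →L[ℂ] (ℝ≥0 →ᵇ E)) : ∃ F, F = F₀ + volterraOp J B F := by
  have h1 : IsUnit (1 - volterraOp J B) :=
    isUnit_one_sub_of_norm_lt_one (x := volterraOp J B) ((norm_volterraOp_le J B).trans_lt hB)
  obtain ⟨V, hV⟩ := h1
  refine ⟨(↑V⁻¹ : (E →L[ℂ] (ℝ≥0 →ᵇ E)) →L[ℂ] (E →L[ℂ] (ℝ≥0 →ᵇ E))) F₀, ?_⟩
  rw [← sub_eq_iff_eq_add]
  have h2 : (V : (E →L[ℂ] (ℝ≥0 →ᵇ E)) →L[ℂ] (E →L[ℂ] (ℝ≥0 →ᵇ E)))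
      ((↑V⁻¹ : (E →L[ℂ] (ℝ≥0 →ᵇ E)) →L[ℂ] (E →L[ℂ] (ℝ≥0 →ᵇ E))) F₀) = F₀ := by
    rw [← mul_apply_eq_comp, Units.mul_inv, one_apply_eq_self]
  rw [hV] at h2
  exact h2

theorem volterra_solution_unique (hB : ‖J‖ * ‖B‖ < 1) {F₀ F G : E →L[ℂ] (ℝ≥0 →ᵇ E)}
    (hF : F = F₀ + volterraOp J B F) (hG : G = F₀ + volterraOp J B G) : F = G := by
  have h1 : F - G = volterraOp J B (F - G) := by
    conv_lhs => rw [hF, hG]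
    rw [map_sub, add_sub_add_left_eq_sub]
  have h2 : ‖F - G‖ ≤ ‖J‖ * ‖B‖ * ‖F - G‖ := by
    conv_lhs => rw [h1]
    exact ((volterraOp J B).le_opNorm _).trans
      (mul_le_mul_of_nonneg_right (norm_volterraOp_le J B) (norm_nonneg _))
  have h3 : ‖F - G‖ = 0 := by
    by_contra h
    have : 0 < ‖F - G‖ := lt_of_le_of_ne (norm_nonneg _) (Ne.symm h)
    nlinarith
  exact sub_eq_zero.1 (norm_eq_zero.1 h3)

/-- A property that is stable under the fixed point iteration and under limits holds for the
solution. -/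
theorem volterra_solution_induction (hB : ‖J‖ * ‖B‖ < 1) {F₀ F : E →L[ℂ] (ℝ≥0 →ᵇ E)}
    (hF : F = F₀ + volterraOp J B F) {P : Set (E →L[ℂ] (ℝ≥0 →ᵇ E))} (hP : IsClosed P)
    (h0 : F₀ ∈ P) (hs : ∀ G ∈ P, F₀ + volterraOp J B G ∈ P) : F ∈ P := by
  set G : ℕ → (E →L[ℂ] (ℝ≥0 →ᵇ E)) := fun n => (fun G => F₀ + volterraOp J B G)^[n] F₀ with hG
  have hG1 : ∀ n, G (n + 1) = F₀ + volterraOp J B (G n) := fun n =>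
    Function.iterate_succ_apply' _ _ _
  have hmem : ∀ n, G n ∈ P := fun n => by
    induction n with
    | zero => exact h0
    | succ n ih => rw [hG1]; exact hs _ ih
  have hle : ∀ n, ‖G n - F‖ ≤ (‖J‖ * ‖B‖) ^ n * ‖F₀ - F‖ := fun n => by
    induction n with
    | zero => rw [pow_zero, one_mul]; exact le_rfl
    | succ n ih =>
      have e : G (n + 1) - F = volterraOp J B (G n - F) := by
        rw [hG1, map_sub]
        conv_lhs => rw [hF]
        rw [add_sub_add_left_eq_sub]
      rw [e, pow_succ', mul_assoc]
      exact ((volterraOp J B).le_opNorm _).trans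
        (mul_le_mul (norm_volterraOp_le J B) ih (norm_nonneg _) (by positivity))
  have hlim : Tendsto G atTop (𝓝 F) := by
    rw [tendsto_iff_norm_sub_tendsto_zero]
    refine squeeze_zero (fun _ => norm_nonneg _) hle ?_
    simpa using (tendsto_pow_atTop_nhds_zero_of_lt_one (by positivity) hB).mul_const ‖F₀ - F‖
  exact hP.mem_of_tendsto hlim (Eventually.of_forall hmem)

end Volterra

/-! ### The perturbed semigroup -/

section Perturbation

variable {X : Type*} [NormedAddCommGroup X] [NormedSpace ℂ X]
  {E : Type*} [NormedAddCommGroup E] [NormedSpace ℂ E]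
  (J : X →L[ℂ] E) (B : E →L[ℂ] Lp X 1 halfLine)

/-- The left translation of bounded continuous functions on the half line. -/
def translateBCF (t : ℝ≥0) : (ℝ≥0 →ᵇ E) →L[ℂ] (ℝ≥0 →ᵇ E) :=
  LinearMap.mkContinuous
    { toFun := fun f => f.compContinuous ⟨fun r => t + r, by fun_prop⟩
      map_add' := fun _ _ => rfl
      map_smul' := fun _ _ => rfl } 1 fun f => by
    rw [one_mul]
    exact (BoundedContinuousFunction.norm_le (norm_nonneg f)).2 fun r => f.norm_coe_le_norm (t + r)

theorem translateBCF_apply (t r : ℝ≥0) (f : ℝ≥0 →ᵇ E) : translateBCF t f r = f (t + r) := rfl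

theorem integral_Ioi_translate (f : ℝ → E) (r : ℝ) :
    ∫ s in Ioi r, f s = ∫ s in Ioi (0 : ℝ), f (r + s) := by
  rw [← integral_indicator measurableSet_Ioi, ← integral_indicator measurableSet_Ioi,
    ← integral_add_left_eq_self ((Ioi r).indicator f) r]
  refine integral_congr_ae (Eventually.of_forall fun s => ?_)
  by_cases hs : 0 < s
  · simp only [indicator_of_mem (show s ∈ Ioi (0 : ℝ) from hs),
      indicator_of_mem (show r + s ∈ Ioi r from lt_add_of_pos_right r hs)]
  · simp only [indicator_of_notMem (show s ∉ Ioi (0 : ℝ) from hs),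
      indicator_of_notMem (show r + s ∉ Ioi r from fun h => hs (by
        have : r < r + s := h
        linarith))]

/-- The convolution at time `t + r`, split at time `r`. -/
theorem volterraOp_add (F : E →L[ℂ] (ℝ≥0 →ᵇ E)) {u v : E} {r : ℝ≥0}
    (huv : ∀ᵐ s ∂halfLine, B v s = B u (r + s)) (t : ℝ≥0) :
    volterraOp J B F u (t + r)
      = volterraOp J B ((translateBCF t).comp F) u r + volterraOp J B F v t := by
  have hsub : Ioc (0 : ℝ) r ∪ Ioi (r : ℝ) = Ioi 0 := Ioc_union_Ioi_eq_Ioi r.coe_nonneg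
  have hdis : Disjoint (Ioc (0 : ℝ) r) (Ioi (r : ℝ)) := Ioc_disjoint_Ioi le_rfl
  have h1 : Ioc (0 : ℝ) r ⊆ Ioi 0 := fun s hs => hs.1
  have h2 : Ioi (r : ℝ) ⊆ Ioi 0 := Ioi_subset_Ioi r.coe_nonneg
  have hi : Integrable (fun s => startedAt (F (J (B u s))) ((t + r : ℝ≥0) : ℝ) s) halfLine :=
    integrable_startedAt (F.comp J) (B u) _
  have hφ : volterraOp J B F u (t + r)
      = (∫ s in Ioc (0 : ℝ) r, startedAt (F (J (B u s))) ((t + r : ℝ≥0) : ℝ) s)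
        + ∫ s in Ioi (r : ℝ), startedAt (F (J (B u s))) ((t + r : ℝ≥0) : ℝ) s := by
    rw [volterraOp_apply, ← setIntegral_union hdis measurableSet_Ioi (IntegrableOn.mono_set hi h1)
      (IntegrableOn.mono_set hi h2), hsub]
  have hψ : volterraOp J B ((translateBCF t).comp F) u r
      = ∫ s in Ioc (0 : ℝ) r, startedAt (translateBCF t (F (J (B u s)))) (r : ℝ) s := by
    rw [volterraOp_apply]
    refine (setIntegral_eq_of_subset_of_forall_sdiff_eq_zero measurableSet_Ioi h1
      fun s hs => ?_)
    rw [startedAt, if_neg]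
    exact fun h => hs.2 ⟨hs.1, h.le⟩
  rw [hφ, hψ]
  congr 1
  · refine integral_congr_ae ?_
    filter_upwards [ae_restrict_mem measurableSet_Ioc,
      ae_restrict_of_ae (Measure.ae_ne volume (r : ℝ))] with s hs hne
    have hlt : s < r := lt_of_le_of_ne hs.2 hne
    rw [startedAt, startedAt, if_pos hlt, if_pos (by push_cast; linarith [t.coe_nonneg]),
      translateBCF_apply]
    congr 1
    rw [NNReal.coe_add, add_sub_assoc, Real.toNNReal_add t.coe_nonneg (sub_pos.2 hlt).le,
      Real.toNNReal_coe]
  · rw [integral_Ioi_translate, volterraOp_apply]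
    refine integral_congr_ae ?_
    filter_upwards [huv] with s hs
    rw [hs, startedAt, startedAt, NNReal.coe_add]
    have e1 : (r : ℝ) + s < t + r ↔ s < t := by constructor <;> intro h <;> linarith
    have e2 : (t : ℝ) + r - (r + s) = t - s := by ring
    simp only [e1, e2]

/-- The orbits of a bounded semigroup, as an operator with values in the bounded continuous
functions. -/
def C0Semigroup.orbitOp (T₀ : C0Semigroup E) {M : ℝ} (hM : ∀ t, ‖T₀.toFun t‖ ≤ M) :
    E →L[ℂ] (ℝ≥0 →ᵇ E) :=
  LinearMap.mkContinuous
    { toFun := fun u => BoundedContinuousFunction.ofNormedAddCommGroup (fun t => T₀.toFun t u)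
        (T₀.continuous_orbit u) (M * ‖u‖) fun t => (T₀.toFun t).le_of_opNorm_le (hM t) u
      map_add' := fun u v => by ext t; exact (T₀.toFun t).map_add u v
      map_smul' := fun c u => by ext t; exact (T₀.toFun t).map_smul c u } M fun u =>
    BoundedContinuousFunction.norm_ofNormedAddCommGroup_le _
      (mul_nonneg ((norm_nonneg _).trans (hM 0)) (norm_nonneg u))
      fun t => (T₀.toFun t).le_of_opNorm_le (hM t) u

variable {J B} [CompleteSpace E] {T₀ : C0Semigroup E} {M : ℝ} {hM : ∀ t, ‖T₀.toFun t‖ ≤ M}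
  {D : Type*} {state : D → E} {F : E →L[ℂ] (ℝ≥0 →ᵇ E)}

/-- The semigroup law for the solution of the variation of constants equation: for fixed `t`, both
`r ↦ T(t + r)` and `r ↦ T(t) T(r)` solve the Volterra equation with free term `r ↦ T(t) T₀(r)`. -/
theorem volterra_solution_add (hB : ‖J‖ * ‖B‖ < 1) (hF : F = T₀.orbitOp hM + volterraOp J B F)
    (hd : DenseRange state)
    (hs : ∀ q r, ∀ᵐ s ∂halfLine, B (T₀.toFun r (state q)) s = B (state q) ((r : ℝ≥0) + s))
    (t r : ℝ≥0) (u : E) : F u (t + r) = F (F u r) t := by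
  set L : E →L[ℂ] E := (BoundedContinuousFunction.evalCLM ℂ t).comp F with hL
  have hLa : ∀ v, L v = F v t := fun _ => rfl
  have hFa : ∀ v a, F v a = T₀.toFun a v + volterraOp J B F v a := fun v a => by
    conv_lhs => rw [hF]
    rfl
  have h2 : (L.compLeftContinuousBounded ℝ≥0).comp F
      = (L.compLeftContinuousBounded ℝ≥0).comp (T₀.orbitOp hM)
        + volterraOp J B ((L.compLeftContinuousBounded ℝ≥0).comp F) := by
    rw [volterraOp_comp, ← ContinuousLinearMap.comp_add, ← hF]
  have h1 : (translateBCF t).comp F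
      = (L.compLeftContinuousBounded ℝ≥0).comp (T₀.orbitOp hM)
        + volterraOp J B ((translateBCF t).comp F) := by
    refine DFunLike.coe_injective (hd.equalizer (ContinuousLinearMap.continuous _)
      (ContinuousLinearMap.continuous _) (funext fun q => ?_))
    ext a
    change F (state q) (t + a) = F (T₀.toFun a (state q)) t
      + volterraOp J B ((translateBCF t).comp F) (state q) a
    rw [hFa, volterraOp_add J B F (hs q a), hFa (T₀.toFun a (state q)) t, T₀.map_add,
      ContinuousLinearMap.comp_apply]
    abel
  have h3 := volterra_solution_unique J B hB h1 h2
  exact congrArg (fun G : E →L[ℂ] (ℝ≥0 →ᵇ E) => G u r) h3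

/-- The semigroup `T(t) u = F(u)(t)` of the perturbed problem, where `F` solves the variation of
constants equation `F(u)(t) = T₀(t) u + ∫₀ᵗ F(J (B u)(s))(t - s) ds`.  The hypotheses say that `B`
is the extension of a delay term along the orbits of `T₀`, given on the dense range of `state`. -/
def perturbedSemigroup (hB : ‖J‖ * ‖B‖ < 1) (hF : F = T₀.orbitOp hM + volterraOp J B F)
    (hd : DenseRange state)
    (hs : ∀ q r, ∀ᵐ s ∂halfLine, B (T₀.toFun r (state q)) s = B (state q) ((r : ℝ≥0) + s)) :
    C0Semigroup E where
  toFun t := (BoundedContinuousFunction.evalCLM ℂ t).comp F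
  map_zero := by
    refine ContinuousLinearMap.ext fun u => ?_
    change F u 0 = u
    rw [hF]
    change T₀.toFun 0 u + volterraOp J B F u 0 = u
    rw [T₀.map_zero, volterraOp_apply]
    have : ∫ s, startedAt (F (J (B u s))) ((0 : ℝ≥0) : ℝ) s ∂halfLine = 0 := by
      refine integral_eq_zero_of_ae ?_
      filter_upwards [ae_restrict_mem measurableSet_Ioi] with s hs
      rw [startedAt, if_neg (not_lt.2 (le_of_lt hs))]
      rfl
    rw [this, add_zero]
    rfl
  map_add t r := ContinuousLinearMap.ext fun u => volterra_solution_add hB hF hd hs t r u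
  continuous_orbit u := (F u).continuous

/-- Differentiability at `0` of a Volterra convolution with continuous data. -/
theorem hasDerivWithinAt_volterraOp {u : E} {c : ℝ≥0 → X} (hc : Continuous c)
    (hu : ∀ᵐ s ∂halfLine, B u s = c s.toNNReal) (hF0 : ∀ v, F v 0 = v) :
    HasDerivWithinAt (fun r : ℝ => volterraOp J B F u r.toNNReal) (J (c 0)) (Ici 0) 0 := by
  set k : ℝ × ℝ → E := fun z => F (J (c z.1.toNNReal)) z.2.toNNReal with hk
  have hkc : Continuous k := by
    have h1 : Continuous fun z : ℝ × ℝ => F (J (c z.1.toNNReal)) :=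
      F.continuous.comp (J.continuous.comp (hc.comp (continuous_real_toNNReal.comp continuous_fst)))
    have h2 : Continuous fun z : ℝ × ℝ => z.2.toNNReal :=
      continuous_real_toNNReal.comp continuous_snd
    exact h1.eval h2
  have hk0 : k (0, 0) = J (c 0) := by
    rw [hk]
    simp only [Real.toNNReal_zero]
    exact hF0 _
  have hw : ∀ r : ℝ, 0 ≤ r → volterraOp J B F u r.toNNReal = ∫ s in (0 : ℝ)..r, k (s, r - s) := by
    intro r hr
    rw [volterraOp_apply, intervalIntegral.integral_of_le hr, Real.coe_toNNReal r hr]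
    have h1 : ∫ s, startedAt (F (J (B u s))) r s ∂halfLine
        = ∫ s in Ioc 0 r, startedAt (F (J (B u s))) r s :=
      (setIntegral_eq_of_subset_of_forall_sdiff_eq_zero measurableSet_Ioi
        (fun s hs => hs.1) fun s hs => by
          rw [startedAt, if_neg]
          exact fun h => hs.2 ⟨hs.1, h.le⟩)
    rw [h1]
    refine integral_congr_ae ?_
    filter_upwards [ae_restrict_mem measurableSet_Ioc,
      ae_restrict_of_ae (Measure.ae_ne volume r),
      ae_restrict_of_ae_restrict_of_subset (fun s (hs : s ∈ Ioc 0 r) => hs.1) hu] with s hs hne h2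
    rw [startedAt, if_pos (lt_of_le_of_ne hs.2 hne), h2]
  rw [hasDerivWithinAt_iff_isLittleO, Asymptotics.isLittleO_iff]
  intro ε hε
  have hnear := Metric.continuousAt_iff.1 (hkc.continuousAt (x := (0, 0))) ε hε
  obtain ⟨δ, hδ, hnear⟩ := hnear
  have hmem : ∀ᶠ r : ℝ in 𝓝[Ici 0] 0, r < δ :=
    mem_nhdsWithin_of_mem_nhds (Iio_mem_nhds hδ)
  filter_upwards [self_mem_nhdsWithin, hmem] with r hr hrδ
  have hr : (0 : ℝ) ≤ r := hr
  have h0 : volterraOp J B F u (0 : ℝ).toNNReal = 0 := by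
    rw [hw 0 le_rfl, intervalIntegral.integral_same]
  have hint : IntervalIntegrable (fun s => k (s, r - s)) volume 0 r :=
    (hkc.comp (by fun_prop)).intervalIntegrable _ _
  rw [h0, sub_zero, sub_zero, hw r hr]
  have h1 : (∫ s in (0 : ℝ)..r, k (s, r - s)) - r • J (c 0)
      = ∫ s in (0 : ℝ)..r, (k (s, r - s) - J (c 0)) := by
    rw [intervalIntegral.integral_sub hint (by simp), intervalIntegral.integral_const, sub_zero]
  rw [h1]
  refine (intervalIntegral.norm_integral_le_of_norm_le_const (C := ε) fun s hs => ?_).trans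
    (le_of_eq (by rw [sub_zero, Real.norm_eq_abs]))
  rw [uIoc_of_le hr] at hs
  rw [← hk0, ← dist_eq_norm]
  refine (hnear ?_).le
  rw [Prod.dist_eq, max_lt_iff, Real.dist_eq, Real.dist_eq, sub_zero, sub_zero, abs_of_pos hs.1,
    abs_of_nonneg (sub_nonneg.2 hs.2)]
  exact ⟨by linarith [hs.2], by linarith [hs.1]⟩

theorem perturbedSemigroup_generatorGraph (hB : ‖J‖ * ‖B‖ < 1)
    (hF : F = T₀.orbitOp hM + volterraOp J B F) (hd : DenseRange state)
    (hs : ∀ q r, ∀ᵐ s ∂halfLine, B (T₀.toFun r (state q)) s = B (state q) ((r : ℝ≥0) + s))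
    {u z : E} (huz : (u, z) ∈ T₀.generatorGraph) {c : ℝ≥0 → X} (hc : Continuous c)
    (hu : ∀ᵐ s ∂halfLine, B u s = c s.toNNReal) :
    (u, z + J (c 0)) ∈ (perturbedSemigroup hB hF hd hs).generatorGraph := by
  rw [C0Semigroup.mem_generatorGraph_iff] at huz ⊢
  have hF0 : ∀ v, F v 0 = v := fun v =>
    congrArg (fun L : E →L[ℂ] E => L v) (perturbedSemigroup hB hF hd hs).map_zero
  refine (huz.add (hasDerivWithinAt_volterraOp (J := J) hc hu hF0)).congr_of_mem
    (fun r _ => ?_) (by simp)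
  change F u r.toNNReal = _
  conv_lhs => rw [hF]
  rfl

end Perturbation

/-! ### Norm continuity of the perturbed semigroup -/

section PerturbationNormContinuity

variable {X : Type*} [NormedAddCommGroup X] [NormedSpace ℂ X]
  {E : Type*} [NormedAddCommGroup E] [NormedSpace ℂ E]
  {J : X →L[ℂ] E} {B : E →L[ℂ] Lp X 1 halfLine}

/-- If the kernel `t ↦ G(t) J` is norm continuous on `(0, ∞)`, then so is the Volterra convolution,
provided that `B u` is uniformly small in `L¹` on short intervals: near `t₀` only the values of
`B u` on a short interval around `t₀` meet the singularity of the kernel at `0`. -/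
theorem continuousOn_volterraOp {κ : ℝ → ℝ} (hκ : Tendsto κ (𝓝[>] 0) (𝓝 0))
    (hB : ∀ a δ : ℝ, 0 ≤ a → 0 < δ → ∀ u : E,
      ∫ s in Ioc a (a + δ), ‖B u s‖ ∂halfLine ≤ κ δ * ‖u‖)
    {G : E →L[ℂ] (ℝ≥0 →ᵇ E)}
    (hG : ContinuousOn (fun t : ℝ≥0 =>
      (BoundedContinuousFunction.evalCLM ℂ t).comp (G.comp J)) (Ioi 0)) :
    ContinuousOn (fun t : ℝ≥0 =>
      (BoundedContinuousFunction.evalCLM ℂ t).comp (volterraOp J B G)) (Ioi 0) := by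
  set k : ℝ≥0 → (X →L[ℂ] E) := fun t => (BoundedContinuousFunction.evalCLM ℂ t).comp (G.comp J)
    with hk
  set C : ℝ := ‖G.comp J‖ with hC
  have hC0 : 0 ≤ C := norm_nonneg _
  refine Metric.continuousOn_iff.2 fun t₀ ht₀ ε hε => ?_
  have ht₀ : (0 : ℝ) < t₀ := by exact_mod_cast (show (0 : ℝ≥0) < t₀ from ht₀)
  -- the length `2 δ` of the interval around `t₀` on which the kernel is only estimated by `C`
  obtain ⟨δ, hδ, hδt, hκδ⟩ : ∃ δ : ℝ, 0 < δ ∧ δ ≤ t₀ ∧ 2 * C * κ (2 * δ) ≤ ε / 4 := by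
    have h1 : Tendsto (fun δ : ℝ => 2 * C * κ (2 * δ)) (𝓝[>] 0) (𝓝 0) := by
      have h2 : Tendsto (fun δ : ℝ => 2 * δ) (𝓝[>] 0) (𝓝[>] 0) := by
        refine tendsto_nhdsWithin_iff.2 ⟨?_, ?_⟩
        · have : Tendsto (fun δ : ℝ => 2 * δ) (𝓝 0) (𝓝 (2 * 0)) :=
            (continuous_const.mul continuous_id).tendsto 0
          rw [mul_zero] at this
          exact this.mono_left nhdsWithin_le_nhds
        · filter_upwards [self_mem_nhdsWithin] with δ hδ
          exact mul_pos two_pos (show (0 : ℝ) < δ from hδ)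
      simpa using (hκ.comp h2).const_mul (2 * C)
    have h3 := h1.eventually_le_const (show (0 : ℝ) < ε / 4 by positivity)
    have h4 : ∀ᶠ δ : ℝ in 𝓝[>] 0, δ ≤ t₀ :=
      mem_nhdsWithin_of_mem_nhds (Iic_mem_nhds ht₀)
    obtain ⟨δ, ⟨e1, e2⟩, e3⟩ := ((h3.and h4).and self_mem_nhdsWithin).exists
    exact ⟨δ, e3, e2, e1⟩
  set δ' : ℝ≥0 := (δ / 2).toNNReal with hδ'
  have hδ'c : (δ' : ℝ) = δ / 2 := Real.coe_toNNReal _ (by positivity)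
  have huc : UniformContinuousOn k (Icc δ' (t₀ + 1)) := by
    refine isCompact_Icc.uniformContinuousOn_of_continuous (hG.mono fun t ht => ?_)
    have : (0 : ℝ) < t := lt_of_lt_of_le (by rw [hδ'c]; positivity) (NNReal.coe_le_coe.2 ht.1)
    exact_mod_cast this
  set ε' : ℝ := ε / (4 * (‖B‖ + 1)) with hε'
  have hε'0 : 0 < ε' := by positivity
  obtain ⟨ρ, hρ, huc⟩ := Metric.uniformContinuousOn_iff.1 huc ε' hε'0
  refine ⟨min ρ (min (δ / 2) 1), by positivity, fun t _ htd => ?_⟩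
  obtain ⟨hd1, hd23⟩ := lt_min_iff.1 htd
  obtain ⟨hd2, hd3⟩ := lt_min_iff.1 hd23
  rw [NNReal.dist_eq] at hd1 hd2 hd3
  have hd2' := abs_lt.1 hd2
  have hd3' := abs_lt.1 hd3
  rw [dist_eq_norm]
  refine lt_of_le_of_lt (ContinuousLinearMap.opNorm_le_bound _ (M := ε / 2) (by positivity)
    fun u => ?_) (by linarith)
  set g := B u with hg
  have hpt : ∀ s, 0 < s → ‖startedAt (G (J (g s))) t s - startedAt (G (J (g s))) t₀ s‖
      ≤ ε' * ‖g s‖ + (Ioc (t₀ - δ : ℝ) (t₀ - δ + 2 * δ)).indicator (fun s => 2 * C * ‖g s‖) s := by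
    intro s hs
    have hkv : ∀ r, G (J (g s)) r = k r (g s) := fun _ => rfl
    have hno : ∀ r, ‖startedAt (G (J (g s))) r s‖ ≤ C * ‖g s‖ := fun r =>
      (norm_startedAt_le _ _ _).trans ((G.comp J).le_opNorm _)
    by_cases h1 : s ∈ Ioc (t₀ - δ : ℝ) (t₀ - δ + 2 * δ)
    · rw [indicator_of_mem h1]
      have h2 : 0 ≤ ε' * ‖g s‖ := by positivity
      linarith [norm_sub_le (startedAt (G (J (g s))) t s) (startedAt (G (J (g s))) t₀ s),
        hno t, hno t₀]
    · rw [indicator_of_notMem h1, add_zero]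
      by_cases h2 : s ≤ t₀ - δ
      · have e1 : s < t := by linarith
        have e2 : s < t₀ := by linarith
        rw [startedAt, startedAt, if_pos e1, if_pos e2, hkv, hkv, ← _root_.sub_apply]
        refine (k _ - k _).le_of_opNorm_le ?_ _
        rw [← dist_eq_norm]
        refine (huc _ ⟨?_, ?_⟩ _ ⟨?_, ?_⟩ ?_).le
        · rw [← NNReal.coe_le_coe, hδ'c, Real.coe_toNNReal _ (by linarith)]; linarith
        · rw [← NNReal.coe_le_coe, Real.coe_toNNReal _ (by linarith)]; push_cast; linarith
        · rw [← NNReal.coe_le_coe, hδ'c, Real.coe_toNNReal _ (by linarith)]; linarith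
        · rw [← NNReal.coe_le_coe, Real.coe_toNNReal _ (by linarith)]; push_cast; linarith
        · rw [NNReal.dist_eq, Real.coe_toNNReal _ (by linarith), Real.coe_toNNReal _ (by linarith),
            sub_sub_sub_cancel_right]
          exact hd1
      · have h3 : t₀ - δ + 2 * δ < s := by
          by_contra h4
          exact h1 ⟨not_le.1 h2, not_lt.1 h4⟩
        rw [startedAt, startedAt, if_neg (by linarith), if_neg (by linarith), sub_zero, norm_zero]
        positivity
  have hgi : Integrable (fun s => ‖g s‖) halfLine := (L1.integrable_coeFn g).norm
  have hi2 : Integrable ((Ioc (t₀ - δ : ℝ) (t₀ - δ + 2 * δ)).indicator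
      fun s => 2 * C * ‖g s‖) halfLine := (hgi.const_mul _).indicator measurableSet_Ioc
  change ‖volterraOp J B G u t - volterraOp J B G u t₀‖ ≤ _
  have hsi : ∀ r : ℝ, Integrable (fun s => startedAt (G (J (g s))) r s) halfLine :=
    fun r => integrable_startedAt (G.comp J) g r
  rw [volterraOp_apply, volterraOp_apply, ← hg, ← integral_sub (hsi t) (hsi t₀)]
  calc ‖∫ s, ((startedAt (G (J (g s))) t s) - startedAt (G (J (g s))) t₀ s) ∂halfLine‖
      ≤ ∫ s, (ε' * ‖g s‖ + (Ioc (t₀ - δ : ℝ) (t₀ - δ + 2 * δ)).indicator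
          (fun s => 2 * C * ‖g s‖) s) ∂halfLine := by
        refine norm_integral_le_of_norm_le ((hgi.const_mul _).add hi2) ?_
        filter_upwards [ae_restrict_mem measurableSet_Ioi] with s hs using hpt s hs
    _ = ε' * ‖g‖ + 2 * C * ∫ s in Ioc (t₀ - δ : ℝ) (t₀ - δ + 2 * δ), ‖g s‖ ∂halfLine := by
        rw [integral_add (hgi.const_mul _) hi2, integral_const_mul, L1.norm_eq_integral_norm,
          integral_indicator measurableSet_Ioc, integral_const_mul]
    _ ≤ ε' * (‖B‖ * ‖u‖) + 2 * C * (κ (2 * δ) * ‖u‖) := by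
        have h1 := hB (t₀ - δ) (2 * δ) (by linarith) (by linarith) u
        have h2 := B.le_opNorm u
        gcongr
    _ ≤ ε / 4 * ‖u‖ + ε / 4 * ‖u‖ := by
        have h3 : ε' * ‖B‖ ≤ ε / 4 := by
          have : ε' * (‖B‖ + 1) = ε / 4 := by
            rw [hε']; field_simp
          nlinarith
        have h4 := mul_le_mul_of_nonneg_right h3 (norm_nonneg u)
        have h5 := mul_le_mul_of_nonneg_right hκδ (norm_nonneg u)
        nlinarith
    _ = ε / 2 * ‖u‖ := by ring

/-- Norm continuity of `t ↦ G(t) J` on a set is a closed condition on `G`. -/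
theorem isClosed_continuousOn_kernel (J : X →L[ℂ] E) (s : Set ℝ≥0) :
    IsClosed {G : E →L[ℂ] (ℝ≥0 →ᵇ E) | ContinuousOn (fun t : ℝ≥0 =>
      (BoundedContinuousFunction.evalCLM ℂ t).comp (G.comp J)) s} := by
  refine isClosed_of_closure_subset fun G hG => ?_
  refine continuousOn_of_uniform_approx_of_continuousOn fun U hU => ?_
  obtain ⟨ε, hε, hεU⟩ := Metric.mem_uniformity_dist.1 hU
  obtain ⟨G', hG', hd⟩ := Metric.mem_closure_iff.1 hG (ε / (‖J‖ + 1)) (by positivity)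
  refine ⟨_, hG', fun t _ => hεU ?_⟩
  rw [dist_eq_norm] at hd ⊢
  have h1 : ‖(BoundedContinuousFunction.evalCLM ℂ t).comp (G.comp J)
      - (BoundedContinuousFunction.evalCLM ℂ t).comp (G'.comp J)‖ ≤ ‖G - G'‖ * ‖J‖ := by
    refine ContinuousLinearMap.opNorm_le_bound _ (by positivity) fun x => ?_
    change ‖((G - G') (J x)) t‖ ≤ _
    calc ‖((G - G') (J x)) t‖ ≤ ‖(G - G') (J x)‖ := BoundedContinuousFunction.norm_coe_le_norm _ t
      _ ≤ ‖G - G'‖ * ‖J x‖ := (G - G').le_opNorm _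
      _ ≤ ‖G - G'‖ * (‖J‖ * ‖x‖) := by gcongr; exact J.le_opNorm x
      _ = _ := by ring
  have h2 : ‖G - G'‖ * (‖J‖ + 1) < ε := (lt_div_iff₀ (by positivity)).1 hd
  have h3 := norm_nonneg (G - G')
  refine h1.trans_lt ?_
  nlinarith

variable [CompleteSpace E] {T₀ : C0Semigroup E} {M : ℝ} {hM : ∀ t, ‖T₀.toFun t‖ ≤ M}
  {D : Type*} {state : D → E} {F : E →L[ℂ] (ℝ≥0 →ᵇ E)}

theorem continuousOn_perturbedSemigroup (hB : ‖J‖ * ‖B‖ < 1)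
    (hF : F = T₀.orbitOp hM + volterraOp J B F) (hd : DenseRange state)
    (hs : ∀ q r, ∀ᵐ s ∂halfLine, B (T₀.toFun r (state q)) s = B (state q) ((r : ℝ≥0) + s))
    {κ : ℝ → ℝ} (hκ : Tendsto κ (𝓝[>] 0) (𝓝 0))
    (hBκ : ∀ a δ : ℝ, 0 ≤ a → 0 < δ → ∀ u : E,
      ∫ s in Ioc a (a + δ), ‖B u s‖ ∂halfLine ≤ κ δ * ‖u‖)
    (hJ : ContinuousOn (fun t => (T₀.toFun t).comp J) (Ioi 0))
    (h1 : ContinuousOn T₀.toFun (Ioi 1)) :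
    ContinuousOn (perturbedSemigroup hB hF hd hs).toFun (Ioi 1) := by
  have hFJ : F ∈ {G : E →L[ℂ] (ℝ≥0 →ᵇ E) | ContinuousOn (fun t : ℝ≥0 =>
      (BoundedContinuousFunction.evalCLM ℂ t).comp (G.comp J)) (Ioi 0)} := by
    refine volterra_solution_induction J B hB hF (isClosed_continuousOn_kernel J _) hJ
      fun G hG => ?_
    exact hJ.add ((continuousOn_volterraOp hκ hBκ hG).clm_comp (continuousOn_const (c := J)))
  have h2 := (continuousOn_volterraOp hκ hBκ hFJ).mono (Ioi_subset_Ioi (zero_le_one' ℝ≥0))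
  refine (h1.add h2).congr fun t _ => ContinuousLinearMap.ext fun u => ?_
  change F u t = _
  conv_lhs => rw [hF]
  rfl

end PerturbationNormContinuity

/-! ### The delay semigroup -/

section DelaySemigroup

theorem setLIntegral_Ioc_translate (f : ℝ → ℝ≥0∞) (a b c : ℝ) :
    ∫⁻ s in Ioc (a + b) (a + c), f s = ∫⁻ s in Ioc b c, f (a + s) := by
  rw [← lintegral_indicator measurableSet_Ioc, ← lintegral_indicator measurableSet_Ioc,
    ← lintegral_add_left_eq_self _ a]
  refine lintegral_congr fun s => ?_
  have : a + s ∈ Ioc (a + b) (a + c) ↔ s ∈ Ioc b c := by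
    simp only [mem_Ioc, add_lt_add_iff_left, add_le_add_iff_left]
  by_cases hs : s ∈ Ioc b c
  · rw [indicator_of_mem hs, indicator_of_mem (this.2 hs)]
  · rw [indicator_of_notMem hs, indicator_of_notMem (mt this.1 hs)]

/-- A bound on the initial interval `(0, τ]` propagates to `(0, ∞)` if the time shift by `τ` halves
the size of the data. -/
theorem lintegral_Ioi_le_of_shift {D : Type*} {N : D → ℝ≥0∞} {b : D → ℝ → ℝ≥0∞} {shift : D → D}
    {τ : ℝ} (hτ : 0 < τ) (hb : ∀ q s, 0 < s → b (shift q) s = b q (τ + s)) {K : ℝ≥0∞}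
    (hK : ∀ q, ∫⁻ s in Ioc 0 τ, b q s ≤ K * N q) (hN : ∀ q, 2 * N (shift q) ≤ N q) (q : D) :
    ∫⁻ s in Ioi 0, b q s ≤ 2 * K * N q := by
  have hn : ∀ (n : ℕ) (q : D), ∫⁻ s in Ioc 0 (n * τ), b q s ≤ 2 * K * N q := by
    intro n
    induction n with
    | zero => intro q; simp
    | succ n ih =>
      intro q
      have hu : Ioc 0 (((n + 1 : ℕ) : ℝ) * τ) = Ioc 0 τ ∪ Ioc τ (((n + 1 : ℕ) : ℝ) * τ) := by
        refine (Ioc_union_Ioc_eq_Ioc hτ.le ?_).symm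
        push_cast
        nlinarith [(Nat.cast_nonneg n : (0 : ℝ) ≤ n)]
      have ht : ∫⁻ s in Ioc τ (((n + 1 : ℕ) : ℝ) * τ), b q s
          = ∫⁻ s in Ioc 0 (n * τ), b (shift q) s := by
        have e : Ioc τ (((n + 1 : ℕ) : ℝ) * τ) = Ioc (τ + 0) (τ + n * τ) := by
          push_cast; congr 1 <;> ring
        rw [e, setLIntegral_Ioc_translate]
        refine setLIntegral_congr_fun measurableSet_Ioc fun s hs => ?_
        exact (hb q s hs.1).symm
      calc ∫⁻ s in Ioc 0 (((n + 1 : ℕ) : ℝ) * τ), b q s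
          ≤ (∫⁻ s in Ioc 0 τ, b q s) + ∫⁻ s in Ioc τ (((n + 1 : ℕ) : ℝ) * τ), b q s := by
            rw [hu]; exact lintegral_union_le _ _ _
        _ ≤ K * N q + 2 * K * N (shift q) := by
            rw [ht]; exact add_le_add (hK q) (ih _)
        _ = K * N q + K * (2 * N (shift q)) := by ring
        _ ≤ K * N q + K * N q := by gcongr; exact hN q
        _ = 2 * K * N q := by ring
  have hunion : Ioi (0 : ℝ) = ⋃ n : ℕ, Ioc 0 (n * τ) := by
    ext s
    simp only [mem_Ioi, mem_iUnion, mem_Ioc]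
    refine ⟨fun hs => ?_, fun ⟨n, hn, _⟩ => hn⟩
    obtain ⟨n, hn⟩ := exists_nat_ge (s / τ)
    exact ⟨n, hs, (div_le_iff₀ hτ).1 hn⟩
  have hmono : Monotone fun n : ℕ => Ioc (0 : ℝ) (n * τ) := fun m n hmn =>
    Ioc_subset_Ioc_right (mul_le_mul_of_nonneg_right (Nat.cast_le.2 hmn) hτ.le)
  rw [hunion, setLIntegral_iUnion_of_directed _ hmono.directed_le]
  exact iSup_le fun n => hn n q

variable {X : Type*} [NormedAddCommGroup X] [NormedSpace ℂ X] [CompleteSpace X]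
  {p : ℝ≥0∞} [Fact (1 ≤ p)] {S : C0Semigroup X} (h : MemLp (orbitKernel S) p volume)
  (Φ : W1p X p →L[ℂ] X) (ω : ℝ)

open delayDomain

/-- The delay term `e^{-ωs} Φ(S_s x + T₀(s) f)` along an undelayed orbit, exponentially weighted. -/
def delayTerm (q : delayDomain p S) (s : ℝ) : X :=
  Complex.exp (-(ω : ℂ) * s) • Φ (segmentW1p h s.toNNReal q)

/-- The exponentially weighted undelayed semigroup on the domain. -/
def weightedShift (t : ℝ≥0) (q : delayDomain p S) : delayDomain p S :=
  Complex.exp (-(ω : ℂ) * t) • shiftDomain h t q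

theorem state_weightedShift (hp : p ≠ ⊤) (t : ℝ≥0) (q : delayDomain p S) :
    state (weightedShift h ω t q)
      = ((undelayedSemigroup h hp).rescale ω).toFun t (state q) := by
  rw [weightedShift, map_smul, state_shiftDomain, C0Semigroup.rescale_apply]
  rfl

theorem delayTerm_weightedShift (t : ℝ≥0) (q : delayDomain p S) {s : ℝ} (hs : 0 ≤ s) :
    delayTerm h Φ ω (weightedShift h ω t q) s = delayTerm h Φ ω q (t + s) := by
  rw [delayTerm, delayTerm, weightedShift, map_smul, map_smul, segmentW1p_shiftDomain, smul_smul,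
    ← Complex.exp_add, Real.toNNReal_add t.coe_nonneg hs, Real.toNNReal_coe]
  congr 2
  push_cast
  ring

theorem continuous_delayTerm (hp : p ≠ ⊤) (q : delayDomain p S) :
    Continuous (delayTerm h Φ ω q) := by
  have h1 : Continuous fun s : ℝ => Φ (segmentW1p h s.toNNReal q) :=
    Φ.continuous.comp ((continuous_segmentW1p h hp q).comp continuous_real_toNNReal)
  have h2 : Continuous fun s : ℝ => Complex.exp (-(ω : ℂ) * s) := by fun_prop
  exact h2.smul h1

theorem delayTerm_add (q q' : delayDomain p S) (s : ℝ) :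
    delayTerm h Φ ω (q + q') s = delayTerm h Φ ω q s + delayTerm h Φ ω q' s := by
  rw [delayTerm, map_add, map_add, smul_add]; rfl

theorem delayTerm_smul (c : ℂ) (q : delayDomain p S) (s : ℝ) :
    delayTerm h Φ ω (c • q) s = c • delayTerm h Φ ω q s := by
  rw [delayTerm, map_smul, map_smul, smul_comm]; rfl

/-- The map from initial data to the delay term, as an operator into `L¹(0, ∞)`. -/
def delayTermLp (hI : ∀ q, MemLp (delayTerm h Φ ω q) 1 halfLine) :
    delayDomain p S →ₗ[ℂ] Lp X 1 halfLine where
  toFun q := (hI q).toLp _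
  map_add' q q' := by
    rw [← MemLp.toLp_add]
    exact MemLp.toLp_congr _ _ (Eventually.of_forall fun s => delayTerm_add h Φ ω q q' s)
  map_smul' c q := by
    rw [RingHom.id_apply, ← MemLp.toLp_const_smul]
    exact MemLp.toLp_congr _ _ (Eventually.of_forall fun s => delayTerm_smul h Φ ω c q s)

theorem delayTermLp_ae (hI : ∀ q, MemLp (delayTerm h Φ ω q) 1 halfLine) (q : delayDomain p S) :
    ∀ᵐ s ∂halfLine, delayTermLp h Φ ω hI q s = delayTerm h Φ ω q s :=
  (hI q).coeFn_toLp

theorem enorm_delayTermLp (hI : ∀ q, MemLp (delayTerm h Φ ω q) 1 halfLine)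
    (q : delayDomain p S) :
    ‖delayTermLp h Φ ω hI q‖ₑ = ∫⁻ s in Ioi 0, ‖delayTerm h Φ ω q s‖ₑ := by
  change ‖(hI q).toLp _‖ₑ = _
  rw [Lp.enorm_toLp, eLpNorm_one_eq_lintegral_enorm]

variable {ω} in
theorem enorm_delayTerm_le (hω : 0 ≤ ω) (q : delayDomain p S) {s : ℝ} (hs : 0 ≤ s) :
    ‖delayTerm h Φ ω q s‖ₑ ≤ ‖Φ (segmentW1p h s.toNNReal q)‖ₑ := by
  rw [delayTerm, enorm_le_iff_norm_le, norm_smul, Complex.norm_exp]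
  refine mul_le_of_le_one_left (norm_nonneg _) (Real.exp_le_one_iff.2 ?_)
  have : (-(ω : ℂ) * s).re = -(ω * s) := by simp
  rw [this]
  exact neg_nonpos.2 (mul_nonneg hω hs)

theorem ae_halfLine_translate {P : ℝ → Prop} (hP : ∀ᵐ s ∂halfLine, P s) {r : ℝ} (hr : 0 ≤ r) :
    ∀ᵐ s ∂halfLine, P (r + s) := by
  rw [ae_restrict_iff' measurableSet_Ioi] at hP ⊢
  filter_upwards [ae_shift hP r] with s hs h0
  exact hs (add_pos_of_nonneg_of_pos hr h0)

/-- Continuous extension of `f` along a linear map `e` with dense range, which need not be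
injective. -/
theorem exists_dense_extension {D E F : Type*} [AddCommGroup D] [Module ℂ D]
    [NormedAddCommGroup E] [NormedSpace ℂ E] [NormedAddCommGroup F] [NormedSpace ℂ F]
    [CompleteSpace F] (e : D → E) (hadd : ∀ q q', e (q + q') = e q + e q')
    (hsmul : ∀ (c : ℂ) q, e (c • q) = c • e q) (f : D →ₗ[ℂ] F) (he : DenseRange e) {C : ℝ}
    (hC : 0 ≤ C) (hf : ∀ q, ‖f q‖ ≤ C * ‖e q‖) :
    ∃ B : E →L[ℂ] F, ‖B‖ ≤ C ∧ ∀ q, B (e q) = f q := by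
  let e' : D →ₗ[ℂ] E := { toFun := e, map_add' := hadd, map_smul' := hsmul }
  have he' : DenseRange e' := he
  exact ⟨f.extendOfNorm e', LinearMap.opNorm_extendOfNorm_le he' hC hf,
    fun q => LinearMap.extendOfNorm_eq he' ⟨C, hf⟩ q⟩

theorem norm_undelayedState_le {M₁ : ℝ} (hM₁ : ∀ t, ‖S.toFun t‖ ≤ M₁) (t : ℝ≥0) :
    ‖undelayedState h t‖ ≤ max (max M₁ ‖lineExtension h‖) 1 := by
  have hM0 : 0 ≤ max (max M₁ ‖lineExtension h‖) 1 := zero_le_one.trans (le_max_right _ _)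
  refine ContinuousLinearMap.opNorm_le_bound _ hM0 fun u => ?_
  change ‖(S.toFun t u.1, pastSegment h t u)‖ ≤ _
  refine max_le ?_ ?_
  · refine ((S.toFun t).le_of_opNorm_le (hM₁ t) _).trans ?_
    exact mul_le_mul ((le_max_left _ _).trans (le_max_left _ _)) (norm_fst_le u)
      (norm_nonneg _) hM0
  · exact (pastSegment h t).le_of_opNorm_le ((norm_pastSegment_le h t).trans
      ((le_max_right _ _).trans (le_max_left _ _))) u

variable {ω Φ} in
theorem lintegral_delayTerm_le (hω : 0 ≤ ω) {κ : ℝ → ℝ≥0}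
    (hκ : ∀ (x : S.generator.domain) (f : W1p X p) (hf : HasValueAtZero (W1p.fn f) (x : X)) (t : ℝ),
      0 < t → ∫⁻ s in Ioc (0 : ℝ) t, ‖Φ (historySegment S x f hf s.toNNReal)‖ₑ
        ≤ κ t * ‖(((x : X), W1p.fn f) : DelaySpace X p)‖ₑ) (q : delayDomain p S) {t : ℝ}
    (ht : 0 < t) : ∫⁻ s in Ioc 0 t, ‖delayTerm h Φ ω q s‖ₑ ≤ κ t * ‖state q‖ₑ := by
  refine (setLIntegral_mono' measurableSet_Ioc
    fun s hs => enorm_delayTerm_le h Φ hω q hs.1.le).trans ?_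
  simp only [segmentW1p_eq_historySegment]
  exact hκ q.1.1 q.1.2 q.2 t ht

/-- The delay term along undelayed orbits extends to a bounded operator into `L¹(0, ∞)`, with small
norm if the weight is large. -/
theorem exists_delayTerm_extension (h : MemLp (orbitKernel S) p volume) (hp : p ≠ ⊤) {τ : ℝ}
    (hτ : 0 < τ)
    (hsmall : ∀ q : delayDomain p S,
      ∫⁻ s in Ioc 0 τ, ‖delayTerm h Φ ω q s‖ₑ ≤ (1 / 4 : ℝ≥0) * ‖state q‖ₑ)
    (hcontr : ∀ q : delayDomain p S,
      2 * ‖state (weightedShift h ω τ.toNNReal q)‖ ≤ ‖state q‖) :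
    ∃ B : DelaySpace X p →L[ℂ] Lp X 1 halfLine, ‖B‖ ≤ 1 / 2 ∧
      ∀ q, ∀ᵐ s ∂halfLine, B (state q) s = delayTerm h Φ ω q s := by
  have hI0 : ∀ q : delayDomain p S,
      ∫⁻ s in Ioi 0, ‖delayTerm h Φ ω q s‖ₑ ≤ 2 * (1 / 4 : ℝ≥0) * ‖state q‖ₑ := by
    refine lintegral_Ioi_le_of_shift (N := fun q => ‖state q‖ₑ)
      (shift := weightedShift h ω τ.toNNReal) hτ (fun q s hs => ?_) hsmall (fun q => ?_)
    · rw [delayTerm_weightedShift h Φ ω _ q hs.le, Real.coe_toNNReal τ hτ.le]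
    · have h3 := ENNReal.ofReal_le_ofReal (hcontr q)
      rwa [ENNReal.ofReal_mul two_pos.le, ofReal_norm, ofReal_norm, ENNReal.ofReal_ofNat] at h3
  have hI : ∀ q : delayDomain p S, MemLp (delayTerm h Φ ω q) 1 halfLine := fun q => by
    refine ⟨(continuous_delayTerm h Φ ω hp q).aestronglyMeasurable, ?_⟩
    rw [eLpNorm_one_eq_lintegral_enorm]
    refine (hI0 q).trans_lt (ENNReal.mul_lt_top ?_ enorm_lt_top)
    exact ENNReal.mul_lt_top (by simp) ENNReal.coe_lt_top
  have hnorm : ∀ q : delayDomain p S, ‖delayTermLp h Φ ω hI q‖ ≤ 1 / 2 * ‖state q‖ := fun q => by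
    have h1 := (enorm_delayTermLp h Φ ω hI q).trans_le (hI0 q)
    have h2 := ENNReal.toReal_mono (by finiteness) h1
    rw [ENNReal.toReal_mul, ENNReal.toReal_mul, toReal_enorm, toReal_enorm] at h2
    refine h2.trans (le_of_eq ?_)
    simp
    norm_num
  obtain ⟨B, hB, hBe⟩ := exists_dense_extension (fun q : delayDomain p S => state q)
    (fun _ _ => rfl) (fun _ _ => rfl) (delayTermLp h Φ ω hI) (denseRange_state h hp) (by norm_num)
    hnorm
  refine ⟨B, hB, fun q => ?_⟩
  rw [hBe]
  exact delayTermLp_ae h Φ ω hI q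

section Extension

variable {h Φ ω} {B : DelaySpace X p →L[ℂ] Lp X 1 halfLine}

theorem delayTerm_extension_shift (hp : p ≠ ⊤)
    (hB : ∀ q, ∀ᵐ s ∂halfLine, B (state q) s = delayTerm h Φ ω q s) (q : delayDomain p S)
    (r : ℝ≥0) : ∀ᵐ s ∂halfLine, B (((undelayedSemigroup h hp).rescale ω).toFun r (state q)) s
      = B (state q) ((r : ℝ≥0) + s) := by
  rw [← state_weightedShift h ω hp]
  filter_upwards [hB (weightedShift h ω r q),
    ae_halfLine_translate (hB q) r.coe_nonneg, ae_restrict_mem measurableSet_Ioi] with s h1 h2 h3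
  rw [h1, h2, delayTerm_weightedShift h Φ ω r q (le_of_lt h3)]

/-- The extended delay term is uniformly small on short time intervals. -/
theorem integral_delayTerm_extension_le (hp : p ≠ ⊤)
    (hB : ∀ q, ∀ᵐ s ∂halfLine, B (state q) s = delayTerm h Φ ω q s) {M : ℝ}
    (hM : ∀ t : ℝ≥0, ‖((undelayedSemigroup h hp).rescale ω).toFun t‖ ≤ M) {a δ : ℝ} {k : ℝ≥0}
    (ha : 0 ≤ a) (hk : ∀ q : delayDomain p S,
      ∫⁻ s in Ioc 0 δ, ‖delayTerm h Φ ω q s‖ₑ ≤ k * ‖state q‖ₑ) (u : DelaySpace X p) :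
    ∫ s in Ioc a (a + δ), ‖B u s‖ ∂halfLine ≤ (k * M) * ‖u‖ := by
  have hn : ∀ u, ∫ s in Ioc a (a + δ), ‖B u s‖ ∂halfLine
      = ‖LpToLpRestrictCLM ℝ X ℂ halfLine 1 (Ioc a (a + δ)) (B u)‖ := fun u => by
    rw [L1.norm_eq_integral_norm]
    refine integral_congr_ae ?_
    filter_upwards [LpToLpRestrictCLM_coeFn ℂ (Ioc a (a + δ)) (B u)] with s hs
    rw [hs]
  rw [hn]
  refine (denseRange_state h hp).induction_on (p := fun u =>
    ‖LpToLpRestrictCLM ℝ X ℂ halfLine 1 (Ioc a (a + δ)) (B u)‖ ≤ (k * M) * ‖u‖) u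
    (isClosed_le (by fun_prop) (by fun_prop)) fun q => ?_
  rw [← hn]
  have h1 : ∫⁻ s in Ioc a (a + δ), ‖B (state q) s‖ₑ ∂halfLine
      ≤ k * ‖state (weightedShift h ω a.toNNReal q)‖ₑ := by
    have e0 : halfLine.restrict (Ioc a (a + δ)) = volume.restrict (Ioc a (a + δ)) := by
      have hsub : Ioc a (a + δ) ⊆ Ioi 0 := fun s hs => lt_of_le_of_lt ha hs.1
      rw [Measure.restrict_restrict measurableSet_Ioc, inter_eq_self_of_subset_left hsub]
    rw [lintegral_congr_ae (g := fun s => ‖delayTerm h Φ ω q s‖ₑ) (by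
      filter_upwards [ae_restrict_of_ae (hB q)] with s hs
      rw [hs]), e0]
    have e1 := setLIntegral_Ioc_translate (fun s => ‖delayTerm h Φ ω q s‖ₑ) a 0 δ
    rw [add_zero] at e1
    rw [e1]
    refine le_trans (le_of_eq ?_) (hk (weightedShift h ω a.toNNReal q))
    refine setLIntegral_congr_fun measurableSet_Ioc fun s hs => ?_
    rw [delayTerm_weightedShift h Φ ω _ q hs.1.le, Real.coe_toNNReal a ha]
  have h2 := ENNReal.toReal_mono (by finiteness) h1
  rw [ENNReal.toReal_mul, toReal_enorm, ENNReal.coe_toReal] at h2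
  rw [integral_norm_eq_lintegral_enorm (Lp.aestronglyMeasurable (B (state q))).restrict]
  refine h2.trans ?_
  rw [mul_assoc, state_weightedShift h ω hp]
  exact mul_le_mul_of_nonneg_left ((ContinuousLinearMap.le_of_opNorm_le _ (hM _) _)) k.coe_nonneg

/-- The semigroup obtained by perturbing the undelayed semigroup, before the weight is removed. -/
theorem exists_weighted_delaySemigroup (hp : p ≠ ⊤) (hc : S.ImmediatelyNormContinuous)
    (hBn : ‖B‖ ≤ 1 / 2) (hB : ∀ q, ∀ᵐ s ∂halfLine, B (state q) s = delayTerm h Φ ω q s) {M : ℝ}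
    (hM : ∀ t : ℝ≥0, ‖((undelayedSemigroup h hp).rescale ω).toFun t‖ ≤ M) {κ : ℝ → ℝ≥0}
    (hκ : Tendsto κ (𝓝[>] 0) (𝓝 0)) (hk : ∀ (q : delayDomain p S) (δ : ℝ), 0 < δ →
      ∫⁻ s in Ioc 0 δ, ‖delayTerm h Φ ω q s‖ₑ ≤ κ δ * ‖state q‖ₑ) :
    ∃ T : C0Semigroup (DelaySpace X p),
      (∀ q : delayDomain p S, (state q, stateDeriv q - (ω : ℂ) • state q + (Φ q.1.2, 0))
        ∈ T.generatorGraph) ∧ ContinuousOn T.toFun (Ioi 1) ∧ ∃ C : ℝ, ∀ t, ‖T.toFun t‖ ≤ C := by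
  have hJn : ‖ContinuousLinearMap.inl ℂ X (LpHistory X p)‖ ≤ 1 :=
    ContinuousLinearMap.norm_inl_le_one ℂ X (LpHistory X p)
  have hJB : ‖ContinuousLinearMap.inl ℂ X (LpHistory X p)‖ * ‖B‖ < 1 := by
    have := mul_le_mul hJn hBn (norm_nonneg _) zero_le_one
    linarith
  have hd : DenseRange (state (p := p) (S := S)) := denseRange_state h hp
  obtain ⟨F, hF⟩ := exists_volterra_solution _ B hJB
    (((undelayedSemigroup h hp).rescale ω).orbitOp hM)
  have hs := delayTerm_extension_shift hp hB
  refine ⟨perturbedSemigroup hJB hF hd hs, fun q => ?_, ?_, ‖F‖, fun t => ?_⟩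
  · have h2 := perturbedSemigroup_generatorGraph hJB hF hd hs
      ((undelayedSemigroup h hp).mem_rescale_generatorGraph (ω : ℂ)
        (state_mem_generatorGraph h hp q))
      (c := fun s : ℝ≥0 => delayTerm h Φ ω q s)
      ((continuous_delayTerm h Φ ω hp q).comp NNReal.continuous_coe) (by
        filter_upwards [hB q, ae_restrict_mem measurableSet_Ioi] with s h3 h4
        rw [h3, Real.coe_toNNReal s (le_of_lt h4)])
    have e : delayTerm h Φ ω q ((0 : ℝ≥0) : ℝ) = Φ q.1.2 := by
      rw [delayTerm, Real.toNNReal_coe, segmentW1p_zero]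
      simp
    rw [e] at h2
    exact h2
  · refine continuousOn_perturbedSemigroup hJB hF hd hs
      (κ := fun δ => κ δ * M) ?_
      (fun a δ ha hδ u => integral_delayTerm_extension_le hp hB hM ha (fun q => hk q δ hδ) u) ?_ ?_
    · have h1 : Tendsto (fun δ => (κ δ : ℝ)) (𝓝[>] 0) (𝓝 ((0 : ℝ≥0) : ℝ)) :=
        (NNReal.continuous_coe.tendsto 0).comp hκ
      simpa using h1.mul_const M
    · have h1 : Continuous fun t : ℝ≥0 => Complex.exp (-(ω : ℂ) * t) := by fun_prop
      exact h1.continuousOn.smul (continuousOn_undelayedState_inl h hc hp)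
    · exact (undelayedSemigroup h hp).continuousOn_rescale _ (continuousOn_undelayedState h hc hp)
  · refine ContinuousLinearMap.opNorm_le_bound _ (norm_nonneg _) fun u => ?_
    exact ((F u).norm_coe_le_norm t).trans (F.le_opNorm u)

end Extension

/-- Under `ConditionK` the delay operator is contained in the generator of a semigroup that is
norm continuous on `(1, ∞)`. -/
theorem exists_delaySemigroup (h : MemLp (orbitKernel S) p volume) (hp : p ≠ ⊤)
    (hc : S.ImmediatelyNormContinuous) {M₁ : ℝ} (hM₁ : ∀ t, ‖S.toFun t‖ ≤ M₁)
    (hK : ConditionK S Φ) :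
    ∃ T : C0Semigroup (DelaySpace X p), delayGraph S.generator Φ ≤ T.generatorGraph ∧
      ContinuousOn T.toFun (Ioi 1) ∧
      ∃ C ω : ℝ, ∀ t : ℝ≥0, ‖T.toFun t‖ ≤ C * Real.exp (ω * t) := by
  obtain ⟨κ, hκ, hκK⟩ := hK
  obtain ⟨M, hM1, hM⟩ : ∃ M : ℝ, 1 ≤ M ∧ ∀ t : ℝ≥0, ‖undelayedState h t‖ ≤ M :=
    ⟨_, le_max_right _ _, norm_undelayedState_le h hM₁⟩
  -- the delay term is small on `(0, τ]`, and the weight makes the shift by `τ` a contraction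
  obtain ⟨τ, hτ, hτκ⟩ : ∃ τ : ℝ, 0 < τ ∧ κ τ ≤ 1 / 4 := by
    have h1 := hκ.eventually_le_const (show (0 : ℝ≥0) < 1 / 4 by positivity)
    obtain ⟨τ, e1, e2⟩ := (h1.and self_mem_nhdsWithin).exists
    exact ⟨τ, e2, e1⟩
  obtain ⟨ω, hω, hωM⟩ : ∃ ω : ℝ, 0 ≤ ω ∧ 2 * (M * Real.exp (-ω * τ)) ≤ 1 := by
    refine ⟨Real.log (2 * M) / τ, div_nonneg (Real.log_nonneg (by linarith)) hτ.le, ?_⟩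
    have e : -(Real.log (2 * M) / τ) * τ = -Real.log (2 * M) := by
      rw [neg_mul, div_mul_cancel₀ _ hτ.ne']
    rw [e, Real.exp_neg, Real.exp_log (by positivity)]
    field_simp
    exact le_rfl
  have hM' : ∀ t : ℝ≥0, ‖((undelayedSemigroup h hp).rescale ω).toFun t‖
      ≤ M * Real.exp (-ω * t) := fun t => by
    have := (undelayedSemigroup h hp).rescale_norm_le (ω : ℂ) (M := M) (r := 0)
      (fun t => by rw [zero_mul, Real.exp_zero, mul_one]; exact hM t) t
    simpa using this
  have hM'' : ∀ t : ℝ≥0, ‖((undelayedSemigroup h hp).rescale ω).toFun t‖ ≤ M := fun t =>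
    (hM' t).trans (mul_le_of_le_one_right (by linarith) (Real.exp_le_one_iff.2 (by
      have := mul_nonneg hω t.coe_nonneg
      linarith)))
  obtain ⟨B, hBn, hB⟩ := exists_delayTerm_extension Φ ω h hp hτ
    (fun q => (lintegral_delayTerm_le h hω hκK q hτ).trans (by gcongr)) (fun q => by
      rw [state_weightedShift h ω hp]
      have h1 := ContinuousLinearMap.le_of_opNorm_le _ (hM' τ.toNNReal) (state q)
      rw [Real.coe_toNNReal τ hτ.le] at h1
      nlinarith [norm_nonneg (state q)])
  obtain ⟨T, hTg, hTc, C, hTn⟩ := exists_weighted_delaySemigroup hp hc hBn hB hM'' hκ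
    fun q δ hδ => lintegral_delayTerm_le h hω hκK q hδ
  refine ⟨T.rescale (-(ω : ℂ)), ?_, T.continuousOn_rescale _ hTc, C, _,
    T.rescale_norm_le (-(ω : ℂ)) (M := C) (r := 0) fun t => by simpa using hTn t⟩
  rintro _ ⟨x, w, hw, rfl⟩
  have h3 := T.mem_rescale_generatorGraph (-(ω : ℂ)) (hTg ⟨(x, w), hw⟩)
  rw [neg_smul, sub_neg_eq_add, add_right_comm, sub_add_cancel] at h3
  convert h3 using 1
  refine Prod.ext rfl (Prod.ext rfl ?_)
  change W1p.deriv w = W1p.deriv w + 0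
  rw [add_zero]

end DelaySemigroup

/-! ### Riemann–Stieltjes delays -/

section Stieltjes

variable {X : Type*} [NormedAddCommGroup X] [NormedSpace ℂ X] [CompleteSpace X]
  {p : ℝ≥0∞} [Fact (1 ≤ p)] {S : C0Semigroup X} {Φ : W1p X p →L[ℂ] X}

/-- The continuous extension to the line of a history function `F` with `F 0 = x` by the orbit
`S(·)x` for positive times, and by a constant for times before `-1`. -/
def contExtension (S : C0Semigroup X) (x : X) (F : ℝ → X) (r : ℝ) : X :=
  S.toFun r.toNNReal x + F (max (-1) (min r 0)) - x

theorem continuous_contExtension (x : X) {F : ℝ → X} (hF : ContinuousOn F (Icc (-1 : ℝ) 0)) :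
    Continuous (contExtension S x F) := by
  have h1 : Continuous fun r : ℝ => F (max (-1) (min r 0)) :=
    hF.comp_continuous (by fun_prop) fun r =>
      ⟨le_max_left _ _, max_le (by norm_num) (min_le_right _ _)⟩
  exact ((S.continuous_real x).add h1).sub continuous_const

theorem contExtension_of_pos {x : X} {F : ℝ → X} (hx : F 0 = x) {r : ℝ} (hr : 0 < r) :
    contExtension S x F r = S.toFun r.toNNReal x := by
  rw [contExtension, min_eq_right hr.le, max_eq_right (by norm_num), hx, add_sub_cancel_right]

theorem contExtension_of_mem {x : X} {F : ℝ → X} {r : ℝ} (hr : r ∈ Icc (-1 : ℝ) 0) :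
    contExtension S x F r = F r := by
  rw [contExtension, min_eq_left hr.2, max_eq_right hr.1, Real.toNNReal_of_nonpos hr.2, S.map_zero,
    ContinuousLinearMap.id_apply, add_sub_cancel_left]

/-- The continuous representative of a history segment. -/
theorem isContRep_historySegment {x : S.generator.domain} {f : W1p X p}
    (hf : HasValueAtZero (W1p.fn f) (x : X)) {F : ℝ → X} (hF : IsContRep (W1p.fn f) F)
    (hx : F 0 = x) (s : ℝ≥0) :
    IsContRep (W1p.fn (historySegment S x f hf s))
      (fun τ => contExtension S (x : X) F (s + τ)) := by
  refine ⟨((continuous_contExtension (x : X) hF.1).comp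
    (continuous_const.add continuous_id)).continuousOn, ?_⟩
  have h0 := (ae_restrict_iff' measurableSet_Icc).1 hF.2
  filter_upwards [historySegment_spec S x f hf s, ae_restrict_of_ae (ae_shift h0 s),
    ae_restrict_mem (μ := volume) measurableSet_Icc] with τ h1 h2 hτ
  rw [h1]
  split_ifs with h3
  · rw [contExtension_of_pos hx (by linarith)]
  · have h4 : (s : ℝ) + τ ∈ Icc (-1 : ℝ) 0 := ⟨by linarith [hτ.1, s.coe_nonneg], by linarith⟩
    rw [contExtension_of_mem h4, h2 h4]

/-- Hölder's inequality on a short interval. -/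
theorem setLIntegral_history_le (f : LpHistory X p) {a b : ℝ} :
    ∫⁻ r in Ioc a b, ‖f r‖ₑ ∂delayMeasure
      ≤ ENNReal.ofReal (b - a) ^ (1 - 1 / p.toReal) * ‖f‖ₑ := by
  have hp1 : (1 : ℝ≥0∞) ≤ p := Fact.out
  have h1 := eLpNorm_le_eLpNorm_mul_rpow_measure_univ hp1
    (Lp.aestronglyMeasurable f).restrict (μ := delayMeasure.restrict (Ioc a b))
  rw [eLpNorm_one_eq_lintegral_enorm, ENNReal.toReal_one, div_one] at h1
  refine h1.trans ?_
  rw [mul_comm]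
  refine mul_le_mul' (ENNReal.rpow_le_rpow ?_ ?_) ?_
  · rw [Measure.restrict_apply_univ]
    exact (Measure.restrict_apply_le _ _).trans (le_of_eq Real.volume_Ioc)
  · rcases eq_or_ne p ⊤ with rfl | hp
    · simp
    · rw [sub_nonneg, div_le_one (ENNReal.toReal_pos (one_pos.trans_le hp1).ne' hp)]
      exact ENNReal.toReal_mono hp hp1
  · rw [Lp.enorm_def]
    exact eLpNorm_mono_measure _ Measure.restrict_le_self

theorem setLIntegral_contExtension_le {M : ℝ≥0} (hM : ∀ t, ‖S.toFun t‖ ≤ M) {x : X}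
    {f : LpHistory X p} {F : ℝ → X} (hF : IsContRep f F) (hx : F 0 = x) {a t : ℝ}
    (ha : -1 ≤ a) :
    ∫⁻ s in Ioc 0 t, ‖contExtension S x F (a + s)‖ₑ
      ≤ (ENNReal.ofReal t ^ (1 - 1 / p.toReal) + M * ENNReal.ofReal t)
        * ‖((x, f) : DelaySpace X p)‖ₑ := by
  have h0 := setLIntegral_Ioc_translate (fun r => ‖contExtension S x F r‖ₑ) a 0 t
  rw [← h0, add_zero]
  have hsplit : Ioc a (a + t) ⊆ (Ioc a (a + t) ∩ Icc (-1) 0) ∪ (Ioc a (a + t) ∩ Ioi 0) := by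
    intro r hr
    rcases le_or_gt r 0 with h | h
    · exact Or.inl ⟨hr, ha.trans hr.1.le, h⟩
    · exact Or.inr ⟨hr, h⟩
  have hf : ‖f‖ₑ ≤ ‖((x, f) : DelaySpace X p)‖ₑ :=
    enorm_le_iff_norm_le.2 (norm_snd_le ((x, f) : DelaySpace X p))
  have hx' : ‖x‖ₑ ≤ ‖((x, f) : DelaySpace X p)‖ₑ :=
    enorm_le_iff_norm_le.2 (norm_fst_le ((x, f) : DelaySpace X p))
  have h1 : ∫⁻ r in Ioc a (a + t) ∩ Icc (-1) 0, ‖contExtension S x F r‖ₑ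
      ≤ ENNReal.ofReal t ^ (1 - 1 / p.toReal) * ‖f‖ₑ := by
    have h2 := setLIntegral_history_le f (a := a) (b := a + t)
    rw [add_sub_cancel_left, Measure.restrict_restrict measurableSet_Ioc] at h2
    refine (le_of_eq (lintegral_congr_ae ?_)).trans h2
    filter_upwards [ae_restrict_of_ae_restrict_of_subset inter_subset_right hF.2,
      ae_restrict_mem (measurableSet_Ioc.inter measurableSet_Icc)] with r h3 h4
    rw [contExtension_of_mem h4.2, h3]
  have h2 : ∫⁻ r in Ioc a (a + t) ∩ Ioi 0, ‖contExtension S x F r‖ₑ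
      ≤ M * ENNReal.ofReal t * ‖x‖ₑ := by
    calc ∫⁻ r in Ioc a (a + t) ∩ Ioi 0, ‖contExtension S x F r‖ₑ
        ≤ ∫⁻ _ in Ioc a (a + t) ∩ Ioi 0, (M : ℝ≥0∞) * ‖x‖ₑ := by
          refine setLIntegral_mono' (measurableSet_Ioc.inter measurableSet_Ioi) fun r hr => ?_
          rw [contExtension_of_pos hx hr.2]
          have h3 := (S.toFun r.toNNReal).le_of_opNorm_le (hM _) x
          have h4 := ENNReal.ofReal_le_ofReal h3
          rwa [ENNReal.ofReal_mul M.coe_nonneg, ofReal_norm, ofReal_norm,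
            ENNReal.ofReal_coe_nnreal] at h4
      _ = M * ‖x‖ₑ * volume (Ioc a (a + t) ∩ Ioi 0) := setLIntegral_const _ _
      _ ≤ M * ‖x‖ₑ * ENNReal.ofReal t := by
          gcongr
          refine (measure_mono inter_subset_left).trans (le_of_eq ?_)
          rw [Real.volume_Ioc, add_sub_cancel_left]
      _ = M * ENNReal.ofReal t * ‖x‖ₑ := by ring
  calc ∫⁻ r in Ioc a (a + t), ‖contExtension S x F r‖ₑ
      ≤ (∫⁻ r in Ioc a (a + t) ∩ Icc (-1) 0, ‖contExtension S x F r‖ₑ)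
        + ∫⁻ r in Ioc a (a + t) ∩ Ioi 0, ‖contExtension S x F r‖ₑ :=
        (lintegral_mono_set hsplit).trans (lintegral_union_le _ _ _)
    _ ≤ ENNReal.ofReal t ^ (1 - 1 / p.toReal) * ‖((x, f) : DelaySpace X p)‖ₑ
        + M * ENNReal.ofReal t * ‖((x, f) : DelaySpace X p)‖ₑ := by
        refine add_le_add (h1.trans ?_) (h2.trans ?_) <;> gcongr
    _ = _ := by ring

/-- The nodes of the uniform partition of `[-1,0]`. -/
def uniformNode (n i : ℕ) : ℝ := -1 + i / n

theorem uniformNode_mem {n i : ℕ} (hi : i ≤ n) : uniformNode n i ∈ Icc (-1 : ℝ) 0 := by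
  have h1 : (i : ℝ) / n ≤ 1 := div_le_one_of_le₀ (Nat.cast_le.2 hi) (Nat.cast_nonneg n)
  have h2 : 0 ≤ (i : ℝ) / n := by positivity
  rw [uniformNode]
  exact ⟨by linarith, by linarith⟩

theorem uniformNode_mono (n : ℕ) : Monotone (uniformNode n) := fun i j hij => by
  rw [uniformNode, uniformNode]
  gcongr

/-- A Riemann–Stieltjes integral is the limit of the sums over uniform partitions. -/
theorem IsRiemannStieltjes.tendsto {η : ℝ → (X →L[ℂ] X)} {F : ℝ → X} {y : X}
    (h : IsRiemannStieltjes η F y) :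
    Tendsto (fun n : ℕ => ∑ i ∈ Finset.range n,
      (η (uniformNode n (i + 1)) - η (uniformNode n i)) (F (uniformNode n i))) atTop (𝓝 y) := by
  refine Metric.tendsto_atTop.2 fun ε hε => ?_
  obtain ⟨δ, hδ, hη⟩ := h ε hε
  obtain ⟨N, hN⟩ := exists_nat_gt (1 / δ)
  refine ⟨N + 1, fun n hn => ?_⟩
  have hn0 : (0 : ℝ) < n := by
    exact_mod_cast (Nat.succ_pos N).trans_le hn
  have hNn : (N : ℝ) ≤ n := by exact_mod_cast (Nat.le_succ N).trans hn
  rw [dist_eq_norm]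
  refine hη n (uniformNode n) (uniformNode n) (by simp [uniformNode]) ?_ fun i _ =>
    ⟨le_rfl, uniformNode_mono n (Nat.le_succ i), ?_⟩
  · rw [uniformNode, div_self hn0.ne', neg_add_cancel]
  · have e : uniformNode n (i + 1) - uniformNode n i = 1 / n := by
      rw [uniformNode, uniformNode]; push_cast; ring
    rw [e, div_lt_iff₀ hn0]
    rw [div_lt_iff₀ hδ] at hN
    nlinarith

theorem sum_enorm_uniformNode_le (η : ℝ → (X →L[ℂ] X)) (n : ℕ) :
    ∑ i ∈ Finset.range n, ‖η (uniformNode n (i + 1)) - η (uniformNode n i)‖ₑ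
      ≤ eVariationOn η (Icc (-1 : ℝ) 0) := by
  have h := eVariationOn.sum_le_of_monotoneOn_Iic (f := η) (s := Icc (-1 : ℝ) 0)
    (u := uniformNode n) (n := n) ((uniformNode_mono n).monotoneOn _) fun i hi =>
      uniformNode_mem hi
  simpa only [edist_eq_enorm_sub] using h

/-- A Riemann–Stieltjes delay satisfies `ConditionK` if `p > 1`: by Fatou's lemma it suffices to
estimate Riemann–Stieltjes sums, and Hölder's inequality gives the small factor
`t ^ (1 - 1 / p)`. -/
theorem IsStieltjesDelay.conditionK (hΦ : IsStieltjesDelay Φ) (hp1 : 1 < p) (hp : p ≠ ⊤) {M : ℝ≥0}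
    (hM : ∀ t, ‖S.toFun t‖ ≤ M) : ConditionK S Φ := by
  obtain ⟨η, hη, hΦη⟩ := hΦ
  set V : ℝ≥0 := (eVariationOn η (Icc (-1 : ℝ) 0)).toNNReal with hV
  have hVc : (V : ℝ≥0∞) = eVariationOn η (Icc (-1 : ℝ) 0) := ENNReal.coe_toNNReal hη
  have hpr : 1 < p.toReal := by
    have := (ENNReal.toReal_lt_toReal ENNReal.one_ne_top hp).2 hp1
    rwa [ENNReal.toReal_one] at this
  have he : 0 < 1 - 1 / p.toReal := by
    rw [sub_pos, div_lt_one (by linarith)]; exact hpr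
  refine ⟨fun t => V * (t.toNNReal ^ (1 - 1 / p.toReal) + M * t.toNNReal), ?_,
    fun x f hf t ht => ?_⟩
  · have h1 : Continuous fun t : ℝ =>
        V * (t.toNNReal ^ (1 - 1 / p.toReal) + M * t.toNNReal) :=
      continuous_const.mul (((NNReal.continuous_rpow_const he.le).comp
        continuous_real_toNNReal).add (continuous_const.mul continuous_real_toNNReal))
    have h2 := (h1.tendsto 0).mono_left (nhdsWithin_le_nhds (s := Ioi 0))
    rwa [Real.toNNReal_zero, NNReal.zero_rpow he.ne', mul_zero, add_zero, mul_zero] at h2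
  · obtain ⟨F, hF, hx⟩ := hf
    set K : ℝ≥0∞ := (ENNReal.ofReal t ^ (1 - 1 / p.toReal) + M * ENNReal.ofReal t)
        * ‖(((x : X), W1p.fn f) : DelaySpace X p)‖ₑ with hK
    set Y : ℕ → ℝ → ℝ≥0∞ := fun n s => ∑ i ∈ Finset.range n,
      ‖η (uniformNode n (i + 1)) - η (uniformNode n i)‖ₑ
        * ‖contExtension S (x : X) F (uniformNode n i + s)‖ₑ with hY
    have hterm : ∀ n i, Measurable fun s =>
        ‖contExtension S (x : X) F (uniformNode n i + s)‖ₑ := fun n i =>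
      ((continuous_contExtension (x : X) hF.1).comp
        (continuous_const.add continuous_id)).enorm.measurable
    have hYm : ∀ n, Measurable (Y n) := fun n =>
      Finset.measurable_fun_sum _ fun i _ => (hterm n i).const_mul _
    have hpt : ∀ s : ℝ, 0 ≤ s → ‖Φ (historySegment S x f ⟨F, hF, hx⟩ s.toNNReal)‖ₑ
        ≤ liminf (fun n => Y n s) atTop := by
      intro s hs
      have h1 := (hΦη _ _ (isContRep_historySegment ⟨F, hF, hx⟩ hF hx s.toNNReal)).tendsto
      rw [← h1.enorm.liminf_eq]
      refine liminf_le_liminf (Eventually.of_forall fun n => ?_)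
      refine (enorm_sum_le _ _).trans (Finset.sum_le_sum fun i _ => ?_)
      rw [Real.coe_toNNReal s hs, add_comm s]
      exact ContinuousLinearMap.le_opENorm _ _
    have hYi : ∀ n, ∫⁻ s in Ioc 0 t, Y n s ≤ V * K := fun n => by
      rw [hY, lintegral_finsetSum _ fun i _ => (hterm n i).const_mul _]
      calc ∑ i ∈ Finset.range n, ∫⁻ s in Ioc 0 t,
            ‖η (uniformNode n (i + 1)) - η (uniformNode n i)‖ₑ
              * ‖contExtension S (x : X) F (uniformNode n i + s)‖ₑ
          ≤ ∑ i ∈ Finset.range n, ‖η (uniformNode n (i + 1)) - η (uniformNode n i)‖ₑ * K := by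
            refine Finset.sum_le_sum fun i hi => ?_
            rw [lintegral_const_mul _ (hterm n i)]
            gcongr
            exact setLIntegral_contExtension_le hM hF hx
              (uniformNode_mem (Finset.mem_range.1 hi).le).1
        _ ≤ V * K := by
            rw [← Finset.sum_mul, hVc]
            gcongr
            exact sum_enorm_uniformNode_le η n
    calc ∫⁻ s in Ioc (0 : ℝ) t, ‖Φ (historySegment S x f ⟨F, hF, hx⟩ s.toNNReal)‖ₑ
        ≤ ∫⁻ s in Ioc (0 : ℝ) t, liminf (fun n => Y n s) atTop :=
          setLIntegral_mono' measurableSet_Ioc fun s hs => hpt s hs.1.le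
      _ ≤ liminf (fun n => ∫⁻ s in Ioc (0 : ℝ) t, Y n s) atTop :=
          lintegral_liminf_le hYm
      _ ≤ V * K := liminf_le_of_le (by isBoundedDefault) fun b hb => by
          obtain ⟨n, hn⟩ := hb.exists
          exact hn.trans (hYi n)
      _ = _ := by
          rw [hK, ← mul_assoc, ENNReal.coe_mul, ENNReal.coe_add, ENNReal.coe_mul,
            ENNReal.coe_rpow_of_nonneg _ he.le]
          rfl

end Stieltjes

/-! ### Generation and stability -/

/-- If `𝒜 ⊆ G` for a generator `G`, `l - 𝒜` is surjective and `l - G` is injective, then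
`G = 𝒜`. -/
theorem C0Semigroup.generator_eq_of_le {Y : Type*} [NormedAddCommGroup Y] [NormedSpace ℂ Y]
    [CompleteSpace Y] (T : C0Semigroup Y) {C ω : ℝ}
    (hT : ∀ t : ℝ≥0, ‖T.toFun t‖ ≤ C * Real.exp (ω * t)) {A : Y →ₗ.[ℂ] Y}
    (hA : A.graph ≤ T.generatorGraph) {l : ℂ} (hl : ω < l.re)
    (hs : ∀ v, ∃ u ∈ A.graph, l • u.1 - u.2 = v) : T.generator = A := by
  refine LinearPMap.eq_of_eq_graph ?_
  rw [T.generator_graph]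
  refine le_antisymm (fun u hu => ?_) hA
  obtain ⟨v, hv, hvu⟩ := hs (l • u.1 - u.2)
  have h1 := T.generatorGraph.sub_mem (hA hv) hu
  have h2 : (v - u).2 = l • (v - u).1 := by
    rw [Prod.snd_sub, Prod.fst_sub, smul_sub, ← sub_eq_zero]
    have := sub_eq_zero.2 hvu
    rw [← neg_eq_zero, ← this]
    abel
  have h3 : (v - u).1 = 0 := T.eq_zero_of_mem_generatorGraph hT hl (by rw [← h2]; exact h1)
  have h4 : v = u := by
    rw [h3, smul_zero] at h2
    exact sub_eq_zero.1 (Prod.ext h3 h2)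
  exact h4 ▸ hv

theorem corollary5p4 {X : Type*} [NormedAddCommGroup X] [NormedSpace ℂ X] [CompleteSpace X]
    (p : ℝ≥0∞) [Fact (1 ≤ p)] (hp : p ≠ ⊤)
    (A : X →ₗ.[ℂ] X) (S : C0Semigroup X) (hA : S.generator = A)
    (hS : S.ImmediatelyNormContinuous)
    (Φ : W1p X p →L[ℂ] X) (hΦ : ConditionK S Φ ∨ (1 < p ∧ IsStieltjesDelay Φ))
    (hω : S.growthBound < 0) (α : ℝ) (hα : S.growthBound < (α : EReal)) (hα0 : α ≤ 0)
    (h : (⨆ ω : ℝ, ‖Φ.comp (expTensor X p ((α : ℂ) + Complex.I * (ω : ℂ)))‖ₑ) <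
      (⨆ ω : ℝ, ‖unboundedResolvent A ((α : ℂ) + Complex.I * (ω : ℂ))‖ₑ)⁻¹) :
    ∃ T : C0Semigroup (DelaySpace X p), T.generator = delayOperator A Φ ∧
      T.growthBound < (α : EReal) ∧ α ≤ 0 := by
  subst hA
  obtain ⟨r, hr, M, hM0, hM⟩ := S.exists_growth_of_growthBound_lt hα
  have hr0 : r < 0 := hr.trans_le hα0
  have hMM : ∀ t : ℝ≥0, ‖S.toFun t‖ ≤ (M.toNNReal : ℝ) := fun t => by
    rw [Real.coe_toNNReal M hM0.le]
    refine (hM t).trans (mul_le_of_le_one_right hM0.le (Real.exp_le_one_iff.2 ?_))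
    exact mul_nonpos_of_nonpos_of_nonneg hr0.le t.coe_nonneg
  have hK : ConditionK S Φ := hΦ.elim id fun hΦ => hΦ.2.conditionK hΦ.1 hp hMM
  obtain ⟨c, hc1, hc⟩ := exists_norm_resolvent_comp_le S Φ hM hr hα0 h
  have hR : ∀ l : ℂ, α ≤ l.re →
      IsResolventAt S.generator l (unboundedResolvent S.generator l) := fun l hl =>
    S.isResolventAt hM (hr.trans_le hl)
  obtain ⟨T, hTg, hTc, C, ω, hTn⟩ :=
    exists_delaySemigroup Φ (memLp_orbitKernel S hS hM hr0 hp) hp hS hMM hK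
  have hgen : T.generator = delayOperator S.generator Φ := by
    -- `l` lies in the half plane of the resolvent bound and to the right of the growth bound of `T`
    set l : ℂ := ((max α (ω + 1) : ℝ) : ℂ) with hl
    have hlre : l.re = max α (ω + 1) := Complex.ofReal_re _
    have hl1 : α ≤ l.re := by rw [hlre]; exact le_max_left _ _
    have hl2 : ω < l.re := by rw [hlre]; exact (lt_add_one ω).trans_le (le_max_right _ _)
    refine T.generator_eq_of_le hTn ((delayOperator_graph S.generator Φ).trans_le hTg) hl2 ?_
    rw [delayOperator_graph]
    exact delayGraph_surjective Φ (hR l hl1) ((hc l hl1).trans_lt hc1)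
  refine ⟨T, hgen, T.growthBound_lt_of_lower_bound hTc fun l hl => ?_, hα0⟩
  obtain ⟨K, hK⟩ := delayGraph_lower_bound Φ (hR l hl) ((hc l hl).trans_lt hc1)
  refine ⟨K, fun u hu => hK u ?_⟩
  rw [← T.generator_graph, hgen, delayOperator_graph] at hu
  exact hu

end
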